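/- Fix $T>0$ and consider real-valued functions on $(0,T)$; write $L^2=L^2(0,T)$. **Function spaces.** For $\ell\in\mathbb N\cup\{0\}$, $H^\ell(0,T)$ is the usual Sobolev space of $u\in L^2$ whose weak derivatives up to order $\ell$ lie in $L^2$, with $\|u\|_{H^\ell}^2=\sum_{k=0}^{\ell}\|\frac{d^k}{dt^k}u\|_{L^2}^2$. For $0<\theta<1$, $H^\theta(0,T)$ is the space of $u\in L^2$ for which $$\|u\|_{H^\theta}^2=\|u\|_{L^2}^2+\int_0^T\!\!\int_0^T\frac{|u(t)-u(s)|^2}{|t-s|^{1+2\theta}}\,dt\,ds<\infty .$$ Set $H_0(0,T)=L^2$. For $0<\gamma\le 1$ set $$H_\gamma(0,T)=\begin{cases}H^\gamma(0,T), & 0<\gamma<\frac12,\\ \{u\in H^{1/2}(0,T):\ \int_0^T t^{-1}|u(t)|^2\,dt<\infty\}, & \gamma=\frac12,\\ \{u\in H^\gamma(0,T):\ u(0)=0\}, & \frac12<\gamma\le1,\end{cases}$$ with norm $\|u\|_{H_\gamma}=\|u\|_{H^\gamma}$ if $\gamma\ne\frac12$ and $\|u\|_{H_{1/2}}^2=\|u\|_{H^{1/2}}^2+\int_0^T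 t^{-1}|u(t)|^2\,dt$. Here $u(0)$ is the value at $0$ of the continuous representative of $u$ on $[0,T]$. For $\gamma>1$ write $\gamma=\ell+\theta$ with $\ell\in\mathbb N$, $0\le\theta<1$, and let $H_\gamma(0,T)$ be the set of $u\in H^\ell(0,T)$ with $\frac{d^k}{dt^k}u(0)=0$ for $k=0,\dots,\ell-1$ and $\frac{d^\ell}{dt^\ell}u\in H_\theta(0,T)$, with norm $\|u\|_{H_\gamma}^2=\|u\|_{H^\ell}^2+\|\frac{d^\ell}{dt^\ell}u\|_{H_\theta}^2$. **Operators.** For $\gamma>0$ and $v\in L^2$ let $J^\gamma v(t)=\int_0^t\frac{(t-s)^{\gamma-1}}{\Gamma(\gamma)}v(s)\,ds$, an element of $L^2$, and let $\partial_t^\gamma:=(J^\gamma)^{-1}$ be the inverse of $J^\gamma$, defined on the range $J^\gamma L^2$. **Theorem.** (A) Let $\alpha>0$ and $\beta\ge0$. (i) $J^\alpha$ maps $H_\beta(0,T)$ bijectively onto $H_{\alpha+\beta}(0,T)$, and there are constants $C_1,C_2>0$, depending only on $\alpha,\beta,T$, such that for all $u\in H_\beta(0,T)$ $$C_2\|J^\alpha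 u\|_{H_{\alpha+\beta}}\le\|u\|_{H_\beta}\le C_1\|J^\alpha u\|_{H_{\alpha+\beta}}.$$ (ii) $\partial_t^\alpha$ maps $H_{\alpha+\beta}(0,T)$ bijectively onto $H_\beta(0,T)$, and there are constants $C_1,C_2>0$, depending only on $\alpha,\beta,T$, such that for all $u\in H_{\alpha+\beta}(0,T)$ $$C_2\|\partial_t^\alpha u\|_{H_\beta}\le\|u\|_{H_{\alpha+\beta}}\le C_1\|\partial_t^\alpha u\|_{H_\beta}.$$ (B) Let $\gamma>0$. (i) $J^\gamma$ maps $L^2$ bijectively onto $H_\gamma(0,T)$, and there are constants $C_1,C_2>0$, depending only on $\gamma,T$, such that for all $v\in L^2$ $$C_2\|J^\gamma v\|_{H_\gamma}\le\|v\|_{L^2}\le C_1\|J^\gamma v\|_{H_\gamma}.$$ (ii) $\partial_t^\gamma J^\gamma v=v$ for all $v\in L^2$, and $J^\gamma\partial_t^\gamma u=u$ for all $u\in H_\gamma(0,T)$. (iii) There are constants $C_1,C_2>0$, depending only on $\gamma,T$, such that for all $u\in H_\gamma(0,T)$ $$C_2\|\partial_t^\gamma u\|_{L^2}\le\|u\|_{H_\gamma}\le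 C_1\|\partial_t^\gamma u\|_{L^2}.$$ -/

import Mathlib

noncomputable section

namespace FracSob

open MeasureTheory Set
open scoped ENNReal

/-- `L²(0,T)` (real valued, classes modulo a.e. equality). -/
abbrev L2 (T : ℝ) : Type := Lp ℝ 2 (volume.restrict (Ioo (0 : ℝ) T))

/-! ### The Riemann–Liouville fractional integral -/

/-- The pointwise Riemann–Liouville integral `∫₀ᵗ (t-s)^(γ-1) / Γ(γ) · v(s) ds`. -/
def rlIntegral (γ : ℝ) (v : ℝ → ℝ) (t : ℝ) : ℝ :=
  ∫ s in (0 : ℝ)..t, (t - s) ^ (γ - 1) / Real.Gamma γ * v s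

/-- The kernel of the Riemann–Liouville integral, cut off to `0 < s < t < T`. -/
def rlKer (γ T t s : ℝ) : ℝ :=
  if 0 < s ∧ s < t ∧ t < T then (t - s) ^ (γ - 1) / Real.Gamma γ else 0

lemma measurable_rlKer (γ T : ℝ) : Measurable (fun p : ℝ × ℝ => rlKer γ T p.1 p.2) := by
  unfold rlKer
  refine Measurable.ite ?_ (by fun_prop) measurable_const
  exact (measurableSet_lt measurable_const measurable_snd).inter
    ((measurableSet_lt measurable_snd measurable_fst).inter
      (measurableSet_lt measurable_fst measurable_const))

lemma rlIntegral_eq (γ T t : ℝ) (ht : t ∈ Ioo (0 : ℝ) T) (v : ℝ → ℝ) :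
    rlIntegral γ v t = ∫ s in Ioo (0 : ℝ) T, rlKer γ T t s * v s := by
  unfold rlIntegral
  rw [intervalIntegral.integral_of_le ht.1.le, integral_Ioc_eq_integral_Ioo,
    ← integral_indicator measurableSet_Ioo, ← integral_indicator measurableSet_Ioo]
  congr 1
  ext s
  by_cases hs : s ∈ Ioo (0 : ℝ) t
  · have hs' : s ∈ Ioo (0 : ℝ) T := ⟨hs.1, hs.2.trans ht.2⟩
    rw [indicator_of_mem hs, indicator_of_mem hs', rlKer, if_pos ⟨hs.1, hs.2, ht.2⟩]
  · have h0 : rlKer γ T t s = 0 := if_neg (fun h => hs ⟨h.1, h.2.1⟩)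
    rw [indicator_of_notMem hs, indicator_apply, h0]
    simp

/-- The total mass of the kernel on `(0,T)`. -/
def rlMass (γ T : ℝ) : ℝ≥0∞ :=
  ∫⁻ r, (Ioo (0 : ℝ) T).indicator (fun r => ‖r ^ (γ - 1) / Real.Gamma γ‖ₑ) r

lemma rlMass_ne_top (γ T : ℝ) (hγ : 0 < γ) : rlMass γ T ≠ ⊤ := by
  unfold rlMass
  rw [lintegral_indicator measurableSet_Ioo]
  have h : IntervalIntegrable (fun r : ℝ => r ^ (γ - 1)) volume 0 (max T 0) :=
    intervalIntegral.intervalIntegrable_rpow' (by linarith)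
  have h2 : IntegrableOn (fun r : ℝ => r ^ (γ - 1)) (Ioo 0 T) volume :=
    h.1.mono_set (fun x hx => ⟨hx.1, hx.2.le.trans (le_max_left _ _)⟩)
  exact (h2.div_const (Real.Gamma γ)).2.ne

lemma enorm_rlKer_le (γ T t s : ℝ) :
    ‖rlKer γ T t s‖ₑ ≤
      (Ioo (0 : ℝ) T).indicator (fun r => ‖r ^ (γ - 1) / Real.Gamma γ‖ₑ) (t - s) := by
  unfold rlKer
  split_ifs with h
  · rw [indicator_of_mem]
    exact ⟨by linarith, by linarith⟩
  · simp

lemma lintegral_rlKer_left (γ T s : ℝ) : ∫⁻ t, ‖rlKer γ T t s‖ₑ ≤ rlMass γ T :=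
  (lintegral_mono fun t => enorm_rlKer_le γ T t s).trans_eq
    (lintegral_sub_right_eq_self _ s)

lemma lintegral_rlKer_right (γ T t : ℝ) : ∫⁻ s, ‖rlKer γ T t s‖ₑ ≤ rlMass γ T :=
  (lintegral_mono fun s => enorm_rlKer_le γ T t s).trans_eq
    (lintegral_sub_left_eq_self _ t)

lemma enorm_rlKer_integral_sq_le (γ T t : ℝ) (v : ℝ → ℝ) (hv : Measurable v) :
    ‖∫ s in Ioo (0 : ℝ) T, rlKer γ T t s * v s‖ₑ ^ (2 : ℝ) ≤
      rlMass γ T * ∫⁻ s in Ioo (0 : ℝ) T, ‖rlKer γ T t s‖ₑ * ‖v s‖ₑ ^ (2 : ℝ) := by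
  have hk : Measurable (fun s => ‖rlKer γ T t s‖ₑ) :=
    ((measurable_rlKer γ T).comp (measurable_const.prodMk measurable_id)).enorm
  have hsplit : ∀ s, ‖rlKer γ T t s * v s‖ₑ =
      ‖rlKer γ T t s‖ₑ ^ (1 / 2 : ℝ) * (‖rlKer γ T t s‖ₑ ^ (1 / 2 : ℝ) * ‖v s‖ₑ) := by
    intro s
    rw [← mul_assoc, ← ENNReal.rpow_add_of_nonneg _ _ (by norm_num) (by norm_num), enorm_mul]
    norm_num
  have hpq : (2 : ℝ).HolderConjugate 2 := Real.HolderConjugate.two_two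
  have h1 : ‖∫ s in Ioo (0 : ℝ) T, rlKer γ T t s * v s‖ₑ ≤
      (∫⁻ s in Ioo (0 : ℝ) T, ‖rlKer γ T t s‖ₑ) ^ (1 / 2 : ℝ) *
        (∫⁻ s in Ioo (0 : ℝ) T, ‖rlKer γ T t s‖ₑ * ‖v s‖ₑ ^ (2 : ℝ)) ^ (1 / 2 : ℝ) := by
    refine (enorm_integral_le_lintegral_enorm _).trans ?_
    simp_rw [hsplit]
    refine (ENNReal.lintegral_mul_le_Lp_mul_Lq _ hpq (hk.pow_const _).aemeasurable
      ((hk.pow_const _).mul hv.enorm).aemeasurable).trans_eq ?_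
    simp_rw [Pi.mul_apply, ENNReal.mul_rpow_of_nonneg _ _ (zero_le_two : (0 : ℝ) ≤ 2), ← ENNReal.rpow_mul]
    norm_num
  calc _ ≤ _ := ENNReal.rpow_le_rpow h1 zero_le_two
    _ = (∫⁻ s in Ioo (0 : ℝ) T, ‖rlKer γ T t s‖ₑ) *
        ∫⁻ s in Ioo (0 : ℝ) T, ‖rlKer γ T t s‖ₑ * ‖v s‖ₑ ^ (2 : ℝ) := by
      rw [ENNReal.mul_rpow_of_nonneg _ _ (zero_le_two : (0 : ℝ) ≤ 2), ← ENNReal.rpow_mul,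
        ← ENNReal.rpow_mul]
      norm_num
    _ ≤ _ := by
      gcongr
      exact (setLIntegral_le_lintegral _ _).trans (lintegral_rlKer_right γ T t)

/-- The Riemann–Liouville integral of order `γ > 0` of an `L²(0,T)` function is in `L²(0,T)`. -/
theorem memLp_rlIntegral {γ : ℝ} (hγ : 0 < γ) {T : ℝ} (v : L2 T) :
    MemLp (rlIntegral γ v) 2 (volume.restrict (Ioo (0 : ℝ) T)) := by
  have hv : Measurable (v : ℝ → ℝ) := (Lp.stronglyMeasurable v).measurable
  have hF : Measurable (fun p : ℝ × ℝ => rlKer γ T p.1 p.2 * v p.2) :=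
    (measurable_rlKer γ T).mul (hv.comp measurable_snd)
  have hmeas : StronglyMeasurable
      (fun t => ∫ s in Ioo (0 : ℝ) T, rlKer γ T t s * v s) :=
    hF.stronglyMeasurable.integral_prod_right'
  have hae : (fun t => ∫ s in Ioo (0 : ℝ) T, rlKer γ T t s * v s)
      =ᵐ[volume.restrict (Ioo (0 : ℝ) T)] rlIntegral γ v := by
    filter_upwards [ae_restrict_mem measurableSet_Ioo] with t ht
    exact (rlIntegral_eq γ T t ht v).symm
  refine MemLp.ae_eq hae ⟨hmeas.aestronglyMeasurable, ?_⟩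
  refine (eLpNorm_lt_top_iff_lintegral_rpow_enorm_lt_top (by norm_num) (by norm_num)).2 ?_
  have hvfin : ∫⁻ s in Ioo (0 : ℝ) T, ‖v s‖ₑ ^ (2 : ℝ) < ⊤ := by
    simpa using (eLpNorm_lt_top_iff_lintegral_rpow_enorm_lt_top (p := 2)
      (by norm_num) (by norm_num)).1 (Lp.memLp v).2
  have hk2 : Measurable (fun p : ℝ × ℝ => ‖rlKer γ T p.1 p.2‖ₑ * ‖v p.2‖ₑ ^ (2 : ℝ)) :=
    (measurable_rlKer γ T).enorm.mul ((hv.comp measurable_snd).enorm.pow_const _)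
  have hM := rlMass_ne_top γ T hγ
  simp only [ENNReal.toReal_ofNat]
  calc _ ≤ ∫⁻ t in Ioo (0 : ℝ) T, rlMass γ T *
          ∫⁻ s in Ioo (0 : ℝ) T, ‖rlKer γ T t s‖ₑ * ‖v s‖ₑ ^ (2 : ℝ) :=
        lintegral_mono fun t => enorm_rlKer_integral_sq_le γ T t v hv
    _ = rlMass γ T * ∫⁻ t in Ioo (0 : ℝ) T,
          ∫⁻ s in Ioo (0 : ℝ) T, ‖rlKer γ T t s‖ₑ * ‖v s‖ₑ ^ (2 : ℝ) :=
        lintegral_const_mul' _ _ hM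
    _ = rlMass γ T * ∫⁻ s in Ioo (0 : ℝ) T,
          ∫⁻ t in Ioo (0 : ℝ) T, ‖rlKer γ T t s‖ₑ * ‖v s‖ₑ ^ (2 : ℝ) := by
        rw [lintegral_lintegral_swap hk2.aemeasurable]
    _ ≤ rlMass γ T * ∫⁻ s in Ioo (0 : ℝ) T, rlMass γ T * ‖v s‖ₑ ^ (2 : ℝ) := by
        gcongr with s
        rw [lintegral_mul_const' _ _ (by finiteness)]
        gcongr
        exact (setLIntegral_le_lintegral _ _).trans (lintegral_rlKer_left γ T s)
    _ = rlMass γ T * (rlMass γ T * ∫⁻ s in Ioo (0 : ℝ) T, ‖v s‖ₑ ^ (2 : ℝ)) := by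
        rw [lintegral_const_mul' _ _ hM]
    _ < ⊤ := by
        have := hvfin.ne
        finiteness

/-- The Riemann–Liouville operator `J^γ : L²(0,T) → L²(0,T)` for `γ ≥ 0`; `J^0` is the identity
(and so is, by convention, the unused case of negative order). -/
def J (T γ : ℝ) (v : L2 T) : L2 T :=
  if h : 0 < γ then (memLp_rlIntegral h v).toLp (rlIntegral γ v) else v

/-- `∂_t^γ := (J^γ)⁻¹`, the inverse of `J^γ : L²(0,T) → L²(0,T)` on its range
(with an irrelevant value off the range). -/
def dt (T γ : ℝ) : L2 T → L2 T := Function.invFun (J T γ)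

/-! ### Sobolev spaces of integer order -/

/-- `v` is the weak derivative of order `k` of `u` on `(0,T)`. -/
def HasWeakDeriv (T : ℝ) (k : ℕ) (u v : L2 T) : Prop :=
  ∀ φ : ℝ → ℝ, ContDiff ℝ (⊤ : ℕ∞) φ → HasCompactSupport φ → tsupport φ ⊆ Ioo (0 : ℝ) T →
    ∫ t in Ioo (0 : ℝ) T, u t * iteratedDeriv k φ t =
      (-1) ^ k * ∫ t in Ioo (0 : ℝ) T, v t * φ t

open Classical in
/-- The weak derivative `d^k u / dt^k` in `L²(0,T)`; it is `0` if there is none. -/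
def weakDeriv (T : ℝ) (k : ℕ) (u : L2 T) : L2 T :=
  if h : ∃ v, HasWeakDeriv T k u v then h.choose else 0

/-- `H^ℓ(0,T)`: the weak derivatives of order at most `ℓ` exist in `L²(0,T)`. -/
def sobolev (T : ℝ) (ℓ : ℕ) : Set (L2 T) :=
  {u | ∀ k ≤ ℓ, ∃ v, HasWeakDeriv T k u v}

/-- The norm of `H^ℓ(0,T)`. -/
def sobolevNorm (T : ℝ) (ℓ : ℕ) (u : L2 T) : ℝ :=
  √(∑ k ∈ Finset.range (ℓ + 1), ‖weakDeriv T k u‖ ^ 2)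

/-- `u(0) = 0`, for (the class of) a function that has a continuous representative on `[0,T]`. -/
def VanishesAtZero (T : ℝ) (u : L2 T) : Prop :=
  ∃ g : ℝ → ℝ, ContinuousOn g (Icc 0 T) ∧ u =ᵐ[volume.restrict (Ioo (0 : ℝ) T)] g ∧ g 0 = 0

/-! ### Sobolev–Slobodeckij spaces of order in `[0,1]` -/

/-- `∫₀ᵀ ∫₀ᵀ |u(t)-u(s)|² / |t-s|^(1+2θ) dt ds`, with values in `[0,∞]`. -/
def gagliardo (T θ : ℝ) (u : L2 T) : ℝ≥0∞ :=
  ∫⁻ s in Ioo (0 : ℝ) T, ∫⁻ t in Ioo (0 : ℝ) T,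
    ENNReal.ofReal (|u t - u s| ^ 2 / |t - s| ^ (1 + 2 * θ))

/-- `∫₀ᵀ t⁻¹ |u(t)|² dt`, with values in `[0,∞]`. -/
def weightInt (T : ℝ) (u : L2 T) : ℝ≥0∞ :=
  ∫⁻ t in Ioo (0 : ℝ) T, ENNReal.ofReal (t⁻¹ * |u t| ^ 2)

/-- `H^θ(0,T)` for `0 ≤ θ ≤ 1` (upper index). -/
def slobodeckij (T θ : ℝ) : Set (L2 T) :=
  if θ = 0 then univ else if θ = 1 then sobolev T 1 else {u | gagliardo T θ u < ⊤}

/-- The norm of `H^θ(0,T)` for `0 ≤ θ ≤ 1` (upper index). -/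
def slobodeckijNorm (T θ : ℝ) (u : L2 T) : ℝ :=
  if θ = 0 then ‖u‖ else if θ = 1 then sobolevNorm T 1 u
  else √(‖u‖ ^ 2 + (gagliardo T θ u).toReal)

/-! ### The spaces `H_γ(0,T)` (lower index) -/

/-- `H_θ(0,T)` for `0 ≤ θ ≤ 1`. -/
def lowH (T θ : ℝ) : Set (L2 T) :=
  if θ < 1 / 2 then slobodeckij T θ
  else if θ = 1 / 2 then {u | u ∈ slobodeckij T (1 / 2) ∧ weightInt T u < ⊤}
  else {u | u ∈ slobodeckij T θ ∧ VanishesAtZero T u}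

/-- The norm of `H_θ(0,T)` for `0 ≤ θ ≤ 1`. -/
def lowHNorm (T θ : ℝ) (u : L2 T) : ℝ :=
  if θ = 1 / 2 then √(slobodeckijNorm T (1 / 2) u ^ 2 + (weightInt T u).toReal)
  else slobodeckijNorm T θ u

/-- `H_ℓ(0,T)` for `ℓ ∈ ℕ`: the elements of `H^ℓ(0,T)` with
`d^k u / dt^k (0) = 0` for `k = 0, …, ℓ - 1`. -/
def natH (T : ℝ) (ℓ : ℕ) : Set (L2 T) :=
  {u | u ∈ sobolev T ℓ ∧ ∀ k < ℓ, VanishesAtZero T (weakDeriv T k u)}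

/-- `H_γ(0,T)` for `γ ≥ 0`. For `γ > 1`, with `γ = ℓ + θ`, `ℓ = ⌊γ⌋`, `0 ≤ θ < 1`, it consists of
the `u ∈ H_ℓ(0,T)` with `d^ℓ u / dt^ℓ ∈ H_θ(0,T)`. -/
def H (T γ : ℝ) : Set (L2 T) :=
  if γ ≤ 1 then lowH T γ
  else {u | u ∈ natH T ⌊γ⌋₊ ∧ weakDeriv T ⌊γ⌋₊ u ∈ lowH T (Int.fract γ)}

/-- The norm of `H_γ(0,T)` for `γ ≥ 0`. -/
def HNorm (T γ : ℝ) (u : L2 T) : ℝ :=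
  if γ ≤ 1 then lowHNorm T γ u
  else √(sobolevNorm T ⌊γ⌋₊ u ^ 2 + lowHNorm T (Int.fract γ) (weakDeriv T ⌊γ⌋₊ u) ^ 2)

end FracSob

end

/-!
# Riemann–Liouville operators as isomorphisms of the scale `H_γ(0,T)`

The statement for two orders `α` and `β` follows from the case `β = 0`: if `J^γ` is an isomorphism
of `L²(0,T)` onto `H_γ(0,T)` for every `γ ≥ 0` (`isIsoOnto`), then the semigroup property
`J^α J^β = J^(α+β)` (`J_J`) and the injectivity of `J^γ` (`J_injective`) carry this over to
`J^α : H_β → H_(α+β)`, and to its inverse `∂_t^α`.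

For `γ ≥ 1`, weak differentiation lowers the order of `J^γ v` by one, and conversely a function
whose derivatives of order below `ℓ` vanish at `0` is the `ℓ`-fold primitive of its `ℓ`-th
derivative (`eq_J_weakDeriv`, from the du Bois-Reymond lemma). This reduces everything to
`0 < γ < 1`, which is a matter of Fourier analysis on the line.

*The operator maps into the space.* On `(0,T)`, `J^γ v` is the convolution of the extension of `v`
by zero with the kernel `t^(γ-1) / Γ(γ)` cut off to `(0,T)`. The Fourier transform of the truncated
kernel is still `O(|ξ|^(-γ))` (`norm_fhat_kker_le`), while the Gagliardo seminorm of a function `f`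
on the line is `∫ |ξ|^(2γ) |f̂(ξ)|² dξ` up to a constant (`gag_eq_fourier`); so the convolution has
finite Gagliardo seminorm on the whole line (`gag_conv_kker_le`). As it vanishes on `(-∞,0]`, the
interaction of `(0,T)` with the negative half-line yields the weighted integral for `γ = 1/2`. For
`γ > 1/2` the kernel is square integrable, so that the convolution is continuous, with value `0`
at `0` (`vanishesAtZero_J`).

*The operator is onto.* Let `u ∈ H_γ(0,T)`. The fractional Hardy inequality bounds
`∫ t^(-2γ) |u|²` by the norm of `u` (`hardy_lt_half`, `hardy_gt_half`; for `γ = 1/2` this integral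
is part of the norm). Hence the even reflection of `u` at `T`, extended by zero, is a function `U`
on the line with finite Gagliardo seminorm (`gag_reflectExt_le`) that vanishes on `(-∞,0]`. Let
`U_h` be its backward difference quotients. By the decay of the kernel of order `1 - γ`, the
functions `J^(1-γ) U_h` are bounded in `L²` by the Gagliardo seminorm of `U`, uniformly in `h`
(`lintegral_conv_diffQuot_sq_le`), and `J^γ J^(1-γ) U_h = J^1 U_h` is the mean value of `U` over
`(t-h,t)`, which tends to `u` in `L²(0,T)`. Weak compactness of balls in `L²` gives `w` with
`J^γ w = u` and the bound for `w` (`exists_J_eq_of_gag`).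
-/

noncomputable section

namespace FracSob

open MeasureTheory Set Filter Topology
open scoped ENNReal FourierTransform SchwartzMap

/-! ### Plancherel's identity for integrable functions -/

/-- For a function that is integrable and square integrable, the `L²` Fourier transform agrees with
the Fourier integral: both define the same tempered distribution. -/
lemma fourier_toLp_ae {f : ℝ → ℂ} (hf : Integrable f) (hf2 : MemLp f 2) :
    (𝓕 (hf2.toLp f) : Lp ℂ 2 (volume : Measure ℝ)) =ᵐ[volume] 𝓕 f := by
  have hc : Continuous (𝓕 f) := VectorFourier.fourierIntegral_continuous
    Real.continuous_fourierChar (by exact continuous_inner) hf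
  refine ae_eq_of_integral_contDiff_smul_eq
    ((Lp.memLp _).locallyIntegrable (by norm_num)) hc.locallyIntegrable fun g hg hgs => ?_
  have hgc : ContDiff ℝ (⊤ : ℕ∞) (fun x => (g x : ℂ)) := Complex.ofRealCLM.contDiff.comp hg
  let φ : 𝓢(ℝ, ℂ) := (hgs.comp_left (g := ((↑) : ℝ → ℂ)) (by simp)).toSchwartzMap hgc
  have hφ : ∀ x, φ x = g x := fun x => rfl
  have h1 := congrArg (fun D => D φ) (Lp.fourier_toTemperedDistribution_eq (hf2.toLp f))
  simp only [TemperedDistribution.fourier_apply, Lp.toTemperedDistribution_apply, hφ] at h1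
  have h2 := VectorFourier.integral_fourierIntegral_smul_eq_flip (μ := volume) (ν := volume)
    (L := innerₗ ℝ) (f := (φ : ℝ → ℂ)) (g := f) Real.continuous_fourierChar
    (by exact continuous_inner) φ.integrable hf
  have h3 : ∫ x, (𝓕 φ) x • (hf2.toLp f) x = ∫ x, (𝓕 φ) x • f x := by
    refine integral_congr_ae ?_
    filter_upwards [hf2.coeFn_toLp] with x hx
    rw [hx]
  rw [h3] at h1
  simp only [Complex.real_smul]
  rw [flip_innerₗ] at h2
  simp only [smul_eq_mul] at h1 h2
  rw [← h1]
  rw [SchwartzMap.fourier_coe]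
  exact h2

/-- An integrable function with square integrable Fourier transform is square integrable: it agrees,
as a tempered distribution, with the inverse `L²` Fourier transform of its Fourier transform. -/
lemma memLp_two_of_memLp_fourier {f : ℝ → ℂ} (hf : Integrable f) (hf2 : MemLp (𝓕 f) 2) :
    MemLp f 2 := by
  set G : Lp ℂ 2 (volume : Measure ℝ) := 𝓕⁻ (hf2.toLp (𝓕 f)) with hG
  have hFG : 𝓕 G = hf2.toLp (𝓕 f) := FourierTransform.fourier_fourierInv_eq _
  refine MemLp.ae_eq ?_ (Lp.memLp G)
  refine ae_eq_of_integral_contDiff_smul_eq ((Lp.memLp _).locallyIntegrable (by norm_num))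
    hf.locallyIntegrable fun g hg hgs => ?_
  have hgc : ContDiff ℝ (⊤ : ℕ∞) (fun x => (g x : ℂ)) := Complex.ofRealCLM.contDiff.comp hg
  let φ : 𝓢(ℝ, ℂ) := (hgs.comp_left (g := ((↑) : ℝ → ℂ)) (by simp)).toSchwartzMap hgc
  have hφ : ∀ x, φ x = g x := fun x => rfl
  have h1 := congrArg (fun D => D (𝓕⁻ φ)) (Lp.fourier_toTemperedDistribution_eq G)
  simp only [TemperedDistribution.fourier_apply, Lp.toTemperedDistribution_apply, hφ, hFG,
    FourierTransform.fourier_fourierInv_eq] at h1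
  have h2 := VectorFourier.integral_fourierIntegral_smul_eq_flip (μ := volume) (ν := volume)
    (L := innerₗ ℝ) (f := (𝓕⁻ φ : 𝓢(ℝ, ℂ))) (g := f) Real.continuous_fourierChar
    (by exact continuous_inner) (𝓕⁻ φ).integrable hf
  have h3 : ∫ x, (𝓕⁻ φ) x • (hf2.toLp (𝓕 f)) x = ∫ x, (𝓕⁻ φ) x • (𝓕 f) x := by
    refine integral_congr_ae ?_
    filter_upwards [hf2.coeFn_toLp] with x hx
    rw [hx]
  rw [h3] at h1
  simp only [Complex.real_smul]
  rw [flip_innerₗ] at h2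
  simp only [smul_eq_mul] at h1 h2
  rw [h1]
  refine h2.symm.trans ?_
  have h4 : VectorFourier.fourierIntegral 𝐞 volume (innerₗ ℝ) ((𝓕⁻ φ : 𝓢(ℝ, ℂ)) : ℝ → ℂ) = φ := by
    conv_rhs => rw [← FourierTransform.fourier_fourierInv_eq (F := 𝓢(ℝ, ℂ)) φ]
    rw [SchwartzMap.fourier_coe]
    rfl
  rw [h4]
  rfl

lemma eLpNorm_two_pow_two {α E : Type*} [MeasurableSpace α] [NormedAddCommGroup E] (μ : Measure α)
    (f : α → E) : eLpNorm f 2 μ ^ 2 = ∫⁻ x, ‖f x‖ₑ ^ 2 ∂μ := by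
  have := eLpNorm_nnreal_pow_eq_lintegral (f := f) (μ := μ) (p := 2) (by norm_num)
  simpa using this

lemma memLp_two_iff_lintegral {α E : Type*} [MeasurableSpace α] [NormedAddCommGroup E]
    {μ : Measure α} {f : α → E} (hf : AEStronglyMeasurable f μ) :
    MemLp f 2 μ ↔ ∫⁻ x, ‖f x‖ₑ ^ 2 ∂μ < ⊤ := by
  rw [← eLpNorm_two_pow_two, MemLp, and_iff_right hf, lt_top_iff_ne_top, lt_top_iff_ne_top,
    Ne, Ne, ENNReal.pow_eq_top_iff]
  simp

/-- Plancherel's identity in `[0, ∞]` for an integrable function, square integrable or not. -/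
theorem lintegral_enorm_fourier_sq {f : ℝ → ℂ} (hf : Integrable f) :
    ∫⁻ ξ, ‖𝓕 f ξ‖ₑ ^ 2 = ∫⁻ t, ‖f t‖ₑ ^ 2 := by
  have hc : Continuous (𝓕 f) := VectorFourier.fourierIntegral_continuous
    Real.continuous_fourierChar (by exact continuous_inner) hf
  by_cases h2 : MemLp f 2
  · rw [← eLpNorm_two_pow_two, ← eLpNorm_two_pow_two, ← eLpNorm_congr_ae (fourier_toLp_ae hf h2),
      ← Lp.enorm_def, ← ofReal_norm, Lp.norm_fourier_eq, ofReal_norm, Lp.enorm_def,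
      eLpNorm_congr_ae h2.coeFn_toLp]
  · have h3 : ¬ MemLp (𝓕 f) 2 := fun h => h2 (memLp_two_of_memLp_fourier hf h)
    rw [memLp_two_iff_lintegral hf.1] at h2
    rw [memLp_two_iff_lintegral hc.aestronglyMeasurable] at h3
    rw [not_lt_top_iff.1 h2, not_lt_top_iff.1 h3]

/-! ### Fourier transforms and convolutions of real functions -/

/-- The Fourier transform `∫ exp(-2πi t ξ) f(t) dt` of a real function. -/
def fhat (f : ℝ → ℝ) (ξ : ℝ) : ℂ := 𝓕 (fun t => (f t : ℂ)) ξ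

/-- The convolution `∫ f(s) k(t-s) ds` of two real functions on the line. -/
def conv (f k : ℝ → ℝ) : ℝ → ℝ := convolution f k (ContinuousLinearMap.mul ℝ ℝ) volume

lemma conv_apply (f k : ℝ → ℝ) (t : ℝ) : conv f k t = ∫ s, f s * k (t - s) := rfl

lemma integrable_conv {f k : ℝ → ℝ} (hf : Integrable f) (hk : Integrable k) :
    Integrable (conv f k) :=
  hf.integrable_convolution _ hk

lemma ae_convExists {f k : ℝ → ℝ} (hf : Integrable f) (hk : Integrable k) :
    ∀ᵐ t, Integrable fun s => f s * k (t - s) :=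
  hf.ae_convolution_exists (ContinuousLinearMap.mul ℝ ℝ) hk

lemma continuous_fhat {f : ℝ → ℝ} (hf : Integrable f) : Continuous (fhat f) :=
  VectorFourier.fourierIntegral_continuous Real.continuous_fourierChar
    (by exact continuous_inner) hf.ofReal

lemma lintegral_enorm_fhat_sq {f : ℝ → ℝ} (hf : Integrable f) :
    ∫⁻ ξ, ‖fhat f ξ‖ₑ ^ 2 = ∫⁻ t, ‖f t‖ₑ ^ 2 := by
  have h := lintegral_enorm_fourier_sq (hf.ofReal (𝕜 := ℂ))
  simpa [fhat, ← ofReal_norm] using h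

lemma fhat_conv {f k : ℝ → ℝ} (hf : Integrable f) (hk : Integrable k) (ξ : ℝ) :
    fhat (conv f k) ξ = fhat f ξ * fhat k ξ := by
  have hf' : Integrable fun t => (f t : ℂ) := hf.ofReal
  have hk' : Integrable fun t => (k t : ℂ) := hk.ofReal
  rw [fhat, fhat, fhat, ← Real.fourier_mul_convolution_eq hf' hk']
  refine congrArg (fun F : ℝ → ℂ => 𝓕 F ξ) (funext fun t => ?_)
  rw [conv_apply, convolution_def, ← integral_complex_ofReal]
  simp

lemma fhat_sub {f g : ℝ → ℝ} (hf : Integrable f) (hg : Integrable g) (ξ : ℝ) :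
    fhat (fun t => f t - g t) ξ = fhat f ξ - fhat g ξ := by
  simp only [fhat, Real.fourier_eq, Complex.ofReal_sub, smul_sub]
  exact integral_sub ((Real.fourierIntegral_convergent_iff ξ).2 hf.ofReal)
    ((Real.fourierIntegral_convergent_iff ξ).2 hg.ofReal)

lemma fhat_const_mul (c : ℝ) (f : ℝ → ℝ) (ξ : ℝ) :
    fhat (fun t => c * f t) ξ = c * fhat f ξ := by
  simp only [fhat, Real.fourier_eq, Complex.ofReal_mul]
  rw [← integral_const_mul]
  congr 1
  ext t
  simp only [Circle.smul_def, smul_eq_mul]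
  ring

lemma fhat_comp_add_right (f : ℝ → ℝ) (h ξ : ℝ) :
    fhat (fun t => f (t + h)) ξ = Complex.exp (2 * Real.pi * h * ξ * Complex.I) * fhat f ξ := by
  have := congrFun (VectorFourier.fourierIntegral_comp_add_right Real.fourierChar volume
    (innerₗ ℝ) (fun t => (f t : ℂ)) h) ξ
  rw [fhat, fhat]
  refine (this.trans ?_)
  rw [Circle.smul_def, Real.fourierChar_apply, smul_eq_mul]
  simp only [innerₗ_apply_apply, RCLike.inner_apply, conj_trivial]
  push_cast
  congr 2
  ring_nf

lemma norm_fhat_le (f : ℝ → ℝ) (ξ : ℝ) : ‖fhat f ξ‖ ≤ ∫ t, |f t| := by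
  rw [fhat, Real.fourier_eq]
  refine (norm_integral_le_integral_norm _).trans_eq ?_
  simp

/-- Plancherel's identity for a difference `f (· + h) - f`. -/
lemma lintegral_enorm_translate_sub_sq {f : ℝ → ℝ} (hf : Integrable f) (h : ℝ) :
    ∫⁻ t, ‖f (t + h) - f t‖ₑ ^ 2 =
      ∫⁻ ξ : ℝ, ‖Complex.exp (2 * Real.pi * h * ξ * Complex.I) - 1‖ₑ ^ 2 * ‖fhat f ξ‖ₑ ^ 2 := by
  have hfh : Integrable fun t => f (t + h) := hf.comp_add_right h
  rw [← lintegral_enorm_fhat_sq (f := fun t => f (t + h) - f t) (hfh.sub hf)]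
  refine lintegral_congr fun ξ => ?_
  rw [fhat_sub hfh hf, fhat_comp_add_right, ← mul_pow, ← enorm_mul]
  ring_nf

/-! ### The Riemann–Liouville operator as a convolution on the line -/

/-- The Riemann–Liouville kernel `t^(γ-1) / Γ(γ)` cut off to `(0,T)`. -/
def kker (γ T t : ℝ) : ℝ := (Ioo (0 : ℝ) T).indicator (fun t => t ^ (γ - 1) / Real.Gamma γ) t

/-- Extension by zero from `(0,T)` to the line. -/
def ext {T : ℝ} (v : L2 T) : ℝ → ℝ := (Ioo (0 : ℝ) T).indicator v

lemma integrable_kker {γ : ℝ} (hγ : 0 < γ) (T : ℝ) : Integrable (kker γ T) := by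
  have h : IntervalIntegrable (fun r : ℝ => r ^ (γ - 1)) volume 0 (max T 0) :=
    intervalIntegral.intervalIntegrable_rpow' (by linarith)
  have h2 : IntegrableOn (fun r : ℝ => r ^ (γ - 1)) (Ioo 0 T) volume :=
    h.1.mono_set (fun x hx => ⟨hx.1, hx.2.le.trans (le_max_left _ _)⟩)
  exact (integrable_indicator_iff measurableSet_Ioo).2 (h2.div_const (Real.Gamma γ))

lemma kker_of_nonpos (γ T : ℝ) {t : ℝ} (ht : t ≤ 0) : kker γ T t = 0 :=
  indicator_of_notMem (fun h => h.1.not_ge ht) _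

lemma ext_of_nonpos {T : ℝ} (v : L2 T) {t : ℝ} (ht : t ≤ 0) : ext v t = 0 :=
  indicator_of_notMem (fun h => h.1.not_ge ht) _

lemma integrable_ext {T : ℝ} (v : L2 T) : Integrable (ext v) :=
  (integrable_indicator_iff measurableSet_Ioo).2 ((Lp.memLp v).integrable (by norm_num))

lemma ext_congr {T : ℝ} {v : L2 T} {f : ℝ → ℝ}
    (h : v =ᵐ[volume.restrict (Ioo (0 : ℝ) T)] f) :
    ext v =ᵐ[volume] (Ioo (0 : ℝ) T).indicator f := by
  rw [Filter.EventuallyEq, ae_restrict_iff' measurableSet_Ioo] at h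
  filter_upwards [h] with t ht
  by_cases hm : t ∈ Ioo (0 : ℝ) T
  · rw [ext, indicator_of_mem hm, indicator_of_mem hm, ht hm]
  · rw [ext, indicator_of_notMem hm, indicator_of_notMem hm]

lemma lintegral_enorm_ext_sq {T : ℝ} (v : L2 T) :
    ∫⁻ t, ‖ext v t‖ₑ ^ 2 = ‖v‖ₑ ^ 2 := by
  rw [Lp.enorm_def, eLpNorm_two_pow_two, ← lintegral_indicator measurableSet_Ioo]
  refine lintegral_congr fun t => ?_
  by_cases hm : t ∈ Ioo (0 : ℝ) T
  · rw [ext, indicator_of_mem hm, indicator_of_mem hm]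
  · rw [ext, indicator_of_notMem hm, indicator_of_notMem hm]; simp

lemma conv_congr_left {f g k : ℝ → ℝ} (h : f =ᵐ[volume] g) (t : ℝ) : conv f k t = conv g k t := by
  rw [conv_apply, conv_apply]
  refine integral_congr_ae ?_
  filter_upwards [h] with s hs
  rw [hs]

/-- Causality: with a kernel supported in `(0,∞)`, the convolution up to time `T` depends only on
the values of the input up to time `T`. -/
lemma conv_congr_left_of_lt {f g k : ℝ → ℝ} {T : ℝ} (hk : ∀ t ≤ 0, k t = 0)
    (h : ∀ᵐ s, s < T → f s = g s) {t : ℝ} (ht : t ≤ T) : conv f k t = conv g k t := by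
  rw [conv_apply, conv_apply]
  refine integral_congr_ae ?_
  filter_upwards [h] with s hs
  by_cases hst : s < t
  · rw [hs (hst.trans_le ht)]
  · rw [hk _ (by linarith), mul_zero, mul_zero]

lemma conv_congr_right_of_lt {f k l : ℝ → ℝ} {T : ℝ} (hf : ∀ t ≤ 0, f t = 0)
    (h : ∀ s < T, k s = l s) {t : ℝ} (ht : t ≤ T) : conv f k t = conv f l t := by
  rw [conv_apply, conv_apply]
  congr 1
  ext s
  by_cases hs : s ≤ 0
  · rw [hf _ hs, zero_mul, zero_mul]
  · rw [h _ (by linarith)]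

lemma conv_of_nonpos {f k : ℝ → ℝ} (hf : ∀ t ≤ 0, f t = 0) (hk : ∀ t ≤ 0, k t = 0) {t : ℝ}
    (ht : t ≤ 0) : conv f k t = 0 := by
  rw [conv_apply]
  refine integral_eq_zero_of_ae (ae_of_all _ fun s => ?_)
  rcases le_total s 0 with hs | hs
  · simp [hf _ hs]
  · simp [hk (t - s) (by linarith)]

lemma rlIntegral_eq_conv (γ : ℝ) {T : ℝ} (v : L2 T) {t : ℝ} (ht : t ∈ Ioo (0 : ℝ) T) :
    rlIntegral γ v t = conv (ext v) (kker γ T) t := by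
  rw [rlIntegral_eq γ T t ht, conv_apply, ← integral_indicator measurableSet_Ioo]
  congr 1
  ext s
  by_cases hs : s ∈ Ioo (0 : ℝ) T
  · rw [ext, indicator_of_mem hs, indicator_of_mem hs, mul_comm, kker, rlKer]
    congr 1
    by_cases hst : s < t
    · rw [if_pos ⟨hs.1, hst, ht.2⟩, indicator_of_mem]
      exact ⟨by linarith, by linarith [hs.1, ht.2]⟩
    · rw [if_neg (fun h => hst h.2.1), indicator_of_notMem]
      exact fun h => hst (by linarith [h.1])
  · rw [ext, indicator_of_notMem hs, indicator_of_notMem hs, zero_mul]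

lemma J_ae {γ : ℝ} (hγ : 0 < γ) {T : ℝ} (v : L2 T) :
    J T γ v =ᵐ[volume.restrict (Ioo (0 : ℝ) T)] conv (ext v) (kker γ T) := by
  rw [J, dif_pos hγ]
  refine (MemLp.coeFn_toLp _).trans ?_
  filter_upwards [ae_restrict_mem measurableSet_Ioo] with t ht
  exact rlIntegral_eq_conv γ v ht

/-- Below time `T`, the extension by zero of `J^γ v` is the convolution of the extension of `v` with
the truncated kernel. Beyond `T` the convolution need not vanish. -/
lemma ext_J_ae {γ : ℝ} (hγ : 0 < γ) {T : ℝ} (v : L2 T) :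
    ∀ᵐ t, t < T → ext (J T γ v) t = conv (ext v) (kker γ T) t := by
  filter_upwards [ext_congr (J_ae hγ v)] with t ht htT
  rw [ht]
  by_cases h0 : 0 < t
  · rw [indicator_of_mem (show t ∈ Ioo 0 T from ⟨h0, htT⟩)]
  · rw [indicator_of_notMem (fun h => h0 h.1), conv_of_nonpos (fun _ => ext_of_nonpos v)
      (fun _ => kker_of_nonpos γ T) (not_lt.1 h0)]

/-- Young's inequality `‖f * k‖_{L²} ≤ ‖k‖_{L¹} ‖f‖_{L²}`, from the Fourier side. -/
lemma lintegral_conv_sq_le {f k : ℝ → ℝ} (hf : Integrable f) (hk : Integrable k) :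
    ∫⁻ t, ‖conv f k t‖ₑ ^ 2 ≤ ENNReal.ofReal (∫ t, |k t|) ^ 2 * ∫⁻ t, ‖f t‖ₑ ^ 2 := by
  rw [← lintegral_enorm_fhat_sq (integrable_conv hf hk), ← lintegral_enorm_fhat_sq hf,
    ← lintegral_const_mul' _ _ (by finiteness)]
  refine lintegral_mono fun ξ => ?_
  simp only
  rw [fhat_conv hf hk, enorm_mul, mul_pow, mul_comm]
  gcongr
  rw [← ofReal_norm]
  exact ENNReal.ofReal_le_ofReal (norm_fhat_le _ _)

lemma J_add {γ : ℝ} {T : ℝ} (v w : L2 T) : J T γ (v + w) = J T γ v + J T γ w := by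
  by_cases hγ : 0 < γ
  · refine Lp.ext ?_
    have hex : ext (v + w) =ᵐ[volume] fun t => ext v t + ext w t := by
      refine (ext_congr (Lp.coeFn_add v w)).trans (ae_of_all _ fun t => ?_)
      exact congrFun (indicator_add _ _ _) t
    have h1 := ae_restrict_of_ae (s := Ioo (0 : ℝ) T)
      (ae_convExists (integrable_ext v) (integrable_kker hγ T))
    have h2 := ae_restrict_of_ae (s := Ioo (0 : ℝ) T)
      (ae_convExists (integrable_ext w) (integrable_kker hγ T))
    filter_upwards [J_ae hγ (v + w), J_ae hγ v, J_ae hγ w, Lp.coeFn_add (J T γ v) (J T γ w), h1, h2]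
      with t h3 h4 h5 h6 h7 h8
    rw [h3, h6, Pi.add_apply, h4, h5, conv_congr_left hex, conv_apply, conv_apply, conv_apply,
      ← integral_add h7 h8]
    simp only [add_mul]
  · simp [J, hγ]

lemma J_smul {γ : ℝ} {T : ℝ} (c : ℝ) (v : L2 T) : J T γ (c • v) = c • J T γ v := by
  by_cases hγ : 0 < γ
  · refine Lp.ext ?_
    have hex : ext (c • v) =ᵐ[volume] fun t => c * ext v t := by
      refine (ext_congr (Lp.coeFn_smul c v)).trans (ae_of_all _ fun t => ?_)
      exact congrFun (indicator_const_smul _ c _) t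
    filter_upwards [J_ae hγ (c • v), J_ae hγ v, Lp.coeFn_smul c (J T γ v)]
      with t h3 h4 h6
    rw [h3, h6, Pi.smul_apply, h4, conv_congr_left hex, conv_apply, conv_apply, smul_eq_mul,
      ← integral_const_mul]
    simp only [mul_assoc]
  · simp [J, hγ]

lemma enorm_sq_le_of_ae {T : ℝ} {v : L2 T} {f : ℝ → ℝ}
    (h : v =ᵐ[volume.restrict (Ioo (0 : ℝ) T)] f) : ‖v‖ₑ ^ 2 ≤ ∫⁻ t, ‖f t‖ₑ ^ 2 := by
  rw [Lp.enorm_def, eLpNorm_congr_ae h, eLpNorm_two_pow_two]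
  exact setLIntegral_le_lintegral _ _

lemma enorm_le_ofReal_mul_of_sq_le {E : Type*} [SeminormedAddCommGroup E] {v : E} {c : ℝ}
    {a : ℝ} (hc : 0 ≤ c) (ha : 0 ≤ a)
    (h : ‖v‖ₑ ^ 2 ≤ ENNReal.ofReal c ^ 2 * ENNReal.ofReal a ^ 2) : ‖v‖ ≤ c * a := by
  rw [← mul_pow, ENNReal.pow_le_pow_left_iff two_ne_zero, ← ofReal_norm,
    ← ENNReal.ofReal_mul hc, ENNReal.ofReal_le_ofReal_iff (by positivity)] at h
  exact h

lemma norm_J_le {γ : ℝ} (hγ : 0 < γ) {T : ℝ} (v : L2 T) :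
    ‖J T γ v‖ ≤ (∫ t, |kker γ T t|) * ‖v‖ := by
  refine enorm_le_ofReal_mul_of_sq_le (integral_nonneg fun _ => abs_nonneg _) (norm_nonneg _) ?_
  rw [ofReal_norm, ← lintegral_enorm_ext_sq v]
  exact (enorm_sq_le_of_ae (J_ae hγ v)).trans
    (lintegral_conv_sq_le (integrable_ext v) (integrable_kker hγ T))

/-- `J^γ` as a continuous linear operator on `L²(0,T)`. -/
def JL (T : ℝ) {γ : ℝ} (hγ : 0 < γ) : L2 T →L[ℝ] L2 T :=
  LinearMap.mkContinuous ⟨⟨J T γ, J_add⟩, J_smul⟩ (∫ t, |kker γ T t|) (norm_J_le hγ)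

@[simp] lemma JL_apply (T : ℝ) {γ : ℝ} (hγ : 0 < γ) (v : L2 T) : JL T hγ v = J T γ v := rfl

/-! ### The semigroup property -/

/-- The Beta integral, scaled to `(0,t)`. -/
lemma integral_rpow_mul_rpow_sub {a b t : ℝ} (ha : 0 < a) (hb : 0 < b) (ht : 0 < t) :
    ∫ s in (0 : ℝ)..t, s ^ (a - 1) * (t - s) ^ (b - 1) =
      t ^ (a + b - 1) * (Real.Gamma a * Real.Gamma b / Real.Gamma (a + b)) := by
  have h := Complex.betaIntegral_scaled a b ht
  rw [Complex.betaIntegral_eq_Gamma_mul_div _ _ (by simpa) (by simpa)] at h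
  have h1 : ∫ s in (0 : ℝ)..t, ((s : ℂ) ^ ((a : ℂ) - 1) * ((t : ℂ) - s) ^ ((b : ℂ) - 1)) =
      ∫ s in (0 : ℝ)..t, ((s ^ (a - 1) * (t - s) ^ (b - 1) : ℝ) : ℂ) := by
    refine intervalIntegral.integral_congr fun s hs => ?_
    rw [uIcc_of_le ht.le] at hs
    rw [Complex.ofReal_mul, Complex.ofReal_cpow hs.1, Complex.ofReal_cpow (by linarith [hs.2])]
    push_cast
    rfl
  rw [h1, intervalIntegral.integral_ofReal] at h
  have h2 : (t : ℂ) ^ ((a : ℂ) + b - 1) = ((t ^ (a + b - 1) : ℝ) : ℂ) := by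
    rw [Complex.ofReal_cpow ht.le]
    push_cast
    rfl
  rw [h2, ← Complex.ofReal_add, Complex.Gamma_ofReal, Complex.Gamma_ofReal,
    Complex.Gamma_ofReal] at h
  exact_mod_cast h

/-- The convolution of two truncated kernels is the kernel of the summed order up to the truncation
time `T`; beyond `T` it differs from the truncated kernel. -/
lemma conv_kker {a b : ℝ} (ha : 0 < a) (hb : 0 < b) {T t : ℝ} (ht : t < T) :
    conv (kker a T) (kker b T) t = kker (a + b) T t := by
  rcases le_or_gt t 0 with h0 | h0
  · rw [kker_of_nonpos _ _ h0, conv_of_nonpos (fun _ => kker_of_nonpos _ _)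
      (fun _ => kker_of_nonpos _ _) h0]
  have h1 : ∀ s, kker a T s * kker b T (t - s) = (Ioo (0 : ℝ) t).indicator
      (fun s => (s ^ (a - 1) * (t - s) ^ (b - 1)) * (Real.Gamma a * Real.Gamma b)⁻¹) s := by
    intro s
    by_cases hs : s ∈ Ioo (0 : ℝ) t
    · have h2 : s ∈ Ioo 0 T := ⟨hs.1, hs.2.trans ht⟩
      have h3 : t - s ∈ Ioo 0 T := ⟨by linarith [hs.2], by linarith [hs.1]⟩
      rw [kker, kker, indicator_of_mem h2, indicator_of_mem h3, indicator_of_mem hs, mul_inv]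
      ring
    · rw [indicator_of_notMem hs]
      rcases le_or_gt s 0 with h2 | h2
      · rw [kker_of_nonpos _ _ h2, zero_mul]
      · rw [kker_of_nonpos _ _ (by linarith [not_lt.1 fun h => hs ⟨h2, h⟩] : t - s ≤ 0), mul_zero]
  rw [conv_apply]
  simp_rw [h1]
  rw [integral_indicator measurableSet_Ioo, ← integral_Ioc_eq_integral_Ioo,
    ← intervalIntegral.integral_of_le h0.le, intervalIntegral.integral_mul_const,
    integral_rpow_mul_rpow_sub ha hb h0, kker,
    indicator_of_mem (show t ∈ Ioo 0 T from ⟨h0, ht⟩)]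
  have := (Real.Gamma_pos_of_pos ha).ne'
  have := (Real.Gamma_pos_of_pos hb).ne'
  have := (Real.Gamma_pos_of_pos (add_pos ha hb)).ne'
  field_simp

lemma ae_conv_assoc {f g k : ℝ → ℝ} (hf : Integrable f) (hg : Integrable g) (hk : Integrable k) :
    ∀ᵐ t, conv (conv f g) k t = conv f (conv g k) t := by
  have h1 := hf.ae_convolution_exists (ContinuousLinearMap.mul ℝ ℝ) hg
  have h2 := hg.norm.ae_convolution_exists (ContinuousLinearMap.mul ℝ ℝ) hk.norm
  have h3 := hf.norm.ae_convolution_exists (ContinuousLinearMap.mul ℝ ℝ)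
    (hg.norm.integrable_convolution (ContinuousLinearMap.mul ℝ ℝ) hk.norm)
  filter_upwards [h3] with t ht
  exact convolution_assoc _ _ _ _ (fun x y z => by simp [mul_assoc]) hf.1 hg.1 hk.1 h1 h2 ht

/-- The semigroup property `J^a J^b = J^(a+b)`. By causality, only values at times below `T` matter,
where the truncations of kernels and functions make no difference. -/
theorem J_J {a b : ℝ} (ha : 0 < a) (hb : 0 < b) {T : ℝ} (v : L2 T) :
    J T a (J T b v) = J T (a + b) v := by
  refine Lp.ext ?_
  refine (J_ae ha _).trans (Filter.EventuallyEq.trans ?_ (J_ae (add_pos ha hb) v).symm)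
  have h := ae_conv_assoc (integrable_ext v) (integrable_kker hb T) (integrable_kker ha T)
  filter_upwards [ae_restrict_of_ae h, ae_restrict_mem measurableSet_Ioo] with t h1 ht
  rw [conv_congr_left_of_lt (fun _ => kker_of_nonpos a T) (ext_J_ae hb v) ht.2.le, h1]
  exact conv_congr_right_of_lt (fun _ => ext_of_nonpos v)
    (fun s hs => by rw [conv_kker hb ha hs, add_comm]) ht.2.le

/-! ### Weak derivatives -/

/-- The fundamental lemma of the calculus of variations on `(0,T)`. -/
lemma ae_zero_of_forall_test {T : ℝ} {z : ℝ → ℝ} (hz : IntegrableOn z (Ioo 0 T))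
    (h : ∀ φ : ℝ → ℝ, ContDiff ℝ (⊤ : ℕ∞) φ → HasCompactSupport φ → tsupport φ ⊆ Ioo (0 : ℝ) T →
      ∫ t in Ioo (0 : ℝ) T, z t * φ t = 0) : z =ᵐ[volume.restrict (Ioo (0 : ℝ) T)] 0 := by
  rw [Filter.EventuallyEq, ae_restrict_iff' measurableSet_Ioo]
  refine isOpen_Ioo.ae_eq_zero_of_integral_contDiff_smul_eq_zero
    hz.locallyIntegrableOn fun φ hφ hc hs => ?_
  rw [← h φ hφ hc hs, ← integral_indicator measurableSet_Ioo]
  congr 1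
  ext t
  by_cases ht : t ∈ Ioo 0 T
  · rw [indicator_of_mem ht, smul_eq_mul, mul_comm]
  · rw [indicator_of_notMem ht, image_eq_zero_of_notMem_tsupport (fun h => ht (hs h)), zero_smul]

lemma integrable_mul_test {T : ℝ} (v : L2 T) {φ : ℝ → ℝ} (hφ : Continuous φ)
    (hc : HasCompactSupport φ) : IntegrableOn (fun t => v t * φ t) (Ioo 0 T) := by
  obtain ⟨C, hC⟩ := hc.exists_bound_of_continuous hφ
  exact ((Lp.memLp v).integrable (by norm_num)).mul_bdd hφ.aestronglyMeasurable
    (ae_of_all _ hC)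

lemma HasWeakDeriv.unique {T : ℝ} {k : ℕ} {u v w : L2 T} (hv : HasWeakDeriv T k u v)
    (hw : HasWeakDeriv T k u w) : v = w := by
  rw [← sub_eq_zero]
  refine Lp.ext (Filter.EventuallyEq.trans (ae_zero_of_forall_test (z := (v - w : L2 T)) ?_ ?_)
    (Lp.coeFn_zero _ _ _).symm)
  · exact (Lp.memLp _).integrable (by norm_num)
  intro φ hφ hc hs
  have h1 := (hv φ hφ hc hs).symm.trans (hw φ hφ hc hs)
  have h2 := mul_left_cancel₀ (pow_ne_zero k (by norm_num : (-1 : ℝ) ≠ 0)) h1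
  have h3 : ∫ t in Ioo (0 : ℝ) T, (v - w : L2 T) t * φ t =
      ∫ t in Ioo (0 : ℝ) T, (v t * φ t - w t * φ t) := by
    refine integral_congr_ae ?_
    filter_upwards [Lp.coeFn_sub v w] with t ht
    rw [ht, Pi.sub_apply, sub_mul]
  rw [h3, integral_sub (integrable_mul_test v hφ.continuous hc)
    (integrable_mul_test w hφ.continuous hc), h2, sub_self]

lemma HasWeakDeriv.weakDeriv_eq {T : ℝ} {k : ℕ} {u v : L2 T} (h : HasWeakDeriv T k u v) :
    weakDeriv T k u = v := by
  have hex : ∃ v, HasWeakDeriv T k u v := ⟨v, h⟩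
  rw [weakDeriv, dif_pos hex]
  exact hex.choose_spec.unique h

lemma hasWeakDeriv_zero {T : ℝ} (u : L2 T) : HasWeakDeriv T 0 u u := by
  intro φ _ _ _
  simp

lemma tsupport_iteratedDeriv_subset (k : ℕ) (φ : ℝ → ℝ) :
    tsupport (iteratedDeriv k φ) ⊆ tsupport φ := by
  induction k with
  | zero => simp
  | succ k ih => rw [iteratedDeriv_succ]; exact (tsupport_deriv_subset).trans ih

lemma HasWeakDeriv.succ {T : ℝ} {k : ℕ} {u v w : L2 T} (hv : HasWeakDeriv T 1 u v)
    (hw : HasWeakDeriv T k v w) : HasWeakDeriv T (k + 1) u w := by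
  intro φ hφ hc hs
  have h1 := hv (iteratedDeriv k φ) (by
      rw [iteratedDeriv_eq_iterate]; exact ContDiff.iterate_deriv k hφ)
    (hc.of_isClosed_subset (isClosed_tsupport _) (tsupport_iteratedDeriv_subset k φ))
    ((tsupport_iteratedDeriv_subset k φ).trans hs)
  rw [iteratedDeriv_one, ← iteratedDeriv_succ] at h1
  rw [h1, hw φ hφ hc hs]
  ring

/-- The weak derivative of order `k + 1` is the first derivative of the one of order `k`. -/
lemma HasWeakDeriv.deriv_of_succ {T : ℝ} {k : ℕ} {u v w : L2 T} (hv : HasWeakDeriv T k u v)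
    (hw : HasWeakDeriv T (k + 1) u w) : HasWeakDeriv T 1 v w := by
  intro φ hφ hc hs
  have h1 := hv (deriv φ) (ContDiff.iterate_deriv 1 hφ) hc.deriv
    ((tsupport_deriv_subset).trans hs)
  have h2 := hw φ hφ hc hs
  rw [iteratedDeriv_succ', h1, pow_succ, mul_assoc] at h2
  rw [iteratedDeriv_one]
  simpa using mul_left_cancel₀ (pow_ne_zero k (by norm_num : (-1 : ℝ) ≠ 0)) h2

/-! ### The integral of order one -/

lemma J_one_ae {T : ℝ} (v : L2 T) :
    J T 1 v =ᵐ[volume.restrict (Ioo (0 : ℝ) T)] fun t => ∫ s in (0 : ℝ)..t, ext v s := by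
  rw [J, dif_pos one_pos]
  refine (MemLp.coeFn_toLp _).trans ?_
  filter_upwards [ae_restrict_mem measurableSet_Ioo] with t ht
  rw [rlIntegral, intervalIntegral.integral_of_le ht.1.le, intervalIntegral.integral_of_le ht.1.le]
  refine setIntegral_congr_fun measurableSet_Ioc fun s hs => ?_
  rw [ext, indicator_of_mem (show s ∈ Ioo 0 T from ⟨hs.1, hs.2.trans_lt ht.2⟩)]
  simp

lemma vanishesAtZero_J_one {T : ℝ} (v : L2 T) : VanishesAtZero T (J T 1 v) :=
  ⟨_, ((integrable_ext v).continuous_primitive 0).continuousOn, J_one_ae v, by simp⟩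

/-- Integration by parts for the absolutely continuous primitive of an `L²` function. -/
lemma hasWeakDeriv_J_one {T : ℝ} (hT : 0 < T) (v : L2 T) : HasWeakDeriv T 1 (J T 1 v) v := by
  intro φ hφ hc hs
  set p : ℝ → ℝ := fun t => ∫ s in (0 : ℝ)..t, ext v s with hp
  have hpac : AbsolutelyContinuousOnInterval p 0 T :=
    ((integrable_ext v).intervalIntegrable
      (a := 0) (b := T)).absolutelyContinuousOnInterval_intervalIntegral (c := 0) (by simp)
  have hφac : AbsolutelyContinuousOnInterval φ 0 T :=
    ((hφ.of_le (by exact_mod_cast le_top)).contDiffOn).absolutelyContinuousOnInterval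
  have h0 : φ 0 = 0 := image_eq_zero_of_notMem_tsupport fun h => (hs h).1.ne rfl
  have h1 : φ T = 0 := image_eq_zero_of_notMem_tsupport fun h => (hs h).2.ne rfl
  have h2 := hpac.integral_mul_deriv_eq_deriv_mul hφac
  rw [h0, h1, mul_zero, mul_zero, sub_zero, zero_sub, intervalIntegral.integral_of_le hT.le,
    intervalIntegral.integral_of_le hT.le, integral_Ioc_eq_integral_Ioo,
    integral_Ioc_eq_integral_Ioo] at h2
  rw [iteratedDeriv_one, pow_one, neg_one_mul]
  have h3 : ∫ t in Ioo (0 : ℝ) T, J T 1 v t * deriv φ t = ∫ t in Ioo (0 : ℝ) T, p t * deriv φ t := by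
    refine integral_congr_ae ?_
    filter_upwards [J_one_ae v] with t ht
    rw [ht]
  rw [h3, h2]
  congr 1
  refine integral_congr_ae ?_
  filter_upwards [ae_restrict_of_ae (LocallyIntegrable.ae_hasDerivAt_integral
      (integrable_ext v).locallyIntegrable),
    ae_restrict_mem measurableSet_Ioo] with t ht htT
  rw [(ht 0).deriv, ext, indicator_of_mem htT]

/-- The du Bois-Reymond lemma: a function with vanishing weak derivative is constant. -/
lemma HasWeakDeriv.ae_const {T : ℝ} (hT : 0 < T) {z : L2 T} (hz : HasWeakDeriv T 1 z 0) :
    ∃ c : ℝ, z =ᵐ[volume.restrict (Ioo (0 : ℝ) T)] fun _ => c := by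
  -- a test function `e` with integral one, supported in `(0,T)`; the constant is `∫ z e`
  obtain ⟨η, hη⟩ : ∃ η : ContDiffBump (T / 2), η.rOut = T / 4 :=
    ⟨⟨T / 8, T / 4, by positivity, by linarith⟩, rfl⟩
  set e : ℝ → ℝ := η.normed volume with he
  have hec : ContDiff ℝ (⊤ : ℕ∞) e := η.contDiff_normed
  have hes : HasCompactSupport e := η.hasCompactSupport_normed
  have heT : tsupport e ⊆ Ioo 0 T := by
    rw [he, η.tsupport_normed_eq, hη, Real.closedBall_eq_Icc]
    exact fun x hx => ⟨by linarith [hx.1], by linarith [hx.2]⟩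
  have hei : ∫ t, e t = 1 := η.integral_normed
  set c : ℝ := ∫ t in Ioo (0 : ℝ) T, z t * e t with hcdef
  refine ⟨c, ?_⟩
  suffices h : (fun t => z t - c) =ᵐ[volume.restrict (Ioo (0 : ℝ) T)] 0 by
    filter_upwards [h] with t ht
    exact sub_eq_zero.1 ht
  refine ae_zero_of_forall_test (((Lp.memLp z).integrable (by norm_num)).sub
    (integrable_const c)) fun ψ hψ hψc hψT => ?_
  set m : ℝ := ∫ t, ψ t with hm
  -- the mean-free part of `ψ` is the derivative of a test function
  set q : ℝ → ℝ := fun t => ψ t - m * e t with hq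
  have hqc : ContDiff ℝ (⊤ : ℕ∞) q := hψ.sub (contDiff_const.mul hec)
  have hqi : Integrable q := (hψ.continuous.integrable_of_hasCompactSupport hψc).sub
    ((hec.continuous.integrable_of_hasCompactSupport hes).const_mul m)
  have hq0 : ∫ t, q t = 0 := by
    rw [hq, integral_sub (hψ.continuous.integrable_of_hasCompactSupport hψc)
      ((hec.continuous.integrable_of_hasCompactSupport hes).const_mul m),
      integral_const_mul, hei, hm]
    ring
  set φ : ℝ → ℝ := fun t => ∫ s in (0 : ℝ)..t, q s with hφdef
  have hφd : ∀ t, HasDerivAt φ (q t) t := fun t =>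
    (hqc.continuous.integral_hasStrictDerivAt 0 t).hasDerivAt
  have hφ' : deriv φ = q := funext fun t => (hφd t).deriv
  have hφ : ContDiff ℝ (⊤ : ℕ∞) φ := by
    rw [contDiff_infty_iff_deriv, hφ']
    exact ⟨fun t => (hφd t).differentiableAt, hqc⟩
  -- the point `T / 2` only makes `K` nonempty, so that it has extreme points
  set K : Set ℝ := insert (T / 2) (tsupport ψ ∪ tsupport e) with hK
  have hKc : IsCompact K := (hψc.isCompact.union hes.isCompact).insert _
  have hKT : K ⊆ Ioo 0 T := insert_subset ⟨by linarith, by linarith⟩ (union_subset hψT heT)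
  obtain ⟨a, haK, ha⟩ := hKc.exists_isLeast (insert_nonempty _ _)
  obtain ⟨b, hbK, hb⟩ := hKc.exists_isGreatest (insert_nonempty _ _)
  have hqK : ∀ t, t ∉ K → q t = 0 := fun t ht => by
    have h1 : t ∉ tsupport ψ := fun h => ht (mem_insert_of_mem _ (Or.inl h))
    have h2 : t ∉ tsupport e := fun h => ht (mem_insert_of_mem _ (Or.inr h))
    simp only [hq]
    rw [image_eq_zero_of_notMem_tsupport h1, image_eq_zero_of_notMem_tsupport h2]
    ring
  have hφl : ∀ t, t < a → φ t = 0 := fun t ht => by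
    refine intervalIntegral.integral_zero_ae (ae_of_all _ fun s hs => hqK s fun h => ?_)
    have := ha h
    rcases le_total 0 t with h0 | h0
    · rw [uIoc_of_le h0] at hs
      linarith [hs.2]
    · rw [uIoc_of_ge h0] at hs
      linarith [hs.2, (hKT h).1]
  have hφr : ∀ t, b < t → φ t = 0 := fun t ht => by
    have h1 : ∫ s, q s = φ t := by
      have hbt : 0 ≤ t := (hKT hbK).1.le.trans ht.le
      rw [hφdef]
      beta_reduce
      rw [intervalIntegral.integral_of_le hbt, ← integral_indicator measurableSet_Ioc]
      refine integral_congr_ae (ae_of_all _ fun s => ?_)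
      by_cases hs : s ∈ Ioc 0 t
      · rw [indicator_of_mem hs]
      · rw [indicator_of_notMem hs]
        exact hqK s fun h => hs ⟨(hKT h).1, (hb h).trans ht.le⟩
    rw [← h1, hq0]
  have hφs : tsupport φ ⊆ Icc a b := by
    refine closure_minimal (fun t ht => ?_) isClosed_Icc
    by_contra h
    rw [mem_Icc, not_and_or, not_le, not_le] at h
    exact ht (h.elim (hφl t) (hφr t))
  have hφT : tsupport φ ⊆ Ioo 0 T :=
    hφs.trans fun t ht => ⟨(hKT haK).1.trans_le ht.1, ht.2.trans_lt (hKT hbK).2⟩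
  have h1 := hz φ hφ (HasCompactSupport.of_support_subset_isCompact isCompact_Icc
    ((subset_tsupport φ).trans hφs)) hφT
  have h0 : ∫ t in Ioo (0 : ℝ) T, (0 : L2 T) t * φ t = 0 := by
    refine integral_eq_zero_of_ae ?_
    filter_upwards [Lp.coeFn_zero ℝ 2 (volume.restrict (Ioo (0 : ℝ) T))] with t ht
    rw [ht]
    simp
  rw [iteratedDeriv_one, hφ', h0, mul_zero] at h1
  have h2 : ∫ t in Ioo (0 : ℝ) T, z t * q t = (∫ t in Ioo (0 : ℝ) T, z t * ψ t) - m * c := by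
    rw [hcdef, ← integral_const_mul, ← integral_sub (integrable_mul_test z hψ.continuous hψc)
      ((integrable_mul_test z hec.continuous hes).const_mul m)]
    congr 1
    ext t
    simp only [hq]
    ring
  have h3 : ∫ t in Ioo (0 : ℝ) T, ψ t = m :=
    setIntegral_eq_integral_of_forall_compl_eq_zero fun t ht =>
      image_eq_zero_of_notMem_tsupport fun h => ht (hψT h)
  simp only [sub_mul]
  rw [integral_sub (integrable_mul_test z hψ.continuous hψc)
    ((hψ.continuous.integrable_of_hasCompactSupport hψc).integrableOn.const_mul c),
    integral_const_mul, h3]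
  linarith

lemma HasWeakDeriv.sub {T : ℝ} {k : ℕ} {u v u' v' : L2 T} (hu : HasWeakDeriv T k u u')
    (hv : HasWeakDeriv T k v v') : HasWeakDeriv T k (u - v) (u' - v') := by
  intro φ hφ hc hs
  have hd : Continuous (iteratedDeriv k φ) := hφ.continuous_iteratedDeriv k (by exact_mod_cast le_top)
  have hdc : HasCompactSupport (iteratedDeriv k φ) :=
    hc.of_isClosed_subset (isClosed_tsupport _) (tsupport_iteratedDeriv_subset k φ)
  have key : ∀ (a b : L2 T) (ψ : ℝ → ℝ), Continuous ψ → HasCompactSupport ψ →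
      ∫ t in Ioo (0 : ℝ) T, (a - b : L2 T) t * ψ t =
        (∫ t in Ioo (0 : ℝ) T, a t * ψ t) - ∫ t in Ioo (0 : ℝ) T, b t * ψ t := by
    intro a b ψ h1 h2
    rw [← integral_sub (integrable_mul_test a h1 h2) (integrable_mul_test b h1 h2)]
    refine integral_congr_ae ?_
    filter_upwards [Lp.coeFn_sub a b] with t ht
    rw [ht, Pi.sub_apply, sub_mul]
  rw [key _ _ _ hd hdc, key _ _ _ hφ.continuous hc, hu φ hφ hc hs, hv φ hφ hc hs]
  ring

/-- A weakly differentiable function vanishing at `0` is the primitive of its derivative. -/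
theorem HasWeakDeriv.eq_J_one {T : ℝ} (hT : 0 < T) {u w : L2 T} (h : HasWeakDeriv T 1 u w)
    (h0 : VanishesAtZero T u) : u = J T 1 w := by
  have hz := h.sub (hasWeakDeriv_J_one hT w)
  rw [sub_self] at hz
  obtain ⟨c, hc⟩ := hz.ae_const hT
  obtain ⟨g, hg, hug, hg0⟩ := h0
  have h1 : (fun t => g t - ∫ s in (0 : ℝ)..t, ext w s) =ᵐ[volume.restrict (Icc 0 T)]
      fun _ => c := by
    rw [← restrict_Ioo_eq_restrict_Icc]
    filter_upwards [hc, hug, J_one_ae w, Lp.coeFn_sub u (J T 1 w)] with t h1 h2 h3 h4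
    rw [← h2, ← h3, ← h1, h4, Pi.sub_apply]
  have h2 := Measure.eqOn_Icc_of_ae_eq volume hT.ne h1
    (hg.sub ((integrable_ext w).continuous_primitive 0).continuousOn) continuousOn_const
    (left_mem_Icc.2 hT.le)
  simp only [hg0, intervalIntegral.integral_same, sub_zero] at h2
  rw [← sub_eq_zero]
  refine Lp.ext (hc.trans ?_)
  filter_upwards [Lp.coeFn_zero ℝ 2 (volume.restrict (Ioo (0 : ℝ) T))] with t ht
  rw [ht, ← h2]
  rfl

/-! ### Injectivity -/

lemma J_zero_order {T : ℝ} (v : L2 T) : J T 0 v = v := by simp [J]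

lemma J_J_of_nonneg {a b : ℝ} (ha : 0 ≤ a) (hb : 0 ≤ b) {T : ℝ} (v : L2 T) :
    J T a (J T b v) = J T (a + b) v := by
  rcases ha.eq_or_lt with rfl | ha
  · rw [J_zero_order, zero_add]
  rcases hb.eq_or_lt with rfl | hb
  · rw [J_zero_order, add_zero]
  exact J_J ha hb v

lemma J_one_injective {T : ℝ} (hT : 0 < T) : Function.Injective (J T 1) := by
  intro v w h
  have := hasWeakDeriv_J_one hT v
  rw [h] at this
  exact this.unique (hasWeakDeriv_J_one hT w)

lemma J_natCast_injective {T : ℝ} (hT : 0 < T) (n : ℕ) : Function.Injective (J T n) := by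
  induction n with
  | zero => intro v w h; simpa [J_zero_order] using h
  | succ n ih =>
    intro v w h
    have h1 : ∀ v, J T ((n + 1 : ℕ) : ℝ) v = J T n (J T 1 v) := fun v => by
      rw [J_J_of_nonneg n.cast_nonneg zero_le_one]; push_cast; rfl
    rw [h1, h1] at h
    exact J_one_injective hT (ih h)

/-- An integer order at least `γ` factors through `J^γ`, and `J^n` is injective because weak
derivatives are unique. -/
theorem J_injective {T : ℝ} (hT : 0 < T) {γ : ℝ} (hγ : 0 ≤ γ) : Function.Injective (J T γ) := by
  intro v w h
  obtain ⟨n, hn⟩ := exists_nat_ge γ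
  refine J_natCast_injective hT n ?_
  have h1 : ∀ v, J T (n : ℝ) v = J T (n - γ) (J T γ v) := fun v => by
    rw [J_J_of_nonneg (by linarith) hγ, sub_add_cancel]
  rw [h1, h1, h]

lemma hasWeakDeriv_J_natCast {T : ℝ} (hT : 0 < T) (k : ℕ) (v : L2 T) :
    HasWeakDeriv T k (J T k v) v := by
  induction k with
  | zero => simpa [J_zero_order] using hasWeakDeriv_zero v
  | succ k ih =>
    have h1 : J T ((k + 1 : ℕ) : ℝ) v = J T 1 (J T k v) := by
      rw [J_J_of_nonneg zero_le_one k.cast_nonneg]; push_cast; rw [add_comm]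
    rw [h1]
    exact (hasWeakDeriv_J_one hT _).succ ih

lemma hasWeakDeriv_J {T : ℝ} (hT : 0 < T) {γ : ℝ} {k : ℕ} (hk : (k : ℝ) ≤ γ) (v : L2 T) :
    HasWeakDeriv T k (J T γ v) (J T (γ - k) v) := by
  have h := hasWeakDeriv_J_natCast hT k (J T (γ - k) v)
  rwa [J_J_of_nonneg k.cast_nonneg (by linarith), add_sub_cancel] at h

lemma vanishesAtZero_J_of_one_le {T : ℝ} {γ : ℝ} (hγ : 1 ≤ γ) (v : L2 T) :
    VanishesAtZero T (J T γ v) := by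
  have h := vanishesAtZero_J_one (J T (γ - 1) v)
  rwa [J_J_of_nonneg zero_le_one (by linarith), add_sub_cancel] at h

/-! ### The Gagliardo seminorm on the line -/

/-- The Gagliardo seminorm, squared, of a function on the line. -/
def gag (θ : ℝ) (f : ℝ → ℝ) : ℝ≥0∞ :=
  ∫⁻ s, ∫⁻ t, ENNReal.ofReal (|f t - f s| ^ 2 / |t - s| ^ (1 + 2 * θ))

lemma lintegral_comp_mul_left (g : ℝ → ℝ≥0∞) {c : ℝ} (hc : c ≠ 0) :
    ∫⁻ x, g (c * x) = ENNReal.ofReal |c⁻¹| * ∫⁻ x, g x := by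
  have h := (Homeomorph.mulLeft₀ c hc).measurableEmbedding.lintegral_map g (μ := volume)
  simp only [Homeomorph.coe_mulLeft₀] at h
  rw [← h, Real.map_volume_mul_left hc, lintegral_smul_measure, smul_eq_mul]

lemma gag_congr {θ : ℝ} {f g : ℝ → ℝ} (h : f =ᵐ[volume] g) : gag θ f = gag θ g := by
  refine lintegral_congr_ae ?_
  filter_upwards [h] with s hs
  refine lintegral_congr_ae ?_
  filter_upwards [h] with t ht
  rw [hs, ht]

lemma ofReal_sq_div_rpow (a b p : ℝ) :
    ENNReal.ofReal (|a| ^ 2 / |b| ^ p) = ENNReal.ofReal (1 / |b| ^ p) * ‖a‖ₑ ^ 2 := by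
  rw [div_eq_mul_one_div, mul_comm, ENNReal.ofReal_mul (by positivity),
    ENNReal.ofReal_pow (abs_nonneg _), Real.enorm_eq_ofReal_abs]

lemma gag_eq_lintegral_translate {θ : ℝ} {f : ℝ → ℝ} (hf : Measurable f) :
    gag θ f = ∫⁻ h, ENNReal.ofReal (1 / |h| ^ (1 + 2 * θ)) * ∫⁻ s, ‖f (s + h) - f s‖ₑ ^ 2 := by
  have h1 : ∀ s, ∫⁻ t, ENNReal.ofReal (|f t - f s| ^ 2 / |t - s| ^ (1 + 2 * θ)) =
      ∫⁻ h, ENNReal.ofReal (1 / |h| ^ (1 + 2 * θ)) * ‖f (s + h) - f s‖ₑ ^ 2 := by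
    intro s
    rw [← lintegral_add_left_eq_self _ s]
    refine lintegral_congr fun h => ?_
    rw [ofReal_sq_div_rpow, add_sub_cancel_left]
  rw [gag]
  simp_rw [h1]
  rw [lintegral_lintegral_swap]
  · refine lintegral_congr fun h => ?_
    rw [lintegral_const_mul' _ _ ENNReal.ofReal_ne_top]
  · refine Measurable.aemeasurable ?_
    simp only [Function.uncurry_def]
    fun_prop

/-- Plancherel's identity for a difference, with `|exp(2πi ξ h) - 1|² = (2 sin(π ξ h))²`. -/
lemma lintegral_translate_sub_sq {f : ℝ → ℝ} (hf : Integrable f) (h : ℝ) :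
    ∫⁻ t, ‖f (t + h) - f t‖ₑ ^ 2 =
      ∫⁻ ξ : ℝ, ENNReal.ofReal ((2 * Real.sin (Real.pi * (ξ * h))) ^ 2) * ‖fhat f ξ‖ₑ ^ 2 := by
  rw [lintegral_enorm_translate_sub_sq hf]
  refine lintegral_congr fun ξ => ?_
  congr 1
  have h1 : (2 * Real.pi * h * ξ * Complex.I : ℂ) =
      Complex.I * ((2 * (Real.pi * (ξ * h)) : ℝ) : ℂ) := by
    push_cast; ring
  rw [h1, ← ofReal_norm, Complex.norm_exp_I_mul_ofReal_sub_one, mul_div_cancel_left₀ _ two_ne_zero,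
    Real.norm_eq_abs, ← ENNReal.ofReal_pow (abs_nonneg _), sq_abs]

/-- The constant `∫ |h|^(-1-2θ) (2 sin(π h))² dh` relating the Gagliardo seminorm to the Fourier
transform, with values in `[0,∞]`; it is finite for `0 < θ < 1`. -/
def gagConst (θ : ℝ) : ℝ≥0∞ :=
  ∫⁻ h, ENNReal.ofReal (1 / |h| ^ (1 + 2 * θ)) * ENNReal.ofReal ((2 * Real.sin (Real.pi * h)) ^ 2)

lemma lintegral_scaled_gagConst (θ : ℝ) {ξ : ℝ} (hξ : ξ ≠ 0) :
    ∫⁻ h, ENNReal.ofReal (1 / |h| ^ (1 + 2 * θ)) *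
      ENNReal.ofReal ((2 * Real.sin (Real.pi * (ξ * h))) ^ 2) =
      ENNReal.ofReal (|ξ| ^ (2 * θ)) * gagConst θ := by
  have hpos : 0 < |ξ| := abs_pos.2 hξ
  have h1 : ∀ h, ENNReal.ofReal (1 / |h| ^ (1 + 2 * θ)) *
      ENNReal.ofReal ((2 * Real.sin (Real.pi * (ξ * h))) ^ 2) =
      ENNReal.ofReal (|ξ| ^ (1 + 2 * θ)) * (ENNReal.ofReal (1 / |ξ * h| ^ (1 + 2 * θ)) *
      ENNReal.ofReal ((2 * Real.sin (Real.pi * (ξ * h))) ^ 2)) := by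
    intro h
    suffices hA : ENNReal.ofReal (1 / |h| ^ (1 + 2 * θ)) = ENNReal.ofReal (|ξ| ^ (1 + 2 * θ)) *
        ENNReal.ofReal (1 / |ξ * h| ^ (1 + 2 * θ)) by
      rw [hA, mul_assoc]
    rw [← ENNReal.ofReal_mul (by positivity)]
    congr 1
    rw [abs_mul, Real.mul_rpow (abs_nonneg _) (abs_nonneg _)]
    have := (Real.rpow_pos_of_pos hpos (1 + 2 * θ)).ne'
    rw [one_div, one_div, mul_inv, mul_inv_cancel_left₀ this]
  simp_rw [h1]
  rw [lintegral_const_mul' _ _ ENNReal.ofReal_ne_top,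
    lintegral_comp_mul_left (fun x => ENNReal.ofReal (1 / |x| ^ (1 + 2 * θ)) *
      ENNReal.ofReal ((2 * Real.sin (Real.pi * x)) ^ 2)) hξ, ← mul_assoc,
    ← ENNReal.ofReal_mul (by positivity), gagConst]
  congr 2
  rw [Real.rpow_add hpos, Real.rpow_one, abs_inv]
  field_simp

/-- The Gagliardo seminorm is the homogeneous Sobolev seminorm on the Fourier side, up to a constant.
This is an identity in `[0,∞]`, so that finiteness passes in both directions. -/
theorem gag_eq_fourier {θ : ℝ} {f : ℝ → ℝ} (hf : Integrable f) :
    gag θ f = gagConst θ * ∫⁻ ξ, ENNReal.ofReal (|ξ| ^ (2 * θ)) * ‖fhat f ξ‖ₑ ^ 2 := by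
  obtain ⟨g, hg, hfg⟩ := hf.1
  have hgi : Integrable g := hf.congr hfg
  have hfhat : fhat f = fhat g := by
    ext ξ
    rw [fhat, fhat, Real.fourier_eq, Real.fourier_eq]
    refine integral_congr_ae ?_
    filter_upwards [hfg] with t ht
    rw [ht]
  have hgc : Measurable fun ξ => ‖fhat g ξ‖ₑ ^ 2 :=
    ((continuous_fhat hgi).measurable.enorm.pow_const _)
  rw [gag_congr hfg, hfhat, gag_eq_lintegral_translate hg.measurable]
  simp_rw [lintegral_translate_sub_sq hgi]
  have h1 : ∀ h : ℝ, ENNReal.ofReal (1 / |h| ^ (1 + 2 * θ)) *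
      ∫⁻ ξ : ℝ, ENNReal.ofReal ((2 * Real.sin (Real.pi * (ξ * h))) ^ 2) * ‖fhat g ξ‖ₑ ^ 2 =
      ∫⁻ ξ : ℝ, ENNReal.ofReal (1 / |h| ^ (1 + 2 * θ)) *
        ENNReal.ofReal ((2 * Real.sin (Real.pi * (ξ * h))) ^ 2) * ‖fhat g ξ‖ₑ ^ 2 := by
    intro h
    rw [← lintegral_const_mul' _ _ ENNReal.ofReal_ne_top]
    simp_rw [mul_assoc]
  simp_rw [h1]
  rw [lintegral_lintegral_swap]
  · rw [← lintegral_const_mul _ (by fun_prop)]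
    refine lintegral_congr_ae ?_
    filter_upwards [Measure.ae_ne volume (0 : ℝ)] with ξ hξ
    rw [lintegral_mul_const' _ _ (by finiteness), lintegral_scaled_gagConst θ hξ]
    ring
  · refine Measurable.aemeasurable ?_
    simp only [Function.uncurry_def]
    exact Measurable.mul (by fun_prop) (hgc.comp measurable_snd)

lemma lintegral_comp_abs_le (G : ℝ → ℝ≥0∞) :
    ∫⁻ x, G |x| ≤ 2 * ∫⁻ x in Ioi (0 : ℝ), G x := by
  have h1 : ∫⁻ x in Ioi (0 : ℝ), G |x| = ∫⁻ x in Ioi (0 : ℝ), G x :=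
    setLIntegral_congr_fun measurableSet_Ioi fun x hx => by
      rw [abs_of_pos hx]
  have h2 : ∫⁻ x in Iio (0 : ℝ), G |x| = ∫⁻ x in Ioi (0 : ℝ), G x := by
    rw [← h1, ← lintegral_indicator measurableSet_Iio, ← lintegral_indicator measurableSet_Ioi,
      ← lintegral_neg_eq_self]
    refine lintegral_congr fun x => ?_
    simp [indicator_apply]
  rw [← setLIntegral_univ, ← Iic_union_Ioi (a := (0 : ℝ)), two_mul]
  refine (lintegral_union_le _ _ _).trans ?_
  rw [h1, ← restrict_Iio_eq_restrict_Iic, h2]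

lemma gagConst_ne_top {θ : ℝ} (h0 : 0 < θ) (h1 : θ < 1) : gagConst θ ≠ ⊤ := by
  -- the integrand is dominated by `|h|^(1-2θ)` near `0` and by `|h|^(-1-2θ)` near infinity
  set G : ℝ → ℝ≥0∞ := fun x => ENNReal.ofReal ((Ioc (0 : ℝ) 1).indicator
    (fun x => (2 * Real.pi) ^ 2 * x ^ (1 - 2 * θ)) x + (Ioi (1 : ℝ)).indicator
    (fun x => 4 * x ^ (-1 - 2 * θ)) x) with hG
  have hle : gagConst θ ≤ ∫⁻ h, G |h| := by
    refine lintegral_mono_ae ?_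
    filter_upwards [Measure.ae_ne volume (0 : ℝ)] with h hh
    have hpos : 0 < |h| := abs_pos.2 hh
    rw [hG, ← ENNReal.ofReal_mul (by positivity)]
    refine ENNReal.ofReal_le_ofReal ?_
    rcases le_or_gt |h| 1 with hle | hgt
    · rw [indicator_of_mem (show |h| ∈ Ioc (0 : ℝ) 1 from ⟨hpos, hle⟩),
        indicator_of_notMem (fun hm : |h| ∈ Ioi (1 : ℝ) => hle.not_gt hm), add_zero]
      have h2 : (2 * Real.sin (Real.pi * h)) ^ 2 ≤ (2 * Real.pi) ^ 2 * |h| ^ 2 := by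
        have : Real.sin (Real.pi * h) ^ 2 ≤ (Real.pi * |h|) ^ 2 := by
          rw [← sq_abs (Real.sin _), ← abs_of_pos Real.pi_pos, ← abs_mul, abs_of_pos Real.pi_pos]
          exact pow_le_pow_left₀ (abs_nonneg _) Real.abs_sin_le_abs 2
        linarith [mul_pow Real.pi |h| 2]
      calc _ ≤ 1 / |h| ^ (1 + 2 * θ) * ((2 * Real.pi) ^ 2 * |h| ^ 2) := by gcongr
        _ = (2 * Real.pi) ^ 2 * (|h| ^ (2 : ℝ) / |h| ^ (1 + 2 * θ)) := by
          rw [Real.rpow_two]; ring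
        _ = _ := by
          rw [← Real.rpow_sub hpos]; congr 2; ring
    · rw [indicator_of_notMem (fun hm : |h| ∈ Ioc (0 : ℝ) 1 => hm.2.not_gt hgt), zero_add,
        indicator_of_mem (show |h| ∈ Ioi (1 : ℝ) from hgt)]
      have h2 : (2 * Real.sin (Real.pi * h)) ^ 2 ≤ 4 := by
        nlinarith [Real.sin_sq_le_one (Real.pi * h)]
      calc _ ≤ 1 / |h| ^ (1 + 2 * θ) * 4 := by gcongr
        _ = 4 * |h| ^ (-1 - 2 * θ) := by
          rw [show -1 - 2 * θ = -(1 + 2 * θ) by ring, Real.rpow_neg hpos.le]; ring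
  refine ((hle.trans (lintegral_comp_abs_le G)).trans_lt ?_).ne
  have i1 : Integrable ((Ioc (0 : ℝ) 1).indicator
      (fun x => (2 * Real.pi) ^ 2 * x ^ (1 - 2 * θ))) := by
    rw [integrable_indicator_iff measurableSet_Ioc]
    exact ((intervalIntegral.intervalIntegrable_rpow' (by linarith)).1).const_mul _
  have i2 : Integrable ((Ioi (1 : ℝ)).indicator (fun x => 4 * x ^ (-1 - 2 * θ))) := by
    rw [integrable_indicator_iff measurableSet_Ioi]
    exact (integrableOn_Ioi_rpow_of_lt (by linarith) one_pos).const_mul _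
  have i3 := ((i1.add i2).integrableOn (s := Ioi 0)).lintegral_lt_top
  exact ENNReal.mul_lt_top (by norm_num) i3

lemma gagConst_ne_zero (θ : ℝ) : gagConst θ ≠ 0 := by
  intro h
  rw [gagConst, lintegral_eq_zero_iff (by fun_prop)] at h
  have h1 : ∀ᵐ x ∂(volume.restrict (Ioo (0 : ℝ) 1)), False := by
    filter_upwards [ae_restrict_of_ae h, ae_restrict_mem measurableSet_Ioo] with x hx hx1
    have h2 : 0 < Real.sin (Real.pi * x) := Real.sin_pos_of_pos_of_lt_pi
      (mul_pos Real.pi_pos hx1.1) (by nlinarith [Real.pi_pos, hx1.2])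
    have h3 : 0 < |x| := abs_pos.2 hx1.1.ne'
    simp only [Pi.zero_apply, mul_eq_zero, ENNReal.ofReal_eq_zero] at hx
    rcases hx with hx | hx
    · exact absurd hx (not_le.2 (by positivity))
    · exact absurd hx (not_le.2 (by positivity))
  rw [eventually_false_iff_eq_bot, ae_eq_bot, Measure.restrict_eq_zero] at h1
  simp at h1

/-! ### The Fourier transform of the kernel -/

/-- Integration by parts gives the decay of the oscillating integral of `t^(γ-1)` away from `0`. -/
lemma intervalIntegral_fhat_kker_tail {γ : ℝ} (h1 : γ < 1) {ξ δ T : ℝ} (hξ : ξ ≠ 0)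
    (hδ : 0 < δ) (hδT : δ ≤ T) :
    ‖∫ t in δ..T, ((t ^ (γ - 1) : ℝ) : ℂ) * Complex.exp (-2 * Real.pi * ξ * Complex.I * t)‖ ≤
      δ ^ (γ - 1) / (Real.pi * |ξ|) := by
  set c : ℂ := -2 * Real.pi * ξ * Complex.I with hc
  have hc0 : c ≠ 0 := by
    simp [hc, Real.pi_ne_zero, hξ]
  have hcn : ‖c‖ = 2 * Real.pi * |ξ| := by
    simp [hc, abs_of_pos Real.pi_pos]
  have hexp : ∀ t : ℝ, ‖Complex.exp (c * t)‖ = 1 := by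
    intro t
    rw [Complex.norm_exp]
    simp [hc]
  have hIcc : ∀ t ∈ uIcc δ T, 0 < t := fun t ht => by
    rw [uIcc_of_le hδT] at ht
    exact hδ.trans_le ht.1
  have hu : ∀ t ∈ uIcc δ T, HasDerivAt (fun t : ℝ => ((t ^ (γ - 1) : ℝ) : ℂ))
      (((γ - 1) * t ^ (γ - 1 - 1) : ℝ) : ℂ) t := fun t ht =>
    (Real.hasDerivAt_rpow_const (Or.inl (hIcc t ht).ne')).ofReal_comp
  have hv : ∀ t ∈ uIcc δ T, HasDerivAt (fun t : ℝ => Complex.exp (c * t) / c)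
      (Complex.exp (c * t)) t := fun t _ => by
    have h2 : HasDerivAt (fun t : ℝ => c * (t : ℂ)) c t := by
      simpa using (Complex.ofRealCLM.hasDerivAt (x := t)).const_mul c
    have h3 := h2.cexp.div_const c
    rwa [mul_div_cancel_right₀ _ hc0] at h3
  have hu' : IntervalIntegrable (fun t : ℝ => (((γ - 1) * t ^ (γ - 1 - 1) : ℝ) : ℂ))
      volume δ T := by
    refine ContinuousOn.intervalIntegrable ?_
    refine Complex.continuous_ofReal.comp_continuousOn (continuousOn_const.mul ?_)
    exact fun t ht => (Real.continuousAt_rpow_const _ _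
      (Or.inl (hIcc t ht).ne')).continuousWithinAt
  have hv' : IntervalIntegrable (fun t : ℝ => Complex.exp (c * t)) volume δ T :=
    Continuous.intervalIntegrable (by fun_prop) _ _
  rw [intervalIntegral.integral_mul_deriv_eq_deriv_mul hu hv hu' hv']
  have hT : 0 < T := hδ.trans_le hδT
  have b1 : ‖∫ t in δ..T, (((γ - 1) * t ^ (γ - 1 - 1) : ℝ) : ℂ) * (Complex.exp (c * t) / c)‖ ≤
      (δ ^ (γ - 1) - T ^ (γ - 1)) / ‖c‖ := by
    have h2 : ∫ t in δ..T, ((1 - γ) / ‖c‖) * t ^ (γ - 1 - 1) =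
        (δ ^ (γ - 1) - T ^ (γ - 1)) / ‖c‖ := by
      rw [intervalIntegral.integral_const_mul, integral_rpow (Or.inr ⟨by linarith, fun h =>
        (hIcc 0 h).ne rfl⟩)]
      have : γ - 1 - 1 + 1 = γ - 1 := by ring
      rw [this]
      have h4 : γ - 1 ≠ 0 := by linarith
      have h5 : ‖c‖ ≠ 0 := norm_ne_zero_iff.2 hc0
      field_simp
      ring
    rw [← h2]
    refine intervalIntegral.norm_integral_le_of_norm_le hδT (ae_of_all _ fun t ht => ?_) ?_
    · have ht0 : 0 < t := hδ.trans ht.1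
      rw [norm_mul, norm_div, hexp, Complex.norm_real, Real.norm_eq_abs, abs_mul,
        abs_of_neg (by linarith : γ - 1 < 0), abs_of_pos (Real.rpow_pos_of_pos ht0 _)]
      refine le_of_eq ?_
      ring
    · refine ContinuousOn.intervalIntegrable (continuousOn_const.mul ?_)
      exact fun t ht => (Real.continuousAt_rpow_const _ _
        (Or.inl (hIcc t ht).ne')).continuousWithinAt
  have b2 : ∀ t : ℝ, 0 < t → ‖((t ^ (γ - 1) : ℝ) : ℂ) * (Complex.exp (c * t) / c)‖ =
      t ^ (γ - 1) / ‖c‖ := fun t ht => by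
    rw [norm_mul, norm_div, hexp, Complex.norm_real, Real.norm_eq_abs,
      abs_of_pos (Real.rpow_pos_of_pos ht _)]
    ring
  refine (norm_sub_le _ _).trans ((add_le_add (norm_sub_le _ _) b1).trans ?_)
  rw [b2 _ hT, b2 _ hδ, hcn]
  refine le_of_eq ?_
  have := Real.pi_pos.ne'
  have : |ξ| ≠ 0 := abs_ne_zero.2 hξ
  field_simp
  ring

/-- The Fourier transform of the truncated kernel is `O(|ξ|^(-γ))`, like that of the full one. The
integral up to time `1 / |ξ|` is estimated by absolute values, the rest by its oscillation. -/
theorem norm_fhat_kker_le {γ : ℝ} (h0 : 0 < γ) (h1 : γ < 1) (T : ℝ) :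
    ∃ C : ℝ, 0 ≤ C ∧ ∀ ξ : ℝ, ξ ≠ 0 → ‖fhat (kker γ T) ξ‖ ≤ C * |ξ| ^ (-γ) := by
  have hΓ := Real.Gamma_pos_of_pos h0
  refine ⟨(1 / γ + 1 / Real.pi) / Real.Gamma γ, by positivity, fun ξ hξ => ?_⟩
  have hpos : 0 < |ξ| := abs_pos.2 hξ
  rcases le_or_gt T 0 with hT | hT
  · have : kker γ T = 0 := by
      ext t
      rw [kker, Ioo_eq_empty (not_lt.2 hT), indicator_empty]; rfl
    rw [this, fhat, Real.fourier_eq]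
    simp only [Pi.zero_apply, Complex.ofReal_zero, smul_zero, integral_zero, norm_zero]
    positivity
  set E : ℝ → ℂ := fun t => ((t ^ (γ - 1) : ℝ) : ℂ) * Complex.exp (-2 * Real.pi * ξ * Complex.I * t)
    with hE
  have hf : fhat (kker γ T) ξ = (∫ t in (0 : ℝ)..T, E t) / Real.Gamma γ := by
    rw [fhat, Real.fourier_eq, intervalIntegral.integral_of_le hT.le, integral_Ioc_eq_integral_Ioo,
      ← integral_div, ← integral_indicator measurableSet_Ioo]
    refine integral_congr_ae (ae_of_all _ fun t => ?_)
    simp only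
    by_cases ht : t ∈ Ioo 0 T
    · rw [kker, indicator_of_mem ht, indicator_of_mem ht, hE, Circle.smul_def,
        Real.fourierChar_apply]
      simp only [RCLike.inner_apply, conj_trivial, smul_eq_mul]
      push_cast
      ring_nf
    · rw [kker, indicator_of_notMem ht, indicator_of_notMem ht]
      simp
  have hEn : ∀ t, 0 ≤ t → ‖E t‖ = t ^ (γ - 1) := by
    intro t ht
    rw [hE, norm_mul, Complex.norm_exp, Complex.norm_real, Real.norm_eq_abs,
      abs_of_nonneg (Real.rpow_nonneg ht _)]
    simp
  have hi : ∀ a : ℝ, 0 ≤ a → IntervalIntegrable E volume 0 a := fun a ha => by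
    have h2 : IntervalIntegrable (fun t : ℝ => t ^ (γ - 1)) volume 0 a :=
      intervalIntegral.intervalIntegrable_rpow' (by linarith)
    have h3 : IntervalIntegrable (fun t : ℝ => ((t ^ (γ - 1) : ℝ) : ℂ)) volume 0 a :=
      ⟨h2.1.ofReal, h2.2.ofReal⟩
    exact h3.mul_continuousOn (by fun_prop)
  have hhead : ∀ a : ℝ, 0 ≤ a → ‖∫ t in (0 : ℝ)..a, E t‖ ≤ a ^ γ / γ := fun a ha => by
    have h2 : ∫ t in (0 : ℝ)..a, t ^ (γ - 1) = a ^ γ / γ := by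
      rw [integral_rpow (Or.inl (by linarith)), sub_add_cancel, Real.zero_rpow h0.ne', sub_zero]
    rw [← h2]
    refine intervalIntegral.norm_integral_le_of_norm_le ha (ae_of_all _ fun t ht => ?_)
      (intervalIntegral.intervalIntegrable_rpow' (by linarith))
    exact (hEn t ht.1.le).le
  have hδγ : (|ξ|⁻¹) ^ γ = |ξ| ^ (-γ) := by
    rw [Real.inv_rpow hpos.le, Real.rpow_neg hpos.le]
  have hmain : ‖∫ t in (0 : ℝ)..T, E t‖ ≤ (1 / γ + 1 / Real.pi) * |ξ| ^ (-γ) := by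
    rcases le_total T |ξ|⁻¹ with hle | hle
    · refine (hhead T hT.le).trans ?_
      have : T ^ γ ≤ |ξ| ^ (-γ) := hδγ ▸ Real.rpow_le_rpow hT.le hle h0.le
      have h3 : 0 ≤ 1 / Real.pi * |ξ| ^ (-γ) := by positivity
      calc T ^ γ / γ ≤ |ξ| ^ (-γ) / γ := by gcongr
        _ ≤ _ := by rw [add_mul, div_eq_mul_one_div, mul_comm]; linarith
    · have hδ : 0 < |ξ|⁻¹ := inv_pos.2 hpos
      rw [← intervalIntegral.integral_add_adjacent_intervals (hi _ hδ.le)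
        ((hi _ hδ.le).symm.trans (hi _ hT.le))]
      refine (norm_add_le _ _).trans ((add_le_add (hhead _ hδ.le)
        (intervalIntegral_fhat_kker_tail h1 hξ hδ hle)).trans_eq ?_)
      rw [hδγ, Real.rpow_sub hδ, Real.rpow_one, hδγ]
      field_simp
  rw [hf, norm_div, Complex.norm_real, Real.norm_eq_abs, abs_of_pos hΓ, div_mul_eq_mul_div]
  gcongr

/-! ### Mapping properties of the Riemann–Liouville operator of order less than one -/

lemma rpow_mul_norm_fhat_kker_sq_le {γ : ℝ} (h0 : 0 < γ) (h1 : γ < 1) (T : ℝ) :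
    ∃ C : ℝ, 0 ≤ C ∧ ∀ ξ : ℝ, ξ ≠ 0 →
      ‖fhat (kker γ T) ξ‖ₑ ^ 2 ≤ ENNReal.ofReal C * ENNReal.ofReal (|ξ| ^ (-2 * γ)) := by
  obtain ⟨C, hC, h⟩ := norm_fhat_kker_le h0 h1 T
  refine ⟨C ^ 2, sq_nonneg _, fun ξ hξ => ?_⟩
  rw [← ofReal_norm, ← ENNReal.ofReal_pow (norm_nonneg _), ← ENNReal.ofReal_mul (sq_nonneg _)]
  refine ENNReal.ofReal_le_ofReal ((pow_le_pow_left₀ (norm_nonneg _) (h ξ hξ) 2).trans_eq ?_)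
  rw [mul_pow, ← Real.rpow_natCast (|ξ| ^ (-γ)), ← Real.rpow_mul (abs_nonneg _)]
  congr 2
  push_cast
  ring

/-- The convolution representing `J^γ v` has finite Gagliardo seminorm of order `γ` on the whole
line. -/
theorem gag_conv_kker_le {γ : ℝ} (h0 : 0 < γ) (h1 : γ < 1) (T : ℝ) :
    ∃ C : ℝ, 0 ≤ C ∧ ∀ v : L2 T,
      gag γ (conv (ext v) (kker γ T)) ≤ ENNReal.ofReal C * ‖v‖ₑ ^ 2 := by
  obtain ⟨C, hC, h⟩ := rpow_mul_norm_fhat_kker_sq_le h0 h1 T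
  refine ⟨(gagConst γ).toReal * C, by positivity, fun v => ?_⟩
  rw [gag_eq_fourier (integrable_conv (integrable_ext v) (integrable_kker h0 T)),
    ENNReal.ofReal_mul ENNReal.toReal_nonneg, ENNReal.ofReal_toReal (gagConst_ne_top h0 h1),
    mul_assoc, ← lintegral_enorm_ext_sq, ← lintegral_enorm_fhat_sq (integrable_ext v),
    ← lintegral_const_mul' _ _ ENNReal.ofReal_ne_top]
  refine mul_le_mul_right (lintegral_mono_ae ?_) _
  filter_upwards [Measure.ae_ne volume (0 : ℝ)] with ξ hξ
  rw [fhat_conv (integrable_ext v) (integrable_kker h0 T), enorm_mul, mul_pow]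
  calc _ ≤ ENNReal.ofReal (|ξ| ^ (2 * γ)) * (‖fhat (ext v) ξ‖ₑ ^ 2 *
        (ENNReal.ofReal C * ENNReal.ofReal (|ξ| ^ (-2 * γ)))) := by gcongr; exact h ξ hξ
    _ = (ENNReal.ofReal (|ξ| ^ (2 * γ)) * ENNReal.ofReal (|ξ| ^ (-2 * γ))) *
        (ENNReal.ofReal C * ‖fhat (ext v) ξ‖ₑ ^ 2) := by ring
    _ = _ := by
      rw [← ENNReal.ofReal_mul (by positivity), ← Real.rpow_add (abs_pos.2 hξ)]
      ring_nf
      simp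

lemma gagliardo_le_gag {T θ : ℝ} {u : L2 T} {f : ℝ → ℝ}
    (h : u =ᵐ[volume.restrict (Ioo (0 : ℝ) T)] f) : gagliardo T θ u ≤ gag θ f := by
  rw [gagliardo, gag]
  refine le_trans (lintegral_mono_ae ?_) (setLIntegral_le_lintegral (Ioo 0 T) _)
  filter_upwards [h] with s hs
  refine le_trans (lintegral_mono_ae ?_) (setLIntegral_le_lintegral (Ioo 0 T) _)
  filter_upwards [h] with t ht
  rw [hs, ht]

lemma lintegral_Ioi_one_div_rpow {θ s : ℝ} (hθ : 0 < θ) (hs : 0 < s) :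
    ∫⁻ x in Ioi s, ENNReal.ofReal (1 / x ^ (1 + 2 * θ)) =
      ENNReal.ofReal (s ^ (-2 * θ) / (2 * θ)) := by
  have h1 : ∀ x ∈ Ioi s, 1 / x ^ (1 + 2 * θ) = x ^ (-1 - 2 * θ) := fun x hx => by
    rw [show -1 - 2 * θ = -(1 + 2 * θ) by ring, Real.rpow_neg (hs.trans hx).le, one_div]
  rw [setLIntegral_congr_fun measurableSet_Ioi (fun x hx => by rw [h1 x hx]),
    ← ofReal_integral_eq_lintegral_ofReal (integrableOn_Ioi_rpow_of_lt (by linarith) hs),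
    integral_Ioi_rpow_of_lt (by linarith) hs]
  · congr 1
    rw [show -1 - 2 * θ + 1 = -2 * θ by ring, neg_div, neg_mul, div_neg, neg_neg]
  · filter_upwards [ae_restrict_mem measurableSet_Ioi] with x hx
    exact Real.rpow_nonneg (hs.trans hx).le _

/-- The interaction of a point `s > 0` with the negative half-line. -/
lemma lintegral_Iio_one_div_rpow {θ s : ℝ} (hθ : 0 < θ) (hs : 0 < s) :
    ∫⁻ t in Iio (0 : ℝ), ENNReal.ofReal (1 / |t - s| ^ (1 + 2 * θ)) =
      ENNReal.ofReal (s ^ (-2 * θ) / (2 * θ)) := by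
  rw [← lintegral_Ioi_one_div_rpow hθ hs, ← lintegral_indicator measurableSet_Iio,
    ← lintegral_indicator measurableSet_Ioi, ← lintegral_sub_left_eq_self _ s]
  refine lintegral_congr fun x => ?_
  by_cases hx : s < x
  · rw [indicator_of_mem (show s - x ∈ Iio (0 : ℝ) from sub_neg.2 hx),
      indicator_of_mem (show x ∈ Ioi s from hx)]
    rw [show s - x - s = -x by ring, abs_neg, abs_of_pos (hs.trans hx)]
  · rw [indicator_of_notMem (fun h : s - x ∈ Iio (0 : ℝ) => hx (sub_neg.1 h)),
      indicator_of_notMem (show x ∉ Ioi s from hx)]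

/-- For a function vanishing on `(-∞,0]`, the interaction of `(0,T)` with the negative half-line in
the Gagliardo seminorm of order `1/2` is the integral with weight `1/t`. -/
lemma weightInt_le_gag {T : ℝ} {u : L2 T} {f : ℝ → ℝ}
    (h : u =ᵐ[volume.restrict (Ioo (0 : ℝ) T)] f) (hf : ∀ t ≤ 0, f t = 0) :
    weightInt T u ≤ gag (1 / 2) f := by
  rw [weightInt, gag]
  refine le_trans (lintegral_mono_ae ?_) (setLIntegral_le_lintegral (Ioo 0 T) _)
  filter_upwards [h, ae_restrict_mem measurableSet_Ioo] with s hs hsT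
  refine le_trans ?_ (setLIntegral_le_lintegral (Iio 0) _)
  have h1 : ∀ t ∈ Iio (0 : ℝ), ENNReal.ofReal (|f t - f s| ^ 2 / |t - s| ^ (1 + 2 * (1 / 2 : ℝ))) =
      ENNReal.ofReal (1 / |t - s| ^ (1 + 2 * (1 / 2 : ℝ))) * ‖f s‖ₑ ^ 2 := fun t ht => by
    rw [ofReal_sq_div_rpow, hf t (le_of_lt ht), zero_sub, enorm_neg]
  rw [setLIntegral_congr_fun measurableSet_Iio h1, lintegral_mul_const' _ _ (by finiteness),
    lintegral_Iio_one_div_rpow (by norm_num) hsT.1, hs, Real.enorm_eq_ofReal_abs,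
    ← ENNReal.ofReal_pow (abs_nonneg _), ← ENNReal.ofReal_mul
      (div_nonneg (Real.rpow_nonneg hsT.1.le _) (by norm_num))]
  refine ENNReal.ofReal_le_ofReal (le_of_eq ?_)
  norm_num [Real.rpow_neg_one]

/-! ### Continuity of convolutions of square integrable functions -/

/-- The Cauchy–Schwarz inequality. -/
lemma enorm_integral_mul_sq_le {α : Type*} [MeasurableSpace α] {μ : Measure α} {f g : α → ℝ}
    (hf : AEMeasurable f μ) (hg : AEMeasurable g μ) :
    ‖∫ x, f x * g x ∂μ‖ₑ ^ 2 ≤ (∫⁻ x, ‖f x‖ₑ ^ 2 ∂μ) * ∫⁻ x, ‖g x‖ₑ ^ 2 ∂μ := by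
  have h1 : ‖∫ x, f x * g x ∂μ‖ₑ ≤
      (∫⁻ x, ‖f x‖ₑ ^ (2 : ℝ) ∂μ) ^ (1 / 2 : ℝ) * (∫⁻ x, ‖g x‖ₑ ^ (2 : ℝ) ∂μ) ^ (1 / 2 : ℝ) := by
    refine (enorm_integral_le_lintegral_enorm _).trans ?_
    simp_rw [enorm_mul]
    exact ENNReal.lintegral_mul_le_Lp_mul_Lq μ Real.HolderConjugate.two_two hf.enorm hg.enorm
  refine (pow_le_pow_left₀ zero_le h1 2).trans_eq ?_
  rw [mul_pow, ← ENNReal.rpow_natCast, ← ENNReal.rpow_natCast, ← ENNReal.rpow_mul,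
    ← ENNReal.rpow_mul]
  norm_num

/-- Translation is continuous in `L²`, by dominated convergence on the Fourier side. -/
lemma tendsto_lintegral_translate_sub_sq {k : ℝ → ℝ} (hk : Integrable k)
    (hk2 : ∫⁻ t, ‖k t‖ₑ ^ 2 ≠ ⊤) :
    Tendsto (fun h => ∫⁻ t, ‖k (t + h) - k t‖ₑ ^ 2) (𝓝 0) (𝓝 0) := by
  simp_rw [lintegral_translate_sub_sq hk]
  have hm : Measurable (fun ξ => ‖fhat k ξ‖ₑ ^ 2) :=
    (continuous_fhat hk).measurable.enorm.pow_const _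
  rw [← lintegral_enorm_fhat_sq hk] at hk2
  have h := tendsto_lintegral_filter_of_dominated_convergence (μ := volume) (l := 𝓝 (0 : ℝ))
    (F := fun h (ξ : ℝ) => ENNReal.ofReal ((2 * Real.sin (Real.pi * (ξ * h))) ^ 2) *
      ‖fhat k ξ‖ₑ ^ 2) (f := fun _ => 0) (fun ξ => ENNReal.ofReal 4 * ‖fhat k ξ‖ₑ ^ 2)
    (Eventually.of_forall fun h => Measurable.mul (by fun_prop) hm)
    (Eventually.of_forall fun h => ae_of_all _ fun ξ => by
      gcongr
      nlinarith [Real.sin_sq_le_one (Real.pi * (ξ * h))])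
    (by rw [lintegral_const_mul' _ _ ENNReal.ofReal_ne_top]; finiteness)
    (ae_of_all _ fun ξ => by
      have h1 : Tendsto (fun h : ℝ => ENNReal.ofReal ((2 * Real.sin (Real.pi * (ξ * h))) ^ 2))
          (𝓝 0) (𝓝 (ENNReal.ofReal ((2 * Real.sin (Real.pi * (ξ * 0))) ^ 2))) :=
        (ENNReal.continuous_ofReal.comp (by fun_prop)).tendsto 0
      have h2 := ENNReal.Tendsto.mul_const (b := ‖fhat k ξ‖ₑ ^ 2) h1 (Or.inr (by finiteness))
      simpa using h2)
  simpa using h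

/-- By the Cauchy–Schwarz inequality and the continuity of translation in `L²`. -/
theorem continuous_conv {f k : ℝ → ℝ} (hf : Integrable f) (hk : Integrable k)
    (hf2 : ∫⁻ t, ‖f t‖ₑ ^ 2 ≠ ⊤) (hk2 : ∫⁻ t, ‖k t‖ₑ ^ 2 ≠ ⊤) : Continuous (conv f k) := by
  have hfL : MemLp f 2 := (memLp_two_iff_lintegral hf.1).2 hf2.lt_top
  have hkL : MemLp k 2 := (memLp_two_iff_lintegral hk.1).2 hk2.lt_top
  have hi : ∀ t, Integrable fun s => f s * k (t - s) := fun t =>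
    hfL.integrable_mul (hkL.comp_measurePreserving (Measure.measurePreserving_sub_left volume t))
  rw [continuous_iff_continuousAt]
  intro t₀
  rw [ContinuousAt, tendsto_iff_edist_tendsto_0]
  have hlim : Tendsto (fun t => ((∫⁻ s, ‖f s‖ₑ ^ 2) *
      ∫⁻ s, ‖k (s + (t - t₀)) - k s‖ₑ ^ 2) ^ (1 / 2 : ℝ)) (𝓝 t₀) (𝓝 0) := by
    have h1 : Tendsto (fun t => t - t₀) (𝓝 t₀) (𝓝 0) := by
      have : Continuous fun t : ℝ => t - t₀ := by fun_prop
      simpa using this.tendsto t₀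
    have h2 := ENNReal.Tendsto.const_mul (a := ∫⁻ s, ‖f s‖ₑ ^ 2)
      ((tendsto_lintegral_translate_sub_sq hk hk2).comp h1) (Or.inr hf2)
    have h3 := h2.ennrpow_const (1 / 2 : ℝ)
    simpa using h3
  refine tendsto_of_tendsto_of_tendsto_of_le_of_le tendsto_const_nhds hlim (fun _ => zero_le)
    fun t => ?_
  rw [one_div, ENNReal.le_rpow_inv_iff two_pos, ENNReal.rpow_two, edist_eq_enorm_sub, conv_apply,
    conv_apply, ← integral_sub (hi t) (hi t₀)]
  simp only [← mul_sub]
  have hm : ∀ t, AEMeasurable (fun s => k (t - s)) := fun t =>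
    (hkL.comp_measurePreserving (Measure.measurePreserving_sub_left volume t)).1.aemeasurable
  refine (enorm_integral_mul_sq_le hf.1.aemeasurable ((hm t).sub (hm t₀))).trans_eq ?_
  congr 1
  rw [← lintegral_sub_left_eq_self _ t₀]
  refine lintegral_congr fun s => ?_
  rw [Pi.sub_apply, show t - (t₀ - s) = s + (t - t₀) by ring, sub_sub_cancel]

lemma lintegral_kker_sq_ne_top {γ : ℝ} (hγ : 1 / 2 < γ) (T : ℝ) :
    ∫⁻ t, ‖kker γ T t‖ₑ ^ 2 ≠ ⊤ := by
  have h : IntervalIntegrable (fun r : ℝ => r ^ (2 * (γ - 1))) volume 0 (max T 0) :=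
    intervalIntegral.intervalIntegrable_rpow' (by linarith)
  have h2 : IntegrableOn (fun r : ℝ => r ^ (2 * (γ - 1)) / Real.Gamma γ ^ 2) (Ioo 0 T) volume :=
    (h.1.mono_set (fun x hx => ⟨hx.1, hx.2.le.trans (le_max_left _ _)⟩)).div_const _
  rw [← integrable_indicator_iff measurableSet_Ioo] at h2
  refine (lt_of_eq_of_lt (lintegral_congr fun t => ?_) h2.2).ne
  by_cases ht : t ∈ Ioo 0 T
  · rw [kker, indicator_of_mem ht, indicator_of_mem ht, ← enorm_pow]
    congr 1
    rw [div_pow, ← Real.rpow_natCast, ← Real.rpow_mul ht.1.le]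
    congr 2
    push_cast
    ring
  · rw [kker, indicator_of_notMem ht, indicator_of_notMem ht]
    simp

theorem vanishesAtZero_J {γ : ℝ} (hγ : 1 / 2 < γ) {T : ℝ} (v : L2 T) :
    VanishesAtZero T (J T γ v) := by
  have h0 : 0 < γ := by linarith
  refine ⟨conv (ext v) (kker γ T), (continuous_conv (integrable_ext v) (integrable_kker h0 T)
    ?_ (lintegral_kker_sq_ne_top hγ T)).continuousOn, J_ae h0 v,
    conv_of_nonpos (fun _ => ext_of_nonpos v) (fun _ => kker_of_nonpos γ T) le_rfl⟩
  rw [lintegral_enorm_ext_sq]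
  finiteness

/-! ### The fractional Hardy inequality -/

/-- The Gagliardo seminorm, squared, of a function on `(0,T)`. -/
def gagOn (T θ : ℝ) (f : ℝ → ℝ) : ℝ≥0∞ :=
  ∫⁻ s in Ioo (0 : ℝ) T, ∫⁻ t in Ioo (0 : ℝ) T,
    ENNReal.ofReal (|f t - f s| ^ 2 / |t - s| ^ (1 + 2 * θ))

lemma gagOn_congr {T θ : ℝ} {f g : ℝ → ℝ} (h : f =ᵐ[volume.restrict (Ioo (0 : ℝ) T)] g) :
    gagOn T θ f = gagOn T θ g := by
  refine lintegral_congr_ae ?_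
  filter_upwards [h] with s hs
  refine lintegral_congr_ae ?_
  filter_upwards [h] with t ht
  rw [hs, ht]

/-- The difference between the scales `t` and `r t`, squared, in the weighted norm of Hardy's
inequality. -/
def scaleDiff (T θ : ℝ) (f : ℝ → ℝ) (r : ℝ) : ℝ≥0∞ :=
  ∫⁻ t in Ioo (0 : ℝ) T, ENNReal.ofReal (t ^ (-2 * θ)) * ‖f t - f (r * t)‖ₑ ^ 2

/-- Averaging the differences of scales over `r ∈ (1/4,1/2)` amounts to integrating over pairs
`(t,s)` with `t/4 < s < t/2`, where `|t - s|` is comparable to `t`. -/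
lemma lintegral_scaleDiff_le {T θ : ℝ} (hθ : 0 < θ) {f : ℝ → ℝ} (hf : Measurable f) :
    ∫⁻ r in Ioo (1 / 4 : ℝ) (1 / 2), scaleDiff T θ f r ≤ gagOn T θ f := by
  simp only [scaleDiff]
  rw [lintegral_lintegral_swap (by
    refine Measurable.aemeasurable ?_
    simp only [Function.uncurry_def]
    fun_prop), gagOn]
  refine setLIntegral_mono' measurableSet_Ioo fun t ht => ?_
  have h1 : ∫⁻ r in Ioo (1 / 4 : ℝ) (1 / 2),
      ENNReal.ofReal (t ^ (-2 * θ)) * ‖f t - f (r * t)‖ₑ ^ 2 =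
      ∫⁻ r, (Ioo (t / 4) (t / 2)).indicator
        (fun s => ENNReal.ofReal (t ^ (-2 * θ)) * ‖f t - f s‖ₑ ^ 2) (t * r) := by
    rw [← lintegral_indicator measurableSet_Ioo]
    refine lintegral_congr fun r => ?_
    have hiff : r ∈ Ioo (1 / 4 : ℝ) (1 / 2) ↔ t * r ∈ Ioo (t / 4) (t / 2) := by
      have := ht.1
      constructor
      · rintro ⟨h1, h2⟩; constructor <;> nlinarith
      · rintro ⟨h1, h2⟩; constructor <;> nlinarith
    by_cases hr : r ∈ Ioo (1 / 4 : ℝ) (1 / 2)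
    · rw [indicator_of_mem hr, indicator_of_mem (hiff.1 hr), mul_comm r t]
    · rw [indicator_of_notMem hr, indicator_of_notMem (fun h => hr (hiff.2 h))]
  rw [h1, lintegral_comp_mul_left _ ht.1.ne', ← lintegral_const_mul' _ _ ENNReal.ofReal_ne_top,
    ← lintegral_indicator measurableSet_Ioo]
  refine lintegral_mono fun s => ?_
  by_cases hs : s ∈ Ioo (t / 4) (t / 2)
  · have hs0 : 0 < s := by linarith [hs.1, ht.1]
    have hst : s < t := by linarith [hs.2, ht.1]
    simp only
    rw [indicator_of_mem hs, indicator_of_mem (show s ∈ Ioo 0 T from ⟨hs0, hst.trans ht.2⟩),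
      ofReal_sq_div_rpow, ← mul_assoc, ← ENNReal.ofReal_mul (abs_nonneg _),
      ← enorm_neg (f s - f t), neg_sub]
    gcongr
    rw [abs_inv, abs_of_pos ht.1, abs_sub_comm, abs_of_pos (sub_pos.2 hst)]
    have h2 : t⁻¹ * t ^ (-2 * θ) = 1 / t ^ (1 + 2 * θ) := by
      rw [← Real.rpow_neg_one, ← Real.rpow_add ht.1, one_div, ← Real.rpow_neg ht.1.le]
      congr 1
      ring
    rw [h2]
    have h3 : 0 < t - s := sub_pos.2 hst
    have h4 : t - s ≤ t := by linarith
    gcongr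
  · simp only
    rw [indicator_of_notMem hs, mul_zero]
    exact zero_le

/-- Some ratio of scales is controlled by the Gagliardo seminorm, since the average over `(1/4,1/2)`
is; the factor `4` is the inverse length of this interval. -/
lemma exists_scaleDiff_le {T θ : ℝ} (hθ : 0 < θ) {f : ℝ → ℝ} (hf : Measurable f) :
    ∃ r : ℝ, 1 / 4 < r ∧ r < 1 / 2 ∧ scaleDiff T θ f r ≤ 4 * gagOn T θ f := by
  by_contra! h
  have hv : volume (Ioo (1 / 4 : ℝ) (1 / 2)) = ENNReal.ofReal (1 / 4) := by
    rw [Real.volume_Ioo]; norm_num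
  by_cases htop : gagOn T θ f = ⊤
  · have := h (3 / 8) (by norm_num) (by norm_num)
    rw [htop, ENNReal.mul_top (by norm_num)] at this
    exact not_top_lt this
  have hm : Measurable (scaleDiff T θ f) := by
    refine Measurable.lintegral_prod_right' (f := fun p : ℝ × ℝ =>
      ENNReal.ofReal (p.2 ^ (-2 * θ)) * ‖f p.2 - f (p.1 * p.2)‖ₑ ^ 2) ?_
    fun_prop
  have h1 : ∫⁻ r in Ioo (1 / 4 : ℝ) (1 / 2), 4 * gagOn T θ f <
      ∫⁻ r in Ioo (1 / 4 : ℝ) (1 / 2), scaleDiff T θ f r := by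
    refine setLIntegral_strict_mono measurableSet_Ioo (by rw [hv]; simp) hm
      ?_ (ae_of_all _ fun r hr => h r hr.1 hr.2)
    rw [setLIntegral_const, hv]
    finiteness
  rw [setLIntegral_const, hv, mul_comm, ← mul_assoc] at h1
  have h2 : ENNReal.ofReal (1 / 4) * 4 = 1 := by
    rw [show (4 : ℝ≥0∞) = ENNReal.ofReal 4 by simp, ← ENNReal.ofReal_mul (by norm_num)]
    norm_num
  rw [h2, one_mul] at h1
  exact absurd (lintegral_scaleDiff_le hθ hf) (not_le.2 h1)

lemma setLIntegral_weight_comp_mul (θ : ℝ) {r a b : ℝ} (hr : 0 < r) (ha : 0 ≤ a)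
    (G : ℝ → ℝ≥0∞) :
    ∫⁻ t in Ioo a b, ENNReal.ofReal (t ^ (-2 * θ)) * G (r * t) =
      ENNReal.ofReal (r ^ (2 * θ - 1)) *
        ∫⁻ s in Ioo (r * a) (r * b), ENNReal.ofReal (s ^ (-2 * θ)) * G s := by
  have h1 : ∫⁻ t in Ioo a b, ENNReal.ofReal (t ^ (-2 * θ)) * G (r * t) =
      ∫⁻ t, ENNReal.ofReal (r ^ (2 * θ)) * (Ioo (r * a) (r * b)).indicator
        (fun s => ENNReal.ofReal (s ^ (-2 * θ)) * G s) (r * t) := by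
    rw [← lintegral_indicator measurableSet_Ioo]
    refine lintegral_congr fun t => ?_
    have hiff : t ∈ Ioo a b ↔ r * t ∈ Ioo (r * a) (r * b) := by
      simp only [mem_Ioo, mul_lt_mul_iff_right₀ hr]
    by_cases ht : t ∈ Ioo a b
    · have ht0 : 0 < t := ha.trans_lt ht.1
      rw [indicator_of_mem ht, indicator_of_mem (hiff.1 ht), ← mul_assoc,
        ← ENNReal.ofReal_mul (by positivity), Real.mul_rpow hr.le ht0.le, ← mul_assoc,
        ← Real.rpow_add hr, show 2 * θ + -2 * θ = 0 by ring, Real.rpow_zero, one_mul]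
    · rw [indicator_of_notMem ht, indicator_of_notMem (fun h => ht (hiff.2 h)), mul_zero]
  rw [h1, lintegral_const_mul' _ _ ENNReal.ofReal_ne_top, lintegral_comp_mul_left _ hr.ne',
    ← mul_assoc, ← ENNReal.ofReal_mul (by positivity), lintegral_indicator measurableSet_Ioo,
    abs_inv, abs_of_pos hr, Real.rpow_sub hr, Real.rpow_one, div_eq_mul_inv]

/-- Absorption of a finite term with coefficient less than one. -/
lemma le_of_le_mul_add {x B : ℝ≥0∞} {q : ℝ} (hx : x ≠ ⊤) (hq0 : 0 ≤ q) (hq : q < 1)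
    (h : x ≤ ENNReal.ofReal q * x + B) : x ≤ ENNReal.ofReal (1 / (1 - q)) * B := by
  have hq1 : 0 < 1 - q := by linarith
  by_cases hB : B = ⊤
  · rw [hB, ENNReal.mul_top]
    · exact le_top
    · simpa using hq
  lift x to NNReal using hx
  lift B to NNReal using hB
  have h1 : (x : ℝ) ≤ q * x + B := by
    have := ENNReal.toReal_mono (by finiteness) h
    rw [ENNReal.toReal_add (by finiteness) (by finiteness), ENNReal.toReal_mul,
      ENNReal.toReal_ofReal hq0] at this
    simpa using this
  rw [← ENNReal.ofReal_coe_nnreal, ← ENNReal.ofReal_coe_nnreal (p := B),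
    ← ENNReal.ofReal_mul (by positivity)]
  refine ENNReal.ofReal_le_ofReal ?_
  rw [div_mul_eq_mul_div, one_mul, le_div_iff₀ hq1]
  linarith

/-- Young's inequality for the square of `b = a - (a - b)`, with a coefficient of `a²` close to one. -/
lemma enorm_sq_le_mul_add {l : ℝ} (hl : 1 < l) (a b : ℝ) :
    ‖b‖ₑ ^ 2 ≤ ENNReal.ofReal l * ‖a‖ₑ ^ 2 + ENNReal.ofReal (l / (l - 1)) * ‖a - b‖ₑ ^ 2 := by
  have hl1 : 0 < l - 1 := by linarith
  have h : ∀ x : ℝ, ‖x‖ₑ ^ 2 = ENNReal.ofReal (x ^ 2) := fun x => by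
    rw [Real.enorm_eq_ofReal_abs, ← ENNReal.ofReal_pow (abs_nonneg _), sq_abs]
  rw [h, h, h, ← ENNReal.ofReal_mul (by positivity), ← ENNReal.ofReal_mul (by positivity),
    ← ENNReal.ofReal_add (by positivity) (by positivity)]
  refine ENNReal.ofReal_le_ofReal ?_
  have h2 : l * a ^ 2 + l / (l - 1) * (a - b) ^ 2 - b ^ 2 =
      ((l - 1) * a + (a - b)) ^ 2 / (l - 1) := by
    field_simp
    ring
  have h3 : 0 ≤ ((l - 1) * a + (a - b)) ^ 2 / (l - 1) := by positivity
  linarith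

/-- The fractional Hardy inequality below the critical order: small scales are compared with
larger ones, and the weighted integral is absorbed. -/
theorem hardy_lt_half {θ T : ℝ} (h0 : 0 < θ) (h1 : θ < 1 / 2) (hT : 0 < T) :
    ∃ C : ℝ, 0 ≤ C ∧ ∀ f : ℝ → ℝ, Measurable f → ∫⁻ t in Ioo 0 T, ‖f t‖ₑ ^ 2 ≠ ⊤ →
      ∫⁻ t in Ioo 0 T, ENNReal.ofReal (t ^ (-2 * θ)) * ‖f t‖ₑ ^ 2 ≤
        ENNReal.ofReal C * ((∫⁻ t in Ioo 0 T, ‖f t‖ₑ ^ 2) + gagOn T θ f) := by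
  -- `l` is chosen such that `r ^ (1 - 2 * θ) * l ≤ l⁻¹ < 1` whenever `r ≤ 1 / 2`
  set l : ℝ := 2 ^ ((1 - 2 * θ) / 2) with hl
  have hl1 : 1 < l := Real.one_lt_rpow (by norm_num) (by linarith)
  have hl0 : 0 < l - 1 := by linarith
  set D : ℝ := max ((T / 4) ^ (-2 * θ)) (l / (l - 1) * 4) with hD
  have hD0 : 0 ≤ D := le_max_of_le_left (by positivity)
  refine ⟨1 / (1 - l⁻¹) * D, ?_, fun f hf hf2 => ?_⟩
  · have : l⁻¹ < 1 := inv_lt_one_of_one_lt₀ hl1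
    have : 0 < 1 - l⁻¹ := by linarith
    positivity
  obtain ⟨r, hr1, hr2, hr⟩ := exists_scaleDiff_le (T := T) h0 hf
  have hr0 : 0 < r := by linarith
  set w : ℝ → ℝ≥0∞ := fun t => ENNReal.ofReal (t ^ (-2 * θ)) * ‖f t‖ₑ ^ 2 with hw
  set N : ℝ≥0∞ := ∫⁻ t in Ioo 0 T, ‖f t‖ₑ ^ 2 with hN
  have hwle : ∀ c : ℝ, 0 < c → ∫⁻ t in Ico c T, w t ≤ ENNReal.ofReal (c ^ (-2 * θ)) * N := by
    intro c hc
    calc ∫⁻ t in Ico c T, w t ≤ ∫⁻ t in Ico c T, ENNReal.ofReal (c ^ (-2 * θ)) * ‖f t‖ₑ ^ 2 := by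
          refine setLIntegral_mono' measurableSet_Ico fun t ht => ?_
          refine mul_le_mul_left (ENNReal.ofReal_le_ofReal ?_) _
          exact Real.rpow_le_rpow_of_nonpos hc ht.1 (by linarith)
      _ = ENNReal.ofReal (c ^ (-2 * θ)) * ∫⁻ t in Ico c T, ‖f t‖ₑ ^ 2 :=
          lintegral_const_mul' _ _ ENNReal.ofReal_ne_top
      _ ≤ _ := by
          gcongr
          exact lintegral_mono_set fun t ht => ⟨hc.trans_le ht.1, ht.2⟩
  -- absorption needs a finite integral, hence the cutoff `δ`, removed by monotone convergence
  have key : ∀ δ : ℝ, 0 < δ → ∫⁻ t in Ioo δ T, w t ≤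
      ENNReal.ofReal (1 / (1 - l⁻¹) * D) * (N + gagOn T θ f) := by
    intro δ hδ
    have hfin : ∫⁻ t in Ioo δ T, w t ≠ ⊤ := by
      refine ((lintegral_mono_set Ioo_subset_Ico_self).trans_lt ((hwle δ hδ).trans_lt ?_)).ne
      finiteness
    rw [ENNReal.ofReal_mul (by
      have : l⁻¹ < 1 := inv_lt_one_of_one_lt₀ hl1
      have : 0 < 1 - l⁻¹ := by linarith
      positivity), mul_assoc]
    refine le_of_le_mul_add hfin (by positivity) (inv_lt_one_of_one_lt₀ hl1) ?_
    have hsplit : Ioo δ T ⊆ Ioo (r * δ) (r * T) ∪ Ico (r * T) T := by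
      intro t ht
      rcases lt_or_ge t (r * T) with h | h
      · exact Or.inl ⟨by nlinarith [ht.1], h⟩
      · exact Or.inr ⟨h, ht.2⟩
    have hA : ∫⁻ t in Ico (r * T) T, w t ≤ ENNReal.ofReal D * N := by
      refine (hwle _ (by positivity)).trans ?_
      gcongr
      refine le_max_of_le_left ?_
      exact Real.rpow_le_rpow_of_nonpos (by positivity) (by nlinarith) (by linarith)
    have hrp : r ^ (1 - 2 * θ) * r ^ (2 * θ - 1) = 1 := by
      rw [← Real.rpow_add hr0]
      simp
    have hrl : r ^ (1 - 2 * θ) ≤ l⁻¹ * l⁻¹ := by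
      have h3 : l⁻¹ * l⁻¹ = (1 / 2 : ℝ) ^ (1 - 2 * θ) := by
        rw [← mul_inv, hl, ← Real.rpow_add two_pos, one_div, Real.inv_rpow two_pos.le]
        congr 2
        ring
      rw [h3]
      exact Real.rpow_le_rpow hr0.le hr2.le (by linarith)
    have hrl1 : r ^ (1 - 2 * θ) ≤ 1 := Real.rpow_le_one hr0.le (by linarith) (by linarith)
    have hB : ∫⁻ t in Ioo (r * δ) (r * T), w t ≤
        ENNReal.ofReal l⁻¹ * (∫⁻ t in Ioo δ T, w t) + ENNReal.ofReal D * gagOn T θ f := by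
      have hs := setLIntegral_weight_comp_mul θ (b := T) hr0 hδ.le (fun t => ‖f t‖ₑ ^ 2)
      calc ∫⁻ t in Ioo (r * δ) (r * T), w t = ENNReal.ofReal (r ^ (1 - 2 * θ)) *
            ∫⁻ t in Ioo δ T, ENNReal.ofReal (t ^ (-2 * θ)) * ‖f (r * t)‖ₑ ^ 2 := by
            rw [hs, ← mul_assoc, ← ENNReal.ofReal_mul (by positivity), hrp]
            simp [hw]
        _ ≤ ENNReal.ofReal (r ^ (1 - 2 * θ)) * ∫⁻ t in Ioo δ T, (ENNReal.ofReal l * w t +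
              ENNReal.ofReal (l / (l - 1)) *
                (ENNReal.ofReal (t ^ (-2 * θ)) * ‖f t - f (r * t)‖ₑ ^ 2)) := by
            gcongr with t
            calc _ ≤ ENNReal.ofReal (t ^ (-2 * θ)) * (ENNReal.ofReal l * ‖f t‖ₑ ^ 2 +
                  ENNReal.ofReal (l / (l - 1)) * ‖f t - f (r * t)‖ₑ ^ 2) := by
                  gcongr
                  exact enorm_sq_le_mul_add hl1 _ _
              _ = _ := by rw [hw]; ring
        _ = ENNReal.ofReal (r ^ (1 - 2 * θ)) * (ENNReal.ofReal l * (∫⁻ t in Ioo δ T, w t) +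
              ENNReal.ofReal (l / (l - 1)) * ∫⁻ t in Ioo δ T,
                (ENNReal.ofReal (t ^ (-2 * θ)) * ‖f t - f (r * t)‖ₑ ^ 2)) := by
            rw [lintegral_add_left (by fun_prop), lintegral_const_mul' _ _ ENNReal.ofReal_ne_top,
              lintegral_const_mul' _ _ ENNReal.ofReal_ne_top]
        _ ≤ ENNReal.ofReal (r ^ (1 - 2 * θ)) * (ENNReal.ofReal l * (∫⁻ t in Ioo δ T, w t) +
              ENNReal.ofReal (l / (l - 1)) * (4 * gagOn T θ f)) := by
            gcongr
            refine (lintegral_mono_set ?_).trans hr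
            exact fun t ht => ⟨hδ.trans ht.1, ht.2⟩
        _ = ENNReal.ofReal (r ^ (1 - 2 * θ) * l) * (∫⁻ t in Ioo δ T, w t) +
              ENNReal.ofReal (r ^ (1 - 2 * θ) * (l / (l - 1) * 4)) * gagOn T θ f := by
            rw [ENNReal.ofReal_mul (by positivity), ENNReal.ofReal_mul (by positivity),
              ENNReal.ofReal_mul (p := l / (l - 1)) (by positivity)]
            simp only [ENNReal.ofReal_ofNat]
            ring
        _ ≤ _ := by
            gcongr
            · calc r ^ (1 - 2 * θ) * l ≤ l⁻¹ * l⁻¹ * l := by gcongr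
                _ = l⁻¹ := by field_simp
            · refine (mul_le_of_le_one_left (by positivity) hrl1).trans (le_max_right _ _)
    calc ∫⁻ t in Ioo δ T, w t ≤ (∫⁻ t in Ioo (r * δ) (r * T), w t) + ∫⁻ t in Ico (r * T) T, w t :=
          (lintegral_mono_set hsplit).trans (lintegral_union_le _ _ _)
      _ ≤ _ := (add_le_add hB hA).trans_eq (by ring)
  have hU : Ioo 0 T = ⋃ n : ℕ, Ioo (1 / ((n : ℝ) + 1)) T := by
    ext t
    simp only [mem_iUnion, mem_Ioo]
    constructor
    · rintro ⟨h2, h3⟩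
      obtain ⟨n, hn⟩ := exists_nat_one_div_lt h2
      exact ⟨n, hn, h3⟩
    · rintro ⟨n, h2, h3⟩
      exact ⟨lt_trans (by positivity) h2, h3⟩
  rw [hU, setLIntegral_iUnion_of_directed]
  · exact iSup_le fun n => key _ (by positivity)
  · refine Monotone.directed_le fun m n hmn t ht => ⟨lt_of_le_of_lt ?_ ht.1, ht.2⟩
    have : (m : ℝ) ≤ n := by exact_mod_cast hmn
    gcongr

/-- The Cauchy–Schwarz inequality for a series, against a geometric sequence. -/
lemma tsum_sq_le_geometric {q : ℝ} (hq0 : 0 < q) (hq1 : q < 1) (a : ℕ → ℝ≥0∞) :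
    (∑' n, a n) ^ 2 ≤ ENNReal.ofReal (1 / (1 - q ^ 2)) *
      ∑' n, ENNReal.ofReal ((q ^ 2)⁻¹ ^ n) * a n ^ 2 := by
  have hq2 : q ^ 2 < 1 := by nlinarith
  have h1 : ∀ n, a n = ENNReal.ofReal (q ^ n) * (ENNReal.ofReal (q⁻¹ ^ n) * a n) := fun n => by
    rw [← mul_assoc, ← ENNReal.ofReal_mul (by positivity), ← mul_pow, mul_inv_cancel₀ hq0.ne']
    simp
  have h2 := ENNReal.lintegral_mul_le_Lp_mul_Lq (Measure.count (α := ℕ))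
    Real.HolderConjugate.two_two (f := fun n => ENNReal.ofReal (q ^ n))
    (g := fun n => ENNReal.ofReal (q⁻¹ ^ n) * a n)
    (measurable_of_countable _).aemeasurable (measurable_of_countable _).aemeasurable
  simp only [lintegral_count, Pi.mul_apply, ← h1] at h2
  refine (pow_le_pow_left₀ zero_le h2 2).trans_eq ?_
  rw [mul_pow, ← ENNReal.rpow_natCast, ← ENNReal.rpow_natCast, ← ENNReal.rpow_mul,
    ← ENNReal.rpow_mul]
  norm_num only [ENNReal.rpow_one]
  congr 1
  · have h3 : ∀ n : ℕ, ENNReal.ofReal (q ^ n) ^ (2 : ℝ) = ENNReal.ofReal ((q ^ 2) ^ n) := fun n => by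
      rw [ENNReal.rpow_two, ← ENNReal.ofReal_pow (by positivity)]
      congr 1
      ring
    simp_rw [h3]
    rw [← ENNReal.ofReal_tsum_of_nonneg (fun n => by positivity)
      (summable_geometric_of_lt_one (by positivity) hq2),
      tsum_geometric_of_lt_one (by positivity) hq2, one_div]
  · refine tsum_congr fun n => ?_
    rw [ENNReal.rpow_two, mul_pow, ← ENNReal.ofReal_pow (by positivity)]
    congr 2
    rw [inv_pow, inv_pow, inv_pow]
    ring

/-- The fractional Hardy inequality above the critical order, for a function tending to `0` at
`0`: the function is the sum of its differences between consecutive scales. -/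
theorem hardy_gt_half {θ T : ℝ} (h1 : 1 / 2 < θ) (hT : 0 < T) :
    ∃ C : ℝ, 0 ≤ C ∧ ∀ f : ℝ → ℝ, Measurable f → Tendsto f (𝓝[>] 0) (𝓝 0) →
      ∫⁻ t in Ioo 0 T, ENNReal.ofReal (t ^ (-2 * θ)) * ‖f t‖ₑ ^ 2 ≤
        ENNReal.ofReal C * gagOn T θ f := by
  have h0 : 0 < θ := by linarith
  -- `q` is chosen such that `r ^ (2 * θ - 1) ≤ q ^ 4` whenever `r ≤ 1 / 2`: half of this decay of
  -- the terms pays for the Cauchy–Schwarz inequality, the other half for summability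
  set q : ℝ := (1 / 2) ^ ((2 * θ - 1) / 4) with hq
  have hq0 : 0 < q := by positivity
  have hq1 : q < 1 := Real.rpow_lt_one (by norm_num) (by norm_num) (by linarith)
  have hq2 : q ^ 2 < 1 := by nlinarith
  have hq3 : 0 < 1 - q ^ 2 := by linarith
  refine ⟨1 / (1 - q ^ 2) * (1 / (1 - q ^ 2) * 4), by positivity, fun f hf hf0 => ?_⟩
  obtain ⟨r, hr1, hr2, hr⟩ := exists_scaleDiff_le (T := T) h0 hf
  have hr0 : 0 < r := by linarith
  have hrn : ∀ n : ℕ, 0 < r ^ n := fun n => pow_pos hr0 n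
  set d : ℝ → ℝ := fun t => f t - f (r * t) with hd
  have hdm : Measurable d := by fun_prop
  have hrq : r ^ (2 * θ - 1) ≤ q ^ 2 * q ^ 2 := by
    have h3 : q ^ 2 * q ^ 2 = (1 / 2 : ℝ) ^ (2 * θ - 1) := by
      rw [← pow_add, hq, ← Real.rpow_natCast, ← Real.rpow_mul (by norm_num)]
      congr 1
      push_cast
      ring
    rw [h3]
    exact Real.rpow_le_rpow hr0.le hr2.le (by linarith)
  have hpt : ∀ t : ℝ, 0 < t → ‖f t‖ₑ ≤ ∑' n : ℕ, ‖d (r ^ n * t)‖ₑ := by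
    intro t ht
    have hsum : ∀ n : ℕ, ‖f t‖ₑ ≤ (∑' n : ℕ, ‖d (r ^ n * t)‖ₑ) + ‖f (r ^ n * t)‖ₑ := by
      intro n
      have h4 : f t = (∑ i ∈ Finset.range n, d (r ^ i * t)) + f (r ^ n * t) := by
        induction n with
        | zero => simp
        | succ n ih =>
          rw [Finset.sum_range_succ, hd]
          simp only [← mul_assoc, ← pow_succ']
          rw [ih, hd]
          simp only [← mul_assoc, ← pow_succ']
          ring
      rw [h4]
      refine (enorm_add_le _ _).trans (add_le_add ?_ le_rfl)
      exact (enorm_sum_le _ _).trans (ENNReal.sum_le_tsum _)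
    have hlim : Tendsto (fun n : ℕ => r ^ n * t) atTop (𝓝[>] 0) := by
      refine tendsto_nhdsWithin_iff.2 ⟨?_, Eventually.of_forall fun n => mul_pos (hrn n) ht⟩
      simpa using (tendsto_pow_atTop_nhds_zero_of_lt_one hr0.le (by linarith)).mul_const t
    have h5 : Tendsto (fun n : ℕ => ‖f (r ^ n * t)‖ₑ) atTop (𝓝 0) := by
      simpa [Function.comp_def] using (continuous_enorm.tendsto (0 : ℝ)).comp (hf0.comp hlim)
    refine ge_of_tendsto' (f := fun n : ℕ => (∑' n : ℕ, ‖d (r ^ n * t)‖ₑ) + ‖f (r ^ n * t)‖ₑ)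
      (x := atTop) ?_ hsum
    simpa using tendsto_const_nhds.add h5
  have hterm : ∀ n : ℕ, ∫⁻ t in Ioo 0 T, ENNReal.ofReal (t ^ (-2 * θ)) * ‖d (r ^ n * t)‖ₑ ^ 2 ≤
      ENNReal.ofReal ((q ^ 2 * q ^ 2) ^ n) * scaleDiff T θ f r := by
    intro n
    rw [setLIntegral_weight_comp_mul θ (hrn n) le_rfl (fun t => ‖d t‖ₑ ^ 2), scaleDiff]
    gcongr
    · rw [← Real.rpow_natCast, ← Real.rpow_mul hr0.le, mul_comm, Real.rpow_mul hr0.le,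
        Real.rpow_natCast]
      gcongr
    · simp
    · exact mul_le_of_le_one_left hT.le (pow_le_one₀ hr0.le (by linarith))
  calc ∫⁻ t in Ioo 0 T, ENNReal.ofReal (t ^ (-2 * θ)) * ‖f t‖ₑ ^ 2
      ≤ ∫⁻ t in Ioo 0 T, ENNReal.ofReal (1 / (1 - q ^ 2)) * ∑' n : ℕ, ENNReal.ofReal ((q ^ 2)⁻¹ ^ n) *
          (ENNReal.ofReal (t ^ (-2 * θ)) * ‖d (r ^ n * t)‖ₑ ^ 2) := by
        refine setLIntegral_mono' measurableSet_Ioo fun t ht => ?_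
        calc _ ≤ ENNReal.ofReal (t ^ (-2 * θ)) * (ENNReal.ofReal (1 / (1 - q ^ 2)) *
              ∑' n : ℕ, ENNReal.ofReal ((q ^ 2)⁻¹ ^ n) * ‖d (r ^ n * t)‖ₑ ^ 2) := by
              gcongr
              exact (pow_le_pow_left₀ zero_le (hpt t ht.1) 2).trans
                (tsum_sq_le_geometric hq0 hq1 _)
          _ = _ := by
              rw [mul_left_comm, ← ENNReal.tsum_mul_left]
              congr 2
              ext n
              ring
    _ = ENNReal.ofReal (1 / (1 - q ^ 2)) * ∑' n : ℕ, ENNReal.ofReal ((q ^ 2)⁻¹ ^ n) *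
          ∫⁻ t in Ioo 0 T, ENNReal.ofReal (t ^ (-2 * θ)) * ‖d (r ^ n * t)‖ₑ ^ 2 := by
        rw [lintegral_const_mul' _ _ ENNReal.ofReal_ne_top, lintegral_tsum (fun n => by fun_prop)]
        congr 2
        ext n
        rw [lintegral_const_mul' _ _ ENNReal.ofReal_ne_top]
    _ ≤ ENNReal.ofReal (1 / (1 - q ^ 2)) * ∑' n : ℕ, ENNReal.ofReal ((q ^ 2)⁻¹ ^ n) *
          (ENNReal.ofReal ((q ^ 2 * q ^ 2) ^ n) * scaleDiff T θ f r) := by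
        gcongr with n
        exact hterm n
    _ = ENNReal.ofReal (1 / (1 - q ^ 2)) * (ENNReal.ofReal (1 / (1 - q ^ 2)) *
          scaleDiff T θ f r) := by
        congr 1
        have h6 : ∀ n : ℕ, ENNReal.ofReal ((q ^ 2)⁻¹ ^ n) *
            (ENNReal.ofReal ((q ^ 2 * q ^ 2) ^ n) * scaleDiff T θ f r) =
            ENNReal.ofReal ((q ^ 2) ^ n) * scaleDiff T θ f r := fun n => by
          rw [← mul_assoc, ← ENNReal.ofReal_mul (by positivity), ← mul_pow,
            inv_mul_cancel_left₀ (by positivity)]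
        simp_rw [h6]
        rw [ENNReal.tsum_mul_right, ← ENNReal.ofReal_tsum_of_nonneg (fun n => by positivity)
          (summable_geometric_of_lt_one (by positivity) hq2),
          tsum_geometric_of_lt_one (by positivity) hq2, one_div]
    _ ≤ ENNReal.ofReal (1 / (1 - q ^ 2)) * (ENNReal.ofReal (1 / (1 - q ^ 2)) *
          (4 * gagOn T θ f)) := by gcongr
    _ = _ := by
        rw [ENNReal.ofReal_mul (by positivity), ENNReal.ofReal_mul (p := 1 / (1 - q ^ 2))
          (q := 4) (by positivity)]
        simp only [ENNReal.ofReal_ofNat]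
        ring

/-! ### Extension from the interval to the line -/

/-- The folding of the line at `T`, which maps `(0,2T)` onto `(0,T]`. -/
def fold (T t : ℝ) : ℝ := T - |T - t|

/-- Even reflection at `T`, followed by extension by zero outside `(0,2T)`. -/
def reflectExt (T : ℝ) (f : ℝ → ℝ) : ℝ → ℝ :=
  (Ioo (0 : ℝ) (2 * T)).indicator fun t => f (fold T t)

lemma measurable_fold (T : ℝ) : Measurable (fold T) := by unfold fold; fun_prop

lemma measurable_reflectExt (T : ℝ) {f : ℝ → ℝ} (hf : Measurable f) :
    Measurable (reflectExt T f) :=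
  (hf.comp (measurable_fold T)).indicator measurableSet_Ioo

lemma reflectExt_of_nonpos (T : ℝ) (f : ℝ → ℝ) {t : ℝ} (ht : t ≤ 0) : reflectExt T f t = 0 :=
  indicator_of_notMem (fun h => h.1.not_ge ht) _

lemma reflectExt_of_mem {T : ℝ} (f : ℝ → ℝ) {t : ℝ} (ht : t ∈ Ioo 0 T) :
    reflectExt T f t = f t := by
  rw [reflectExt, indicator_of_mem (show t ∈ Ioo 0 (2 * T) from ⟨ht.1, by linarith [ht.1, ht.2]⟩),
    fold, abs_of_pos (sub_pos.2 ht.2), sub_sub_cancel]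

/-- Each point of `(0,T)` has two preimages in `(0,2T)` under the folding. -/
lemma setLIntegral_comp_fold (T : ℝ) (G : ℝ → ℝ≥0∞) :
    ∫⁻ t in Ioo 0 (2 * T), G (fold T t) ≤ 2 * ∫⁻ t in Ioo 0 T, G t := by
  have hsub : Ioo 0 (2 * T) ⊆ Ioc 0 T ∪ Ioo T (2 * T) := by
    intro t ht
    rcases le_or_gt t T with h | h
    · exact Or.inl ⟨ht.1, h⟩
    · exact Or.inr ⟨h, ht.2⟩
  have h0 : (volume : Measure ℝ).restrict (Ioc 0 T) = volume.restrict (Ioo 0 T) :=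
    restrict_Ioo_eq_restrict_Ioc.symm
  have h1 : ∫⁻ t in Ioo 0 T, G (fold T t) = ∫⁻ t in Ioo 0 T, G t := by
    refine setLIntegral_congr_fun measurableSet_Ioo fun t ht => ?_
    rw [fold, abs_of_pos (sub_pos.2 ht.2), sub_sub_cancel]
  have h2 : ∫⁻ t in Ioo T (2 * T), G (fold T t) = ∫⁻ t in Ioo 0 T, G t := by
    rw [← lintegral_indicator measurableSet_Ioo, ← lintegral_indicator measurableSet_Ioo,
      ← lintegral_sub_left_eq_self _ (2 * T)]
    refine lintegral_congr fun t => ?_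
    have hiff : 2 * T - t ∈ Ioo T (2 * T) ↔ t ∈ Ioo 0 T := by
      simp only [mem_Ioo]
      constructor <;> rintro ⟨h1, h2⟩ <;> constructor <;> linarith
    by_cases ht : t ∈ Ioo 0 T
    · rw [indicator_of_mem ht, indicator_of_mem (hiff.2 ht), fold,
        show T - (2 * T - t) = -(T - t) by ring, abs_neg, abs_of_pos (sub_pos.2 ht.2),
        sub_sub_cancel]
    · rw [indicator_of_notMem ht, indicator_of_notMem (fun h => ht (hiff.1 h))]
  refine (lintegral_mono_set hsub).trans ((lintegral_union_le _ _ _).trans_eq ?_)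
  rw [h0, h1, h2, two_mul]

lemma integrable_reflectExt {T : ℝ} {f : ℝ → ℝ} (hf : Measurable f)
    (hfi : IntegrableOn f (Ioo 0 T)) : Integrable (reflectExt T f) := by
  refine ⟨(measurable_reflectExt T hf).aestronglyMeasurable, ?_⟩
  rw [hasFiniteIntegral_iff_enorm]
  have h1 : ∀ t, ‖reflectExt T f t‖ₑ =
      (Ioo (0 : ℝ) (2 * T)).indicator (fun t => ‖f (fold T t)‖ₑ) t := fun t => by
    rw [reflectExt, enorm_indicator_eq_indicator_enorm]
  simp_rw [h1]
  rw [lintegral_indicator measurableSet_Ioo]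
  exact (setLIntegral_comp_fold T fun t => ‖f t‖ₑ).trans_lt
    (ENNReal.mul_lt_top (by norm_num) hfi.2)

/-- The interaction of a point `s` of `(0,2T)` with the complement; `fold T s` is the distance of `s`
to the complement. -/
lemma lintegral_compl_one_div_rpow_le {θ T s : ℝ} (hθ : 0 < θ) (hs : s ∈ Ioo 0 (2 * T)) :
    ∫⁻ t in (Ioo 0 (2 * T))ᶜ, ENNReal.ofReal (1 / |t - s| ^ (1 + 2 * θ)) ≤
      ENNReal.ofReal (1 / θ) * ENNReal.ofReal (fold T s ^ (-2 * θ)) := by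
  have hfold : 0 < fold T s ∧ fold T s ≤ s ∧ fold T s ≤ 2 * T - s := by
    rw [fold]
    rcases abs_cases (T - s) with h | h <;> refine ⟨?_, ?_, ?_⟩ <;> linarith [hs.1, hs.2, h.1, h.2]
  have hsub : (Ioo 0 (2 * T))ᶜ ⊆ Iic 0 ∪ Ici (2 * T) := by
    intro t ht
    rw [mem_compl_iff, mem_Ioo, not_and_or, not_lt, not_lt] at ht
    exact ht
  refine (lintegral_mono_set hsub).trans ((lintegral_union_le _ _ _).trans ?_)
  have h1 := lintegral_Iio_one_div_rpow hθ hs.1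
  have h2 := lintegral_Iio_one_div_rpow hθ (show 0 < 2 * T - s by linarith [hs.2])
  have h3 : ∫⁻ t in Ici (2 * T), ENNReal.ofReal (1 / |t - s| ^ (1 + 2 * θ)) =
      ∫⁻ t in Iic (0 : ℝ), ENNReal.ofReal (1 / |t - (2 * T - s)| ^ (1 + 2 * θ)) := by
    rw [← lintegral_indicator measurableSet_Ici, ← lintegral_indicator measurableSet_Iic,
      ← lintegral_sub_left_eq_self _ (2 * T)]
    refine lintegral_congr fun t => ?_
    by_cases ht : t ≤ 0
    · rw [indicator_of_mem (show t ∈ Iic (0 : ℝ) from ht),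
        indicator_of_mem (show 2 * T - t ∈ Ici (2 * T) from by rw [mem_Ici]; linarith),
        ← abs_neg, show -(2 * T - t - s) = t - (2 * T - s) by ring]
    · rw [indicator_of_notMem (show t ∉ Iic (0 : ℝ) from ht),
        indicator_of_notMem (show 2 * T - t ∉ Ici (2 * T) from by rw [mem_Ici]; linarith)]
  rw [h3, ← restrict_Iio_eq_restrict_Iic, h1, h2, ← ENNReal.ofReal_mul (by positivity),
    ← ENNReal.ofReal_add (div_nonneg (Real.rpow_nonneg hs.1.le _) (by linarith))
      (div_nonneg (Real.rpow_nonneg (by linarith [hs.2]) _) (by linarith))]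
  refine ENNReal.ofReal_le_ofReal ?_
  have h4 : s ^ (-2 * θ) ≤ fold T s ^ (-2 * θ) :=
    Real.rpow_le_rpow_of_nonpos hfold.1 hfold.2.1 (by linarith)
  have h5 : (2 * T - s) ^ (-2 * θ) ≤ fold T s ^ (-2 * θ) :=
    Real.rpow_le_rpow_of_nonpos hfold.1 hfold.2.2 (by linarith)
  calc _ ≤ fold T s ^ (-2 * θ) / (2 * θ) + fold T s ^ (-2 * θ) / (2 * θ) := by gcongr
    _ = _ := by field_simp; ring

/-- The extension is bounded in the Gagliardo seminorm, given the weighted bound of Hardy's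
inequality: folding does not increase distances, and the interaction of `(0,2T)` with its complement
is the weighted integral. -/
theorem gag_reflectExt_le {θ T : ℝ} (hθ : 0 < θ) {f : ℝ → ℝ} (hf : Measurable f) :
    gag θ (reflectExt T f) ≤ 4 * gagOn T θ f + ENNReal.ofReal (4 / θ) *
      ∫⁻ t in Ioo 0 T, ENNReal.ofReal (t ^ (-2 * θ)) * ‖f t‖ₑ ^ 2 := by
  set A : Set ℝ := Ioo 0 (2 * T) with hA
  have hAm : MeasurableSet A := measurableSet_Ioo
  set U := reflectExt T f with hU
  have hUm : Measurable U := measurable_reflectExt T hf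
  set F : ℝ → ℝ → ℝ≥0∞ := fun s t => ENNReal.ofReal (|U t - U s| ^ 2 / |t - s| ^ (1 + 2 * θ))
    with hF
  have hFm : Measurable (Function.uncurry F) := by
    rw [hF]; simp only [Function.uncurry_def]; fun_prop
  have hsymm : ∀ s t, F s t = F t s := fun s t => by
    simp only [hF]; rw [abs_sub_comm (U t), abs_sub_comm t]
  have hUA : ∀ t ∉ A, U t = 0 := fun t ht => indicator_of_notMem ht _
  have h1 : ∫⁻ s in A, ∫⁻ t in A, F s t ≤ 4 * gagOn T θ f := by
    have h2 : ∀ s ∈ A, ∫⁻ t in A, F s t ≤ 2 * ∫⁻ t in Ioo 0 T,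
        ENNReal.ofReal (|f t - f (fold T s)| ^ 2 / |t - fold T s| ^ (1 + 2 * θ)) := by
      intro s hs
      refine le_trans ?_ (setLIntegral_comp_fold T fun t =>
        ENNReal.ofReal (|f t - f (fold T s)| ^ 2 / |t - fold T s| ^ (1 + 2 * θ)))
      refine setLIntegral_mono' measurableSet_Ioo fun t ht => ?_
      refine ENNReal.ofReal_le_ofReal ?_
      rw [hU, reflectExt, indicator_of_mem ht, indicator_of_mem hs]
      by_cases hst : fold T t = fold T s
      · rw [hst]; simp
      · have h3 : 0 < |fold T t - fold T s| := abs_pos.2 (sub_ne_zero.2 hst)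
        have h4 : |fold T t - fold T s| ≤ |t - s| := by
          rw [fold, fold, show T - |T - t| - (T - |T - s|) = |T - s| - |T - t| by ring]
          refine (abs_abs_sub_abs_le _ _).trans_eq ?_
          congr 1
          ring
        gcongr
    refine (setLIntegral_mono' measurableSet_Ioo h2).trans ?_
    rw [lintegral_const_mul' _ _ (by norm_num), show (4 : ℝ≥0∞) = 2 * 2 by norm_num, mul_assoc]
    gcongr
    exact setLIntegral_comp_fold T fun s => ∫⁻ t in Ioo 0 T,
      ENNReal.ofReal (|f t - f s| ^ 2 / |t - s| ^ (1 + 2 * θ))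
  have h5 : ∫⁻ s in A, ∫⁻ t in Aᶜ, F s t ≤ ENNReal.ofReal (2 / θ) *
      ∫⁻ t in Ioo 0 T, ENNReal.ofReal (t ^ (-2 * θ)) * ‖f t‖ₑ ^ 2 := by
    have h2 : ∀ s ∈ A, ∫⁻ t in Aᶜ, F s t ≤ ENNReal.ofReal (1 / θ) *
        (ENNReal.ofReal (fold T s ^ (-2 * θ)) * ‖f (fold T s)‖ₑ ^ 2) := by
      intro s hs
      have h3 : ∫⁻ t in Aᶜ, F s t =
          ∫⁻ t in Aᶜ, ENNReal.ofReal (1 / |t - s| ^ (1 + 2 * θ)) * ‖f (fold T s)‖ₑ ^ 2 := by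
        refine setLIntegral_congr_fun hAm.compl fun t ht => ?_
        simp only [hF]
        rw [ofReal_sq_div_rpow, hUA t ht, zero_sub, enorm_neg, hU, reflectExt, indicator_of_mem hs]
      rw [h3, lintegral_mul_const' _ _ (by finiteness), ← mul_assoc]
      gcongr
      exact lintegral_compl_one_div_rpow_le hθ hs
    refine (setLIntegral_mono' measurableSet_Ioo h2).trans ?_
    rw [lintegral_const_mul' _ _ ENNReal.ofReal_ne_top, show 2 / θ = 1 / θ * 2 by ring,
      ENNReal.ofReal_mul (by positivity), ENNReal.ofReal_ofNat, mul_assoc]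
    gcongr
    exact setLIntegral_comp_fold T fun t => ENNReal.ofReal (t ^ (-2 * θ)) * ‖f t‖ₑ ^ 2
  have h6 : ∫⁻ s in Aᶜ, ∫⁻ t, F s t = ∫⁻ s in A, ∫⁻ t in Aᶜ, F s t := by
    have h7 : ∀ s ∈ Aᶜ, ∫⁻ t, F s t = ∫⁻ t in A, F s t := fun s hs => by
      rw [← lintegral_add_compl _ hAm]
      have : ∫⁻ t in Aᶜ, F s t = 0 := by
        rw [setLIntegral_congr_fun hAm.compl (g := fun _ => 0), lintegral_zero]
        intro t ht
        simp only [hF]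
        rw [hUA t ht, hUA s hs]
        simp
      rw [this, add_zero]
    rw [setLIntegral_congr_fun hAm.compl h7, lintegral_lintegral_swap hFm.aemeasurable]
    simp_rw [hsymm]
  have h8 : gag θ U = (∫⁻ s in A, ∫⁻ t in A, F s t) + (∫⁻ s in A, ∫⁻ t in Aᶜ, F s t) +
      ∫⁻ s in A, ∫⁻ t in Aᶜ, F s t := by
    have h9 : gag θ U = (∫⁻ s in A, ∫⁻ t, F s t) + ∫⁻ s in Aᶜ, ∫⁻ t, F s t :=
      (lintegral_add_compl _ hAm).symm
    rw [h9, h6]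
    congr 1
    rw [← lintegral_add_left]
    · refine lintegral_congr fun s => ?_
      rw [lintegral_add_compl _ hAm]
    · exact Measurable.lintegral_prod_right' hFm
  rw [h8, add_assoc]
  refine add_le_add h1 ((add_le_add h5 h5).trans_eq ?_)
  rw [← add_mul, ← ENNReal.ofReal_add (by positivity) (by positivity)]
  congr 2
  ring

/-! ### Approximate fractional derivatives -/

/-- The mean value over `(t-h,t)` converges at a rate given by the Gagliardo seminorm. -/
lemma lintegral_mean_sub_sq_le {θ : ℝ} (hθ : 0 < θ) {U : ℝ → ℝ} (hU : Measurable U)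
    (hUi : Integrable U) {h : ℝ} (hh : 0 < h) :
    ∫⁻ t, ‖h⁻¹ * (∫ s in (t - h)..t, U s) - U t‖ₑ ^ 2 ≤
      ENNReal.ofReal (h ^ (2 * θ)) * gag θ U := by
  have h1 : ∀ t, ‖h⁻¹ * (∫ s in (t - h)..t, U s) - U t‖ₑ ^ 2 ≤
      ENNReal.ofReal h⁻¹ * ∫⁻ r in Ioo (-h) 0, ‖U (t + r) - U t‖ₑ ^ 2 := by
    intro t
    have h2 : ∫ s in (t - h)..t, U s = ∫ r in Ioo (-h) 0, U (t + r) := by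
      rw [← integral_Ioc_eq_integral_Ioo, ← intervalIntegral.integral_of_le (by linarith),
        intervalIntegral.integral_comp_add_left]
      congr 1
      ring
    have h3 : h⁻¹ * (∫ s in (t - h)..t, U s) - U t =
        h⁻¹ * ∫ r in Ioo (-h) 0, 1 * (U (t + r) - U t) := by
      simp only [one_mul]
      rw [integral_sub ((hUi.comp_add_left t).integrableOn) (integrable_const _), h2,
        setIntegral_const]
      simp only [Real.volume_real_Ioo, smul_eq_mul, sub_neg_eq_add, zero_add,
        max_eq_left hh.le]
      field_simp
    rw [h3, enorm_mul, mul_pow]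
    calc _ ≤ ‖h⁻¹‖ₑ ^ 2 * ((∫⁻ r in Ioo (-h) 0, ‖(1 : ℝ)‖ₑ ^ 2) *
          ∫⁻ r in Ioo (-h) 0, ‖U (t + r) - U t‖ₑ ^ 2) := by
          gcongr
          exact enorm_integral_mul_sq_le aemeasurable_const (by fun_prop)
      _ = _ := by
          rw [setLIntegral_const, Real.volume_Ioo, ← mul_assoc, Real.enorm_eq_ofReal_abs,
            abs_of_pos (inv_pos.2 hh)]
          congr 1
          simp only [enorm_one, one_pow, one_mul, sub_neg_eq_add, zero_add]
          rw [← ENNReal.ofReal_pow (by positivity), ← ENNReal.ofReal_mul (by positivity)]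
          congr 1
          field_simp
  refine (lintegral_mono h1).trans ?_
  rw [lintegral_const_mul' _ _ ENNReal.ofReal_ne_top, lintegral_lintegral_swap (by
    refine Measurable.aemeasurable ?_
    simp only [Function.uncurry_def]
    fun_prop), gag_eq_lintegral_translate hU,
    show h ^ (2 * θ) = h⁻¹ * h ^ (1 + 2 * θ) by
      rw [Real.rpow_add hh, Real.rpow_one, inv_mul_cancel_left₀ hh.ne'],
    ENNReal.ofReal_mul (by positivity), mul_assoc]
  gcongr
  rw [← lintegral_const_mul' _ _ ENNReal.ofReal_ne_top]
  refine le_trans (setLIntegral_mono' measurableSet_Ioo fun r hr => ?_)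
    (setLIntegral_le_lintegral (Ioo (-h) 0) _)
  rw [← mul_assoc, ← ENNReal.ofReal_mul (by positivity)]
  refine le_mul_of_one_le_left zero_le ?_
  rw [← ENNReal.ofReal_one]
  refine ENNReal.ofReal_le_ofReal ?_
  have hr0 : 0 < |r| := abs_pos.2 hr.2.ne
  have hrh : |r| ≤ h := by rw [abs_of_neg hr.2]; linarith [hr.1]
  rw [mul_one_div, one_le_div (by positivity)]
  gcongr

/-- The image of a ball under a bounded operator of Hilbert spaces is closed, by weak compactness. -/
lemma exists_eq_of_tendsto_of_bounded {E F : Type*} [NormedAddCommGroup E] [InnerProductSpace ℝ E]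
    [CompleteSpace E] [NormedAddCommGroup F] [InnerProductSpace ℝ F] [CompleteSpace F]
    (A : E →L[ℝ] F) {w : ℕ → E} {C : ℝ} (hw : ∀ n, ‖w n‖ ≤ C) {u : F}
    (hu : Tendsto (fun n => A (w n)) atTop (𝓝 u)) : ∃ x, A x = u ∧ ‖x‖ ≤ C := by
  let φ : ℕ → WeakDual ℝ E := fun n => StrongDual.toWeakDual (InnerProductSpace.toDual ℝ E (w n))
  have hK := WeakDual.isCompact_closedBall (𝕜 := ℝ) (E := E) 0 C
  obtain ⟨x, hxK, hx⟩ := hK.ultrafilter_le_nhds ((hyperfilter ℕ).map φ) (by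
    rw [Ultrafilter.coe_map, le_principal_iff, mem_map]
    refine univ_mem' fun n => ?_
    simpa [φ] using hw n)
  set y : E := (InnerProductSpace.toDual ℝ E).symm (WeakDual.toStrongDual x) with hy
  have hlim : Tendsto φ (hyperfilter ℕ) (𝓝 x) := hx
  have hev : ∀ z : E, Tendsto (fun n => inner ℝ (w n) z) (hyperfilter ℕ) (𝓝 (inner ℝ y z)) := by
    intro z
    have h1 := ((WeakDual.eval_continuous z).tendsto x).comp hlim
    have h2 : x z = inner ℝ y z := by
      rw [hy, InnerProductSpace.toDual_symm_apply]; rfl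
    rw [← h2]
    exact h1
  refine ⟨y, ?_, ?_⟩
  · refine ext_inner_right ℝ fun z => ?_
    have h1 := hev (ContinuousLinearMap.adjoint A z)
    simp only [ContinuousLinearMap.adjoint_inner_right] at h1
    have h2 : Tendsto (fun n => inner ℝ (A (w n)) z) (hyperfilter ℕ) (𝓝 (inner ℝ u z)) :=
      (hu.inner tendsto_const_nhds).mono_left Nat.hyperfilter_le_atTop
    exact tendsto_nhds_unique h1 h2
  · rw [hy, LinearIsometryEquiv.norm_map]
    simpa using hxK

/-! ### Surjectivity by difference quotients -/

/-- The backward difference quotient `(U(t) - U(t-h)) / h`. It preserves functions vanishing on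
`(-∞,0]`. -/
def diffQuot (h : ℝ) (U : ℝ → ℝ) (t : ℝ) : ℝ := h⁻¹ * (U t - U (t + -h))

lemma integrable_diffQuot {U : ℝ → ℝ} (hU : Integrable U) (h : ℝ) : Integrable (diffQuot h U) :=
  (hU.sub (hU.comp_add_right (-h))).const_mul _

lemma diffQuot_of_nonpos {U : ℝ → ℝ} (hU0 : ∀ t ≤ 0, U t = 0) {h : ℝ} (hh : 0 < h) {t : ℝ}
    (ht : t ≤ 0) : diffQuot h U t = 0 := by
  rw [diffQuot, hU0 t ht, hU0 _ (by linarith), sub_zero, mul_zero]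

lemma norm_fhat_diffQuot_le {U : ℝ → ℝ} (hU : Integrable U) {h : ℝ} (hh : 0 < h) (ξ : ℝ) :
    ‖fhat (diffQuot h U) ξ‖ ≤ 2 * Real.pi * |ξ| * ‖fhat U ξ‖ := by
  have h1 : fhat (diffQuot h U) ξ = (h⁻¹ : ℝ) * (fhat U ξ - fhat (fun t => U (t + -h)) ξ) := by
    rw [← fhat_sub hU (hU.comp_add_right (-h)), ← fhat_const_mul]
    rfl
  have h2 : (2 * Real.pi * ((-h : ℝ) : ℂ) * ξ * Complex.I : ℂ) =
      Complex.I * ((-(2 * Real.pi * h * ξ) : ℝ) : ℂ) := by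
    push_cast; ring
  rw [h1, fhat_comp_add_right, h2, ← one_sub_mul, norm_mul, norm_mul, ← mul_assoc,
    Complex.norm_real, Real.norm_eq_abs, abs_of_pos (inv_pos.2 hh), norm_sub_rev]
  refine mul_le_mul_of_nonneg_right ?_ (norm_nonneg _)
  calc _ ≤ h⁻¹ * ‖-(2 * Real.pi * h * ξ)‖ := by
        gcongr
        exact Real.norm_exp_I_mul_ofReal_sub_one_le
    _ = _ := by
        rw [norm_neg, Real.norm_eq_abs, abs_mul,
          abs_of_pos (show 0 < 2 * Real.pi * h by positivity)]
        field_simp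

/-- The integrals of order `1 - γ` of difference quotients are bounded in `L²` by the Gagliardo
seminorm of order `γ`, uniformly in the step. -/
theorem lintegral_conv_diffQuot_sq_le {γ : ℝ} (h0 : 0 < γ) (h1 : γ < 1) (T : ℝ) :
    ∃ K : ℝ, 0 ≤ K ∧ ∀ U : ℝ → ℝ, Integrable U → ∀ h : ℝ, 0 < h →
      ∫⁻ t, ‖conv (diffQuot h U) (kker (1 - γ) T) t‖ₑ ^ 2 ≤ ENNReal.ofReal (K ^ 2) * gag γ U := by
  obtain ⟨C, hC, hk⟩ := rpow_mul_norm_fhat_kker_sq_le (γ := 1 - γ) (by linarith) (by linarith) T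
  have hc0 := gagConst_ne_zero γ
  have hct := gagConst_ne_top h0 h1
  have hcpos : 0 < (gagConst γ).toReal := ENNReal.toReal_pos hc0 hct
  -- `|ξ|² |ξ|^(-2(1-γ)) = |ξ|^(2γ)`: the quotient costs `|ξ|`, the kernel gains `|ξ|^(-(1-γ))`
  refine ⟨√((2 * Real.pi) ^ 2 * C / (gagConst γ).toReal), by positivity, fun U hU h hh => ?_⟩
  have hki := integrable_kker (show 0 < 1 - γ by linarith) T
  rw [Real.sq_sqrt (by positivity), gag_eq_fourier hU, ← mul_assoc, div_eq_mul_inv,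
    ENNReal.ofReal_mul (by positivity), ENNReal.ofReal_inv_of_pos hcpos, ENNReal.ofReal_toReal hct,
    mul_assoc (ENNReal.ofReal _), ENNReal.inv_mul_cancel hc0 hct, mul_one,
    ← lintegral_const_mul' _ _ ENNReal.ofReal_ne_top,
    ← lintegral_enorm_fhat_sq (integrable_conv (integrable_diffQuot hU h) hki)]
  refine lintegral_mono_ae ?_
  filter_upwards [Measure.ae_ne volume (0 : ℝ)] with ξ hξ
  have hpos : 0 < |ξ| := abs_pos.2 hξ
  rw [fhat_conv (integrable_diffQuot hU h) hki, enorm_mul, mul_pow]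
  calc _ ≤ ENNReal.ofReal ((2 * Real.pi * |ξ|) ^ 2) * ‖fhat U ξ‖ₑ ^ 2 *
        (ENNReal.ofReal C * ENNReal.ofReal (|ξ| ^ (-2 * (1 - γ)))) := by
        gcongr
        · rw [← ofReal_norm, ← ofReal_norm, ← ENNReal.ofReal_pow (norm_nonneg _),
            ← ENNReal.ofReal_pow (norm_nonneg _), ← ENNReal.ofReal_mul (by positivity), ← mul_pow]
          gcongr
          exact norm_fhat_diffQuot_le hU hh ξ
        · exact hk ξ hξ
    _ = ENNReal.ofReal ((2 * Real.pi * |ξ|) ^ 2) * (ENNReal.ofReal C *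
        ENNReal.ofReal (|ξ| ^ (-2 * (1 - γ)))) * ‖fhat U ξ‖ₑ ^ 2 := by ring
    _ = _ := by
        rw [← mul_assoc (ENNReal.ofReal ((2 * Real.pi) ^ 2 * C)), ← ENNReal.ofReal_mul hC,
          ← ENNReal.ofReal_mul (by positivity), ← ENNReal.ofReal_mul (by positivity)]
        congr 2
        rw [mul_pow, show 2 * γ = 2 + -2 * (1 - γ) by ring, Real.rpow_add hpos, Real.rpow_two]
        ring

/-- Integrating the difference quotient gives a mean value. -/
lemma conv_diffQuot_kker_one {U : ℝ → ℝ} (hU : Integrable U) (hU0 : ∀ t ≤ 0, U t = 0) {h : ℝ}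
    (hh : 0 < h) {T t : ℝ} (ht : t ∈ Ioo 0 T) :
    conv (diffQuot h U) (kker 1 T) t = h⁻¹ * ∫ s in (t - h)..t, U s := by
  have hi : ∀ (a b : ℝ), IntervalIntegrable U volume a b := fun a b => hU.intervalIntegrable
  have h1 : conv (diffQuot h U) (kker 1 T) t = ∫ s in (0 : ℝ)..t, diffQuot h U s := by
    rw [conv_apply, intervalIntegral.integral_of_le ht.1.le, integral_Ioc_eq_integral_Ioo,
      ← integral_indicator measurableSet_Ioo]
    congr 1
    ext s
    by_cases hs : s ∈ Ioo 0 t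
    · rw [indicator_of_mem hs, kker, indicator_of_mem
        (show t - s ∈ Ioo 0 T from ⟨by linarith [hs.2], by linarith [hs.1, ht.2]⟩)]
      simp
    · rw [indicator_of_notMem hs]
      rcases le_or_gt s 0 with h2 | h2
      · rw [diffQuot_of_nonpos hU0 hh h2, zero_mul]
      · rw [kker_of_nonpos _ _ (by linarith [not_lt.1 fun h => hs ⟨h2, h⟩] : t - s ≤ 0), mul_zero]
  have h2 : ∫ s in (0 : ℝ)..t, U (s + -h) = ∫ s in (0 : ℝ)..(t - h), U s := by
    rw [intervalIntegral.integral_comp_add_right, zero_add, ← sub_eq_add_neg,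
      ← intervalIntegral.integral_add_adjacent_intervals (hi (-h) 0) (hi 0 (t - h)),
      intervalIntegral.integral_zero_ae, zero_add]
    refine ae_of_all _ fun s hs => hU0 s ?_
    rw [uIoc_of_le (by linarith)] at hs
    exact hs.2
  rw [h1]
  simp only [diffQuot]
  rw [intervalIntegral.integral_const_mul, intervalIntegral.integral_sub (hi _ _)
    (hU.comp_add_right (-h)).intervalIntegrable, h2,
    intervalIntegral.integral_interval_sub_left (hi _ _) (hi _ _)]

/-- A function with an extension to the line that vanishes on `(-∞,0]` and has finite Gagliardo
seminorm is in the range of `J^γ`: a preimage is a weak limit of the integrals of order `1 - γ` of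
the difference quotients of the extension. -/
theorem exists_J_eq_of_gag {γ : ℝ} (h0 : 0 < γ) (h1 : γ < 1) (T : ℝ) :
    ∃ K : ℝ, 0 ≤ K ∧ ∀ (u : L2 T) (U : ℝ → ℝ), Measurable U → Integrable U →
      (∀ t ≤ 0, U t = 0) → u =ᵐ[volume.restrict (Ioo (0 : ℝ) T)] U →
      ∀ M : ℝ, 0 ≤ M → gag γ U ≤ ENNReal.ofReal (M ^ 2) → ∃ w : L2 T, J T γ w = u ∧ ‖w‖ ≤ K * M := by
  obtain ⟨K, hK, hbound⟩ := lintegral_conv_diffQuot_sq_le h0 h1 T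
  refine ⟨K, hK, fun u U hUm hUi hU0 huU M hM hgag => ?_⟩
  have h1γ : 0 < 1 - γ := by linarith
  have hki := integrable_kker h1γ T
  set h : ℕ → ℝ := fun n => 1 / ((n : ℝ) + 1) with hh
  have hpos : ∀ n, 0 < h n := fun n => by positivity
  set W : ℕ → ℝ → ℝ := fun n => conv (diffQuot (h n) U) (kker (1 - γ) T) with hW
  have hWi : ∀ n, Integrable (W n) := fun n => integrable_conv (integrable_diffQuot hUi _) hki
  have hWb : ∀ n, ∫⁻ t, ‖W n t‖ₑ ^ 2 ≤ ENNReal.ofReal K ^ 2 * ENNReal.ofReal M ^ 2 := fun n => by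
    refine (hbound U hUi (h n) (hpos n)).trans ?_
    rw [← ENNReal.ofReal_pow hK, ← ENNReal.ofReal_pow hM]
    gcongr
  have hWL : ∀ n, MemLp (W n) 2 (volume.restrict (Ioo 0 T)) := fun n =>
    ((memLp_two_iff_lintegral (hWi n).1).2 ((hWb n).trans_lt (by finiteness))).restrict _
  set w : ℕ → L2 T := fun n => (hWL n).toLp (W n) with hw
  have hwW : ∀ n, w n =ᵐ[volume.restrict (Ioo (0 : ℝ) T)] W n := fun n => (hWL n).coeFn_toLp
  have hwn : ∀ n, ‖w n‖ ≤ K * M := fun n =>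
    enorm_le_ofReal_mul_of_sq_le hK hM ((enorm_sq_le_of_ae (hwW n)).trans (hWb n))
  have hW0 : ∀ n, ∀ t ≤ 0, W n t = 0 := fun n t ht =>
    conv_of_nonpos (fun t ht => diffQuot_of_nonpos hU0 (hpos n) ht)
      (fun _ => kker_of_nonpos _ _) ht
  -- `J^γ J^(1-γ)` applied to the difference quotient is a mean value of `U`
  have hJ : ∀ n, J T γ (w n) =ᵐ[volume.restrict (Ioo (0 : ℝ) T)]
      fun t => (h n)⁻¹ * ∫ s in (t - h n)..t, U s := fun n => by
    have hext : ∀ᵐ s, s < T → ext (w n) s = W n s := by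
      filter_upwards [ext_congr (hwW n)] with s hs hsT
      rw [hs]
      by_cases hs0 : 0 < s
      · rw [indicator_of_mem (show s ∈ Ioo 0 T from ⟨hs0, hsT⟩)]
      · rw [indicator_of_notMem (show s ∉ Ioo 0 T from fun h => hs0 h.1), hW0 n s (not_lt.1 hs0)]
    have hassoc := ae_conv_assoc (integrable_diffQuot hUi (h n)) hki (integrable_kker h0 T)
    filter_upwards [J_ae h0 (w n), ae_restrict_of_ae hassoc, ae_restrict_mem measurableSet_Ioo]
      with t h2 h3 ht
    rw [h2, conv_congr_left_of_lt (fun _ => kker_of_nonpos γ T) hext ht.2.le, h3,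
      ← conv_diffQuot_kker_one hUi hU0 (hpos n) ht]
    refine conv_congr_right_of_lt (fun t ht => diffQuot_of_nonpos hU0 (hpos n) ht)
      (fun s hs => ?_) ht.2.le
    rw [conv_kker h1γ h0 hs, sub_add_cancel]
  have hlim : Tendsto (fun n => JL T h0 (w n)) atTop (𝓝 u) := by
    rw [tendsto_iff_norm_sub_tendsto_zero]
    have hle : ∀ n, ‖JL T h0 (w n) - u‖ ≤ h n ^ γ * M := fun n => by
      refine enorm_le_ofReal_mul_of_sq_le (Real.rpow_nonneg (hpos n).le _) hM ?_
      have h2 : (JL T h0 (w n) - u : L2 T) =ᵐ[volume.restrict (Ioo (0 : ℝ) T)]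
          fun t => (h n)⁻¹ * (∫ s in (t - h n)..t, U s) - U t := by
        filter_upwards [Lp.coeFn_sub (JL T h0 (w n)) u, hJ n, huU] with t h3 h4 h5
        rw [h3, Pi.sub_apply, JL_apply, h4, h5]
      refine (enorm_sq_le_of_ae h2).trans ((lintegral_mean_sub_sq_le h0 hUm hUi (hpos n)).trans ?_)
      rw [← ENNReal.ofReal_pow (Real.rpow_nonneg (hpos n).le _), ← ENNReal.ofReal_pow hM]
      gcongr
      rw [← Real.rpow_natCast (h n ^ γ), ← Real.rpow_mul (hpos n).le, mul_comm]
      norm_num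
    refine squeeze_zero (fun _ => norm_nonneg _) hle ?_
    have h2 : Tendsto h atTop (𝓝 0) := tendsto_one_div_add_atTop_nhds_zero_nat
    have h3 := h2.rpow_const (p := γ) (Or.inr h0.le)
    rw [Real.zero_rpow h0.ne'] at h3
    simpa using h3.mul_const M
  exact exists_eq_of_tendsto_of_bounded (JL T h0) hwn hlim

/-! ### Orders between zero and one -/

lemma slobodeckij_eq {T θ : ℝ} (h0 : 0 < θ) (h1 : θ < 1) :
    slobodeckij T θ = {u | gagliardo T θ u < ⊤} := by
  rw [slobodeckij, if_neg h0.ne', if_neg h1.ne]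

lemma slobodeckijNorm_sq {T θ : ℝ} (h0 : 0 < θ) (h1 : θ < 1) (u : L2 T) :
    slobodeckijNorm T θ u ^ 2 = ‖u‖ ^ 2 + (gagliardo T θ u).toReal := by
  rw [slobodeckijNorm, if_neg h0.ne', if_neg h1.ne, Real.sq_sqrt (by positivity)]

lemma slobodeckijNorm_nonneg (T θ : ℝ) (u : L2 T) : 0 ≤ slobodeckijNorm T θ u := by
  rw [slobodeckijNorm, sobolevNorm]
  split_ifs <;> positivity

lemma lowHNorm_nonneg (T θ : ℝ) (u : L2 T) : 0 ≤ lowHNorm T θ u := by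
  rw [lowHNorm]
  split_ifs
  · positivity
  · exact slobodeckijNorm_nonneg T θ u

lemma slobodeckijNorm_sq_le_lowHNorm_sq (T θ : ℝ) (u : L2 T) :
    slobodeckijNorm T θ u ^ 2 ≤ lowHNorm T θ u ^ 2 := by
  rw [lowHNorm]
  split_ifs with h
  · rw [Real.sq_sqrt (by positivity), h]
    exact le_add_of_nonneg_right ENNReal.toReal_nonneg
  · exact le_rfl

lemma lowH_subset_slobodeckij (T θ : ℝ) : lowH T θ ⊆ slobodeckij T θ := by
  rw [lowH]
  split_ifs with h1 h2
  · exact Subset.rfl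
  · rw [h2]; exact fun u hu => hu.1
  · exact fun u hu => hu.1

lemma gagliardo_le_lowHNorm {T θ : ℝ} (h0 : 0 < θ) (h1 : θ < 1) {u : L2 T} (hu : u ∈ lowH T θ) :
    gagliardo T θ u ≤ ENNReal.ofReal (lowHNorm T θ u ^ 2) := by
  have h := lowH_subset_slobodeckij T θ hu
  rw [slobodeckij_eq h0 h1] at h
  rw [← ENNReal.ofReal_toReal (ne_of_lt h)]
  refine ENNReal.ofReal_le_ofReal (le_trans ?_ (slobodeckijNorm_sq_le_lowHNorm_sq T θ u))
  rw [slobodeckijNorm_sq h0 h1]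
  exact le_add_of_nonneg_left (sq_nonneg _)

lemma norm_le_lowHNorm {T θ : ℝ} (h0 : 0 < θ) (h1 : θ < 1) (u : L2 T) :
    ‖u‖ ≤ lowHNorm T θ u := by
  refine (pow_le_pow_iff_left₀ (norm_nonneg u) (lowHNorm_nonneg T θ u) two_ne_zero).1 ?_
  refine le_trans ?_ (slobodeckijNorm_sq_le_lowHNorm_sq T θ u)
  rw [slobodeckijNorm_sq h0 h1]
  exact le_add_of_nonneg_right ENNReal.toReal_nonneg

lemma gagliardo_eq_gagOn {T θ : ℝ} {u : L2 T} {f : ℝ → ℝ}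
    (h : u =ᵐ[volume.restrict (Ioo (0 : ℝ) T)] f) : gagliardo T θ u = gagOn T θ f :=
  gagOn_congr h

lemma setLIntegral_enorm_sq_eq {T : ℝ} {u : L2 T} {f : ℝ → ℝ}
    (h : u =ᵐ[volume.restrict (Ioo (0 : ℝ) T)] f) :
    ∫⁻ t in Ioo 0 T, ‖f t‖ₑ ^ 2 = ENNReal.ofReal (‖u‖ ^ 2) := by
  rw [← eLpNorm_two_pow_two, ← eLpNorm_congr_ae h, ← Lp.enorm_def, ← ofReal_norm,
    ENNReal.ofReal_pow (norm_nonneg _)]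

/-- The weighted bound that makes the extension by zero to negative times bounded: Hardy's
inequality off the critical order, and a part of the norm at the critical order. -/
lemma exists_weighted_bound {T θ : ℝ} (hT : 0 < T) (h0 : 0 < θ) (h1 : θ < 1) :
    ∃ C : ℝ, 0 ≤ C ∧ ∀ u ∈ lowH T θ, ∃ f : ℝ → ℝ, Measurable f ∧
      u =ᵐ[volume.restrict (Ioo (0 : ℝ) T)] f ∧
      ∫⁻ t in Ioo 0 T, ENNReal.ofReal (t ^ (-2 * θ)) * ‖f t‖ₑ ^ 2 ≤
        ENNReal.ofReal (C * lowHNorm T θ u ^ 2) := by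
  rcases lt_trichotomy θ (1 / 2) with hθ | hθ | hθ
  · obtain ⟨C, hC, h⟩ := hardy_lt_half h0 hθ hT
    refine ⟨C * 2, by positivity, fun u hu =>
      ⟨u, (Lp.stronglyMeasurable u).measurable, ae_eq_rfl, ?_⟩⟩
    have h2 := setLIntegral_enorm_sq_eq (u := u) ae_eq_rfl
    refine (h u (Lp.stronglyMeasurable u).measurable (by rw [h2]; finiteness)).trans ?_
    rw [h2, mul_assoc, ENNReal.ofReal_mul hC, two_mul, ENNReal.ofReal_add (by positivity)
      (by positivity)]
    gcongr
    · exact norm_le_lowHNorm h0 h1 u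
    · exact gagliardo_le_lowHNorm h0 h1 hu
  · subst hθ
    refine ⟨1, zero_le_one, fun u hu =>
      ⟨u, (Lp.stronglyMeasurable u).measurable, ae_eq_rfl, ?_⟩⟩
    rw [lowH, if_neg (lt_irrefl _), if_pos rfl] at hu
    have h2 : ∫⁻ t in Ioo 0 T, ENNReal.ofReal (t ^ (-2 * (1 / 2) : ℝ)) * ‖u t‖ₑ ^ 2 =
        weightInt T u := by
      refine setLIntegral_congr_fun measurableSet_Ioo fun t ht => ?_
      have ht0 : 0 ≤ t⁻¹ := (inv_pos.2 ht.1).le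
      rw [ENNReal.ofReal_mul ht0, ENNReal.ofReal_pow (abs_nonneg _),
        Real.enorm_eq_ofReal_abs, show (-2 * (1 / 2) : ℝ) = -1 by norm_num, Real.rpow_neg_one]
    rw [h2, one_mul, ← ENNReal.ofReal_toReal (ne_of_lt hu.2)]
    refine ENNReal.ofReal_le_ofReal ?_
    rw [lowHNorm, if_pos rfl, Real.sq_sqrt (by positivity)]
    exact le_add_of_nonneg_left (sq_nonneg _)
  · obtain ⟨C, hC, h⟩ := hardy_gt_half hθ hT
    refine ⟨C, hC, fun u hu => ?_⟩
    have hu' := hu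
    rw [lowH, if_neg hθ.le.not_gt, if_neg hθ.ne'] at hu'
    obtain ⟨-, g, hg, hug, hg0⟩ := hu'
    set f : ℝ → ℝ := IccExtend hT.le ((Icc 0 T).domRestrict g) with hf
    have hfc : Continuous f := (continuousOn_iff_continuous_domRestrict.1 hg).Icc_extend'
    have hfg : ∀ t ∈ Icc 0 T, f t = g t := fun t ht => by
      rw [hf, IccExtend_of_mem _ _ ht]; rfl
    have huf : u =ᵐ[volume.restrict (Ioo (0 : ℝ) T)] f := by
      filter_upwards [hug, ae_restrict_mem measurableSet_Ioo] with t h2 h3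
      rw [h2, hfg t (Ioo_subset_Icc_self h3)]
    refine ⟨f, hfc.measurable, huf, (h f hfc.measurable ?_).trans ?_⟩
    · have h2 := hfc.tendsto 0
      rw [hfg 0 (left_mem_Icc.2 hT.le), hg0] at h2
      exact h2.mono_left nhdsWithin_le_nhds
    · rw [ENNReal.ofReal_mul hC, ← gagliardo_eq_gagOn huf]
      gcongr
      exact gagliardo_le_lowHNorm h0 h1 hu

/-- The assertion that `J^γ` is an isomorphism of `L²(0,T)` onto `H_γ(0,T)`, up to injectivity, which
is known separately (`J_injective`): it maps into `H_γ(0,T)`, is bounded, and every element of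
`H_γ(0,T)` has a preimage of controlled norm. -/
structure IsIsoOnto (T γ : ℝ) : Prop where
  mem : ∀ v : L2 T, J T γ v ∈ H T γ
  bound : ∃ C : ℝ, 0 < C ∧ ∀ v : L2 T, HNorm T γ (J T γ v) ≤ C * ‖v‖
  surj : ∃ C : ℝ, 0 < C ∧ ∀ u ∈ H T γ, ∃ w : L2 T, J T γ w = u ∧ ‖w‖ ≤ C * HNorm T γ u

lemma H_zero (T : ℝ) : H T 0 = univ := by
  rw [H, if_pos zero_le_one, lowH, if_pos (by norm_num), slobodeckij, if_pos rfl]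

lemma lowHNorm_zero {T : ℝ} (u : L2 T) : lowHNorm T 0 u = ‖u‖ := by
  rw [lowHNorm, if_neg (by norm_num), slobodeckijNorm, if_pos rfl]

lemma HNorm_zero {T : ℝ} (u : L2 T) : HNorm T 0 u = ‖u‖ := by
  rw [HNorm, if_pos zero_le_one, lowHNorm_zero]

lemma isIsoOnto_zero (T : ℝ) : IsIsoOnto T 0 where
  mem v := by rw [H_zero]; exact mem_univ _
  bound := ⟨1, one_pos, fun v => by rw [HNorm_zero, J_zero_order, one_mul]⟩
  surj := ⟨1, one_pos, fun u _ => ⟨u, J_zero_order u, by rw [HNorm_zero, one_mul]⟩⟩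

lemma exists_norm_J_le {T γ : ℝ} (hγ : 0 ≤ γ) :
    ∃ C : ℝ, 0 ≤ C ∧ ∀ v : L2 T, ‖J T γ v‖ ≤ C * ‖v‖ := by
  rcases hγ.eq_or_lt with rfl | hγ
  · exact ⟨1, zero_le_one, fun v => by rw [J_zero_order, one_mul]⟩
  · exact ⟨_, integral_nonneg fun _ => abs_nonneg _, norm_J_le hγ⟩

theorem isIsoOnto_of_lt_one {T γ : ℝ} (hT : 0 < T) (h0 : 0 < γ) (h1 : γ < 1) : IsIsoOnto T γ := by
  obtain ⟨B, hB, hJ⟩ := exists_norm_J_le (T := T) h0.le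
  obtain ⟨C, hC, hgag⟩ := gag_conv_kker_le h0 h1 T
  have hgag' : ∀ v : L2 T, gag γ (conv (ext v) (kker γ T)) ≤ ENNReal.ofReal (C * ‖v‖ ^ 2) :=
    fun v => (hgag v).trans_eq (by
      rw [ENNReal.ofReal_mul hC, ENNReal.ofReal_pow (norm_nonneg _), ofReal_norm])
  have hG : ∀ v : L2 T, gagliardo T γ (J T γ v) ≤ ENNReal.ofReal (C * ‖v‖ ^ 2) := fun v =>
    (gagliardo_le_gag (J_ae h0 v)).trans (hgag' v)
  have hGr : ∀ v : L2 T, (gagliardo T γ (J T γ v)).toReal ≤ C * ‖v‖ ^ 2 := fun v =>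
    ENNReal.toReal_le_of_le_ofReal (by positivity) (hG v)
  have hW : γ = 1 / 2 → ∀ v : L2 T, weightInt T (J T γ v) ≤ ENNReal.ofReal (C * ‖v‖ ^ 2) :=
    fun h v => (weightInt_le_gag (J_ae h0 v) fun t ht => conv_of_nonpos
      (fun _ => ext_of_nonpos v) (fun _ => kker_of_nonpos γ T) ht).trans (h ▸ hgag' v)
  have hmem : ∀ v : L2 T, J T γ v ∈ slobodeckij T γ := fun v => by
    rw [slobodeckij_eq h0 h1]
    exact (hG v).trans_lt ENNReal.ofReal_lt_top
  refine ⟨fun v => ?_, ⟨√(B ^ 2 + C + C) + 1, by positivity, fun v => ?_⟩, ?_⟩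
  · rw [H, if_pos h1.le, lowH]
    split_ifs with h2 h3
    · exact hmem v
    · exact ⟨h3 ▸ hmem v, (hW h3 v).trans_lt ENNReal.ofReal_lt_top⟩
    · exact ⟨hmem v, vanishesAtZero_J (lt_of_le_of_ne (not_lt.1 h2) (Ne.symm h3)) v⟩
  · have h2 : slobodeckijNorm T γ (J T γ v) ^ 2 ≤ (B ^ 2 + C) * ‖v‖ ^ 2 := by
      rw [slobodeckijNorm_sq h0 h1, add_mul, ← mul_pow]
      exact add_le_add (pow_le_pow_left₀ (norm_nonneg _) (hJ v) 2) (hGr v)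
    have h3 : lowHNorm T γ (J T γ v) ^ 2 ≤ (B ^ 2 + C + C) * ‖v‖ ^ 2 := by
      rw [lowHNorm]
      split_ifs with h3
      · rw [Real.sq_sqrt (by positivity), add_mul _ C]
        exact add_le_add (h3 ▸ h2) (ENNReal.toReal_le_of_le_ofReal (by positivity) (hW h3 v))
      · refine h2.trans ?_
        gcongr
        linarith
    rw [HNorm, if_pos h1.le]
    have h4 := Real.le_sqrt_of_sq_le h3
    rw [Real.sqrt_mul (by positivity), Real.sqrt_sq (norm_nonneg _)] at h4
    refine h4.trans ?_
    gcongr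
    linarith
  · obtain ⟨D, hD, hw⟩ := exists_weighted_bound hT h0 h1
    obtain ⟨K, hK, hext⟩ := exists_J_eq_of_gag h0 h1 T
    refine ⟨K * √(4 + 4 / γ * D) + 1, by positivity, fun u hu => ?_⟩
    rw [H, if_pos h1.le] at hu
    rw [HNorm, if_pos h1.le]
    obtain ⟨f, hfm, huf, hfw⟩ := hw u hu
    have hfi : IntegrableOn f (Ioo 0 T) :=
      ((Lp.memLp u).integrable (by norm_num)).congr huf
    have hN := lowHNorm_nonneg T γ u
    have huU : u =ᵐ[volume.restrict (Ioo (0 : ℝ) T)] reflectExt T f := by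
      filter_upwards [huf, ae_restrict_mem measurableSet_Ioo] with t h2 h3
      rw [h2, reflectExt_of_mem f h3]
    obtain ⟨w, hJw, hwn⟩ := hext u (reflectExt T f) (measurable_reflectExt T hfm)
      (integrable_reflectExt hfm hfi) (fun t ht => reflectExt_of_nonpos T f ht) huU
      (√(4 + 4 / γ * D) * lowHNorm T γ u) (by positivity) (by
        refine (gag_reflectExt_le h0 hfm).trans ?_
        rw [mul_pow, Real.sq_sqrt (by positivity), add_mul, ENNReal.ofReal_add (by positivity)
          (by positivity), mul_assoc (4 / γ), ENNReal.ofReal_mul (p := 4) (by positivity),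
          ENNReal.ofReal_mul (p := 4 / γ) (by positivity), ENNReal.ofReal_ofNat,
          ← gagliardo_eq_gagOn huf]
        gcongr
        exact gagliardo_le_lowHNorm h0 h1 hu)
    refine ⟨w, hJw, hwn.trans ?_⟩
    rw [← mul_assoc]
    gcongr
    linarith

/-! ### Orders at least one -/

lemma norm_weakDeriv_le_sobolevNorm {T : ℝ} {k l : ℕ} (hk : k ≤ l) (u : L2 T) :
    ‖weakDeriv T k u‖ ≤ sobolevNorm T l u := by
  refine Real.le_sqrt_of_sq_le ?_
  exact Finset.single_le_sum (f := fun k => ‖weakDeriv T k u‖ ^ 2) (fun _ _ => sq_nonneg _)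
    (Finset.mem_range.2 (Nat.lt_succ_of_le hk))

lemma weakDeriv_J {T γ : ℝ} (hT : 0 < T) {k : ℕ} (hk : (k : ℝ) ≤ γ) (v : L2 T) :
    weakDeriv T k (J T γ v) = J T (γ - k) v :=
  (hasWeakDeriv_J hT hk v).weakDeriv_eq

lemma J_mem_sobolev {T γ : ℝ} (hT : 0 < T) {l : ℕ} (hl : (l : ℝ) ≤ γ) (v : L2 T) :
    J T γ v ∈ sobolev T l := fun _ hk =>
  ⟨_, hasWeakDeriv_J hT ((Nat.cast_le.2 hk).trans hl) v⟩

lemma exists_sobolevNorm_J_le {T γ : ℝ} (hT : 0 < T) {l : ℕ} (hl : (l : ℝ) ≤ γ) :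
    ∃ C : ℝ, 0 ≤ C ∧ ∀ v : L2 T, sobolevNorm T l (J T γ v) ≤ C * ‖v‖ := by
  have h : ∀ k : ℕ, ∃ C : ℝ, 0 ≤ C ∧ (k ≤ l → ∀ v : L2 T, ‖J T (γ - k) v‖ ≤ C * ‖v‖) := by
    intro k
    by_cases hk : k ≤ l
    · have h1 : (k : ℝ) ≤ l := Nat.cast_le.2 hk
      obtain ⟨C, hC, h2⟩ := exists_norm_J_le (T := T) (show 0 ≤ γ - k by linarith)
      exact ⟨C, hC, fun _ => h2⟩
    · exact ⟨0, le_rfl, fun h => absurd h hk⟩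
  choose C hC hCl using h
  refine ⟨√(∑ k ∈ Finset.range (l + 1), C k ^ 2), by positivity, fun v => ?_⟩
  rw [sobolevNorm, ← Real.sqrt_sq (norm_nonneg v), ← Real.sqrt_mul (by positivity),
    Finset.sum_mul]
  refine Real.sqrt_le_sqrt (Finset.sum_le_sum fun k hk => ?_)
  have hkl : k ≤ l := Nat.le_of_lt_succ (Finset.mem_range.1 hk)
  rw [weakDeriv_J hT ((Nat.cast_le.2 hkl).trans hl), ← mul_pow]
  exact pow_le_pow_left₀ (norm_nonneg _) (hCl k hkl v) 2

lemma J_mem_natH {T γ : ℝ} (hT : 0 < T) {l : ℕ} (hl : (l : ℝ) ≤ γ) (v : L2 T) :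
    J T γ v ∈ natH T l := by
  refine ⟨J_mem_sobolev hT hl v, fun k hk => ?_⟩
  have h1 : ((k : ℝ) + 1) ≤ l := by exact_mod_cast hk
  rw [weakDeriv_J hT (by linarith)]
  exact vanishesAtZero_J_of_one_le (by linarith) v

/-- Functions whose derivatives of order below `l` vanish at `0` are `l`-fold primitives. -/
lemma eq_J_weakDeriv {T : ℝ} (hT : 0 < T) {l : ℕ} {u : L2 T} (hu : u ∈ natH T l) :
    ∀ k ≤ l, u = J T k (weakDeriv T k u) := by
  intro k hk
  induction k with
  | zero => rw [(hasWeakDeriv_zero u).weakDeriv_eq, Nat.cast_zero, J_zero_order]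
  | succ k ih =>
    obtain ⟨a, ha⟩ := hu.1 k (by lia)
    obtain ⟨b, hb⟩ := hu.1 (k + 1) hk
    have h1 := (ha.deriv_of_succ hb).eq_J_one hT
      (by have := hu.2 k (by lia); rwa [ha.weakDeriv_eq] at this)
    have h2 := ih (by lia)
    rw [ha.weakDeriv_eq, h1, J_J_of_nonneg k.cast_nonneg zero_le_one] at h2
    rw [hb.weakDeriv_eq]
    push_cast
    exact h2

lemma H_one (T : ℝ) : H T 1 = natH T 1 := by
  rw [H, if_pos le_rfl, lowH, if_neg (by norm_num), if_neg (by norm_num), slobodeckij,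
    if_neg one_ne_zero, if_pos rfl]
  ext u
  simp only [natH, mem_ofPred_eq, Nat.lt_one_iff, forall_eq, (hasWeakDeriv_zero u).weakDeriv_eq]

lemma HNorm_one {T : ℝ} (u : L2 T) : HNorm T 1 u = sobolevNorm T 1 u := by
  rw [HNorm, if_pos le_rfl, lowHNorm, if_neg (by norm_num), slobodeckijNorm, if_neg one_ne_zero,
    if_pos rfl]

lemma isIsoOnto_one {T : ℝ} (hT : 0 < T) : IsIsoOnto T 1 where
  mem v := by
    rw [H_one]
    exact J_mem_natH hT (by simp) v
  bound := by
    obtain ⟨C, hC, h⟩ := exists_sobolevNorm_J_le (γ := 1) (l := 1) hT (by simp)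
    refine ⟨C + 1, by positivity, fun v => ?_⟩
    rw [HNorm_one]
    exact (h v).trans (by gcongr; linarith)
  surj := by
    refine ⟨1, one_pos, fun u hu => ⟨weakDeriv T 1 u, ?_, ?_⟩⟩
    · rw [H_one] at hu
      simpa using (eq_J_weakDeriv hT hu 1 le_rfl).symm
    · rw [HNorm_one, one_mul]
      exact norm_weakDeriv_le_sobolevNorm le_rfl u

theorem isIsoOnto_of_one_lt {T γ : ℝ} (hT : 0 < T) (hγ : 1 < γ) : IsIsoOnto T γ := by
  have hlγ : ((⌊γ⌋₊ : ℕ) : ℝ) ≤ γ := Nat.floor_le (by linarith)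
  have hfr : γ - (⌊γ⌋₊ : ℕ) = Int.fract γ := by
    rw [Int.fract, natCast_floor_eq_intCast_floor (by linarith)]
  have hθ0 := Int.fract_nonneg γ
  have hθ1 := Int.fract_lt_one γ
  have hθ : IsIsoOnto T (Int.fract γ) := by
    rcases hθ0.eq_or_lt with h | h
    · rw [← h]; exact isIsoOnto_zero T
    · exact isIsoOnto_of_lt_one hT h hθ1
  have hH : H T (Int.fract γ) = lowH T (Int.fract γ) := by rw [H, if_pos hθ1.le]
  have hHN : ∀ u : L2 T, HNorm T (Int.fract γ) u = lowHNorm T (Int.fract γ) u := fun u => by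
    rw [HNorm, if_pos hθ1.le]
  refine ⟨fun v => ?_, ?_, ?_⟩
  · rw [H, if_neg hγ.not_ge]
    refine ⟨J_mem_natH hT hlγ v, ?_⟩
    rw [weakDeriv_J hT hlγ, hfr, ← hH]
    exact hθ.mem v
  · obtain ⟨A, hA, h1⟩ := exists_sobolevNorm_J_le hT hlγ
    obtain ⟨B, hB, h2⟩ := hθ.bound
    refine ⟨√(A ^ 2 + B ^ 2), by positivity, fun v => ?_⟩
    rw [HNorm, if_neg hγ.not_ge, weakDeriv_J hT hlγ, hfr, ← hHN]
    refine Real.sqrt_le_iff.2 ⟨by positivity, ?_⟩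
    rw [mul_pow, Real.sq_sqrt (by positivity), add_mul, ← mul_pow, ← mul_pow]
    refine add_le_add (pow_le_pow_left₀ (Real.sqrt_nonneg _) (h1 v) 2)
      (pow_le_pow_left₀ ?_ (h2 v) 2)
    rw [hHN]
    exact lowHNorm_nonneg _ _ _
  · obtain ⟨C, hC, h1⟩ := hθ.surj
    refine ⟨C, hC, fun u hu => ?_⟩
    rw [H, if_neg hγ.not_ge] at hu
    obtain ⟨w, hw, hwn⟩ := h1 _ (hH ▸ hu.2)
    refine ⟨w, ?_, hwn.trans ?_⟩
    · rw [eq_J_weakDeriv hT hu.1 _ le_rfl, ← hw, J_J_of_nonneg (Nat.cast_nonneg _) hθ0, ← hfr,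
        add_sub_cancel]
    · rw [hHN, HNorm, if_neg hγ.not_ge]
      gcongr
      exact Real.le_sqrt_of_sq_le (le_add_of_nonneg_left (sq_nonneg _))

theorem isIsoOnto {T γ : ℝ} (hT : 0 < T) (hγ : 0 ≤ γ) : IsIsoOnto T γ := by
  rcases hγ.eq_or_lt with rfl | h0
  · exact isIsoOnto_zero T
  rcases lt_trichotomy γ 1 with h | rfl | h
  · exact isIsoOnto_of_lt_one hT h0 h
  · exact isIsoOnto_one hT
  · exact isIsoOnto_of_one_lt hT h

/-! ### Isomorphisms along the scale -/

lemma dt_J {T γ : ℝ} (hT : 0 < T) (hγ : 0 ≤ γ) (v : L2 T) : dt T γ (J T γ v) = v :=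
  Function.leftInverse_invFun (J_injective hT hγ) v

theorem bijOn_J {T α β : ℝ} (hT : 0 < T) (hα : 0 < α) (hβ : 0 ≤ β) :
    BijOn (J T α) (H T β) (H T (α + β)) := by
  obtain ⟨_, _, hs⟩ := (isIsoOnto hT hβ).surj
  obtain ⟨_, _, hs'⟩ := (isIsoOnto hT (add_nonneg hα.le hβ)).surj
  refine ⟨fun u hu => ?_, (J_injective hT hα.le).injOn, fun u hu => ?_⟩
  · obtain ⟨w, rfl, _⟩ := hs u hu
    rw [J_J_of_nonneg hα.le hβ]
    exact (isIsoOnto hT (add_nonneg hα.le hβ)).mem w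
  · obtain ⟨w, rfl, _⟩ := hs' u hu
    exact ⟨J T β w, (isIsoOnto hT hβ).mem w, J_J_of_nonneg hα.le hβ w⟩

theorem exists_HNorm_bounds {T α β : ℝ} (hT : 0 < T) (hα : 0 < α) (hβ : 0 ≤ β) :
    ∃ A B : ℝ, 0 < A ∧ 0 < B ∧ ∀ u ∈ H T β,
      HNorm T (α + β) (J T α u) ≤ A * HNorm T β u ∧
      HNorm T β u ≤ B * HNorm T (α + β) (J T α u) := by
  have hαβ := add_nonneg hα.le hβ
  obtain ⟨b, hb, hb'⟩ := (isIsoOnto hT hβ).bound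
  obtain ⟨c, hc, hc'⟩ := (isIsoOnto hT hαβ).bound
  obtain ⟨d, hd, hd'⟩ := (isIsoOnto hT hβ).surj
  obtain ⟨e, he, he'⟩ := (isIsoOnto hT hαβ).surj
  refine ⟨c * d, b * e, by positivity, by positivity, fun u hu => ?_⟩
  obtain ⟨w, rfl, hw⟩ := hd' u hu
  rw [J_J_of_nonneg hα.le hβ]
  constructor
  · rw [mul_assoc]
    exact (hc' w).trans (by gcongr)
  · obtain ⟨w', hww, hw'⟩ := he' _ ((isIsoOnto hT hαβ).mem w)
    rw [J_injective hT hαβ hww] at hw'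
    rw [mul_assoc]
    exact (hb' w).trans (by gcongr)

end FracSob
end

theorem mainTheorem4 (T : ℝ) (hT : 0 < T) :
    (∀ α β : ℝ, 0 < α → 0 ≤ β →
      (Set.BijOn (FracSob.J T α) (FracSob.H T β) (FracSob.H T (α + β)) ∧
        ∃ C₁ C₂ : ℝ, 0 < C₁ ∧ 0 < C₂ ∧ ∀ u ∈ FracSob.H T β,
          C₂ * FracSob.HNorm T (α + β) (FracSob.J T α u) ≤ FracSob.HNorm T β u ∧
          FracSob.HNorm T β u ≤ C₁ * FracSob.HNorm T (α + β) (FracSob.J T α u)) ∧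
      (Set.BijOn (FracSob.dt T α) (FracSob.H T (α + β)) (FracSob.H T β) ∧
        ∃ C₁ C₂ : ℝ, 0 < C₁ ∧ 0 < C₂ ∧ ∀ u ∈ FracSob.H T (α + β),
          C₂ * FracSob.HNorm T β (FracSob.dt T α u) ≤ FracSob.HNorm T (α + β) u ∧
          FracSob.HNorm T (α + β) u ≤ C₁ * FracSob.HNorm T β (FracSob.dt T α u))) ∧
    (∀ γ : ℝ, 0 < γ →
      (Set.BijOn (FracSob.J T γ) Set.univ (FracSob.H T γ) ∧
        ∃ C₁ C₂ : ℝ, 0 < C₁ ∧ 0 < C₂ ∧ ∀ v : FracSob.L2 T,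
          C₂ * FracSob.HNorm T γ (FracSob.J T γ v) ≤ ‖v‖ ∧
          ‖v‖ ≤ C₁ * FracSob.HNorm T γ (FracSob.J T γ v)) ∧
      (∀ v : FracSob.L2 T, FracSob.dt T γ (FracSob.J T γ v) = v) ∧
      (∀ u ∈ FracSob.H T γ, FracSob.J T γ (FracSob.dt T γ u) = u) ∧
      ∃ C₁ C₂ : ℝ, 0 < C₁ ∧ 0 < C₂ ∧ ∀ u ∈ FracSob.H T γ,
        C₂ * ‖FracSob.dt T γ u‖ ≤ FracSob.HNorm T γ u ∧
        FracSob.HNorm T γ u ≤ C₁ * ‖FracSob.dt T γ u‖) := by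
  have hA : ∀ α β : ℝ, 0 < α → 0 ≤ β →
      (Set.BijOn (FracSob.J T α) (FracSob.H T β) (FracSob.H T (α + β)) ∧
        ∃ C₁ C₂ : ℝ, 0 < C₁ ∧ 0 < C₂ ∧ ∀ u ∈ FracSob.H T β,
          C₂ * FracSob.HNorm T (α + β) (FracSob.J T α u) ≤ FracSob.HNorm T β u ∧
          FracSob.HNorm T β u ≤ C₁ * FracSob.HNorm T (α + β) (FracSob.J T α u)) ∧
      (Set.BijOn (FracSob.dt T α) (FracSob.H T (α + β)) (FracSob.H T β) ∧
        ∃ C₁ C₂ : ℝ, 0 < C₁ ∧ 0 < C₂ ∧ ∀ u ∈ FracSob.H T (α + β),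
          C₂ * FracSob.HNorm T β (FracSob.dt T α u) ≤ FracSob.HNorm T (α + β) u ∧
          FracSob.HNorm T (α + β) u ≤ C₁ * FracSob.HNorm T β (FracSob.dt T α u)) := by
    intro α β hα hβ
    have hbij := FracSob.bijOn_J hT hα hβ
    have hinv : Set.InvOn (FracSob.dt T α) (FracSob.J T α) (FracSob.H T β)
        (FracSob.H T (α + β)) := by
      refine ⟨fun v _ => FracSob.dt_J hT hα.le v, fun u hu => ?_⟩
      obtain ⟨x, -, rfl⟩ := hbij.surjOn hu
      rw [FracSob.dt_J hT hα.le]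
    obtain ⟨A, B, hA, hB, h⟩ := FracSob.exists_HNorm_bounds hT hα hβ
    have h1 : ∀ u ∈ FracSob.H T β,
        A⁻¹ * FracSob.HNorm T (α + β) (FracSob.J T α u) ≤ FracSob.HNorm T β u := fun u hu => by
      rw [inv_mul_le_iff₀ hA]
      exact (h u hu).1
    have h2 : ∀ u ∈ FracSob.H T β,
        B⁻¹ * FracSob.HNorm T β u ≤ FracSob.HNorm T (α + β) (FracSob.J T α u) := fun u hu => by
      rw [inv_mul_le_iff₀ hB]
      exact (h u hu).2
    refine ⟨⟨hbij, B, A⁻¹, hB, inv_pos.2 hA, fun u hu => ⟨h1 u hu, (h u hu).2⟩⟩,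
      hbij.symm hinv.symm, A, B⁻¹, hA, inv_pos.2 hB, fun u hu => ?_⟩
    obtain ⟨x, hx, rfl⟩ := hbij.surjOn hu
    rw [FracSob.dt_J hT hα.le]
    exact ⟨h2 x hx, (h x hx).1⟩
  refine ⟨hA, fun γ hγ => ?_⟩
  -- the assertions about a single order are the case `β = 0`, as `H_0(0,T) = L²(0,T)`
  obtain ⟨⟨hbij, hn⟩, -, hn'⟩ := hA γ 0 hγ le_rfl
  simp only [add_zero, FracSob.H_zero, FracSob.HNorm_zero, Set.mem_univ, true_implies]
    at hbij hn hn'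
  refine ⟨⟨hbij, hn⟩, FracSob.dt_J hT hγ.le, fun u hu => ?_, hn'⟩
  obtain ⟨x, -, rfl⟩ := hbij.surjOn hu
  rw [FracSob.dt_J hT hγ.le]
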